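/- Conventions. Let $\overline X^{n+1}$ be a compact smooth manifold with non-empty boundary $M=\partial\overline X$ and interior $X$. A defining function for $M$ is a smooth function $r$ on $\overline X$ with $r>0$ on $X$, $r=0$ on $M$ and $dr\neq0$ on $M$. A complete Riemannian metric $g_+$ on $X$ is conformally compact of order $C^{m,\alpha}$ if, for some defining function $r$, the metric $r^2g_+$ extends to a Riemannian metric of class $C^{m,\alpha}$ on $\overline X$. It is asymptotically hyperbolic with asymptotic sectional curvature $K$, where $K<0$ is a constant, if it is conformally compact and its sectional curvatures tend to $K$ at $M$, uniformly over all tangent $2$-planes. (If the metric is only $C^1$, as the metric induced by a $C^2$ immersion may be, its curvature tensor is the continuous tensor that represents the curvature in the sense of distributions; for $C^2$ metrics this is the classical curvature tensor.) Let $(X^{n+1},g_+)$ be asymptotically hyperbolic with asymptotic sectional curvature $-1$ and conformally compact of order $C^{3,\alpha}$. Let $\overline Y^{k+1}$ be a compact smooth manifold with non-empty boundary and interior $Y$, and let $\iota:\overline Y\to\overline X$ be a $C^{2,\beta}$ immersion ($\alpha,\beta\in(0,1]$) with $\iota(Y)\subset X$ and $\iota(\partial\overline Y)\subset M$ that is transversal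 to $M$ along $\partial\overline Y$, and such that $(Y,\iota^*g_+)$ is conformally compact of order $C^{m,\beta}$ for some $m\ge1$. Let $H$ be the mean curvature vector of $\iota:Y\to(X,g_+)$, that is, the trace of the second fundamental form. Suppose that $Y$ is asymptotically CMC with asymptotic mean curvature $C\in[0,\infty)$, that is, $$g_+(H,H)=C^2+O(r)\quad\text{at }\partial\overline Y$$ for a (equivalently, any) defining function $r$ for $M$. Then $C<k+1$, and $(Y,\iota^*g_+)$ is asymptotically hyperbolic (conformally compact of order $C^{m,\beta}$) with asymptotic sectional curvature $$-\left(1-\frac{C^2}{(k+1)^2}\right).$$ In particular, if $Y$ is asymptotically minimal ($C=0$), then $(Y,\iota^*g_+)$ is asymptotically hyperbolic with asymptotic sectional curvature $-1$. -/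

import Mathlib

open scoped Manifold ContDiff Topology NNReal ENNReal
open Set Filter MeasureTheory

namespace AHGeometry

noncomputable section

/-! ### Riemannian calculus in coordinates -/

/-- The model vector space of dimension `d + 1`. -/
abbrev Vec (d : ℕ) : Type := EuclideanSpace ℝ (Fin (d + 1))

/-- Bilinear forms on the model vector space. -/
abbrev Bilin (d : ℕ) : Type := Vec d →L[ℝ] Vec d →L[ℝ] ℝ

/-- `f` is of class `C^{m,α}` on `s`: it is `C^m` on `s` and its `m`-th derivative is
locally `α`-Hölder on `s`. -/
def HolderContDiffOn {E F : Type*} [NormedAddCommGroup E] [NormedSpace ℝ E]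
    [NormedAddCommGroup F] [NormedSpace ℝ F] (m : ℕ) (α : ℝ≥0) (f : E → F) (s : Set E) : Prop :=
  ContDiffOn ℝ m f s ∧
    ∀ x ∈ s, ∃ c : ℝ≥0, ∃ U ∈ 𝓝[s] x, HolderOnWith c α (iteratedFDerivWithin ℝ m f s) U

/-- Christoffel symbols of the first kind of the metric `G`: the covector
`w ↦ (∂_u G(v, w) + ∂_v G(u, w) - ∂_w G(u, v)) / 2`. -/
def christoffelLower {d : ℕ} (G : Vec d → Bilin d) (x u v : Vec d) : Vec d →L[ℝ] ℝ :=
  (1 / 2 : ℝ) • (fderiv ℝ G x u v + fderiv ℝ G x v u - ((fderiv ℝ G x).flip u).flip v)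

/-- Christoffel symbols of the second kind: the vector `Γ(u, v)` with
`G(Γ(u, v), w) = christoffelLower G x u v w` for all `w`. -/
def christoffel {d : ℕ} (G : Vec d → Bilin d) (x u v : Vec d) : Vec d :=
  (G x).inverse (christoffelLower G x u v)

/-- The entries `h_{ij}` of the metric induced at `q` by the map `F` from the metric `G`. -/
def inducedGram {k n : ℕ} (G : Vec n → Bilin n) (F : Vec k → Vec n) (q : Vec k) :
    Matrix (Fin (k + 1)) (Fin (k + 1)) ℝ :=
  Matrix.of fun i j =>
    G (F q) (fderiv ℝ F q (EuclideanSpace.single i 1)) (fderiv ℝ F q (EuclideanSpace.single j 1))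

/-- The projection of `v` on the `G`-orthogonal complement of the image of `dF` at `q`:
`v - h^{ij} G(v, ∂_i F) ∂_j F`. -/
def normalProj {k n : ℕ} (G : Vec n → Bilin n) (F : Vec k → Vec n) (q : Vec k) (v : Vec n) :
    Vec n :=
  v - ∑ i, ∑ j, ((inducedGram G F q)⁻¹ i j *
    G (F q) v (fderiv ℝ F q (EuclideanSpace.single i 1))) •
      fderiv ℝ F q (EuclideanSpace.single j 1)

/-- The vector-valued second fundamental form of the immersion `F` for the metric `G`: the normal
part of `∇_u (dF v) = D²F(u, v) + Γ(dF u, dF v)`. -/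
def secondFundamentalForm {k n : ℕ} (G : Vec n → Bilin n) (F : Vec k → Vec n) (q u v : Vec k) :
    Vec n :=
  normalProj G F q (fderiv ℝ (fderiv ℝ F) q u v +
    christoffel G (F q) (fderiv ℝ F q u) (fderiv ℝ F q v))

/-- The mean curvature vector `H = h^{ij} II(∂_i, ∂_j)` (the trace, not the average). -/
def meanCurvatureVector {k n : ℕ} (G : Vec n → Bilin n) (F : Vec k → Vec n) (q : Vec k) : Vec n :=
  ∑ i, ∑ j, (inducedGram G F q)⁻¹ i j •
    secondFundamentalForm G F q (EuclideanSpace.single i 1) (EuclideanSpace.single j 1)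

/-! ### Metrics on a manifold with boundary -/

section Manifold

variable {d : ℕ} {X : Type*} [TopologicalSpace X] [ChartedSpace (EuclideanHalfSpace (d + 1)) X]

/-- Fields of bilinear forms on the tangent spaces of a manifold with boundary. The tangent space
`TangentSpace (𝓡∂ (d + 1)) x` is by definition a copy of the model vector space `Vec d`, identified
with it by the chart at `x`. -/
abbrev BilinField (d : ℕ) (X : Type*) : Type _ := X → Bilin d

/-- Fields of covariant 4-tensors on the tangent spaces. -/
abbrev FourTensorField (d : ℕ) (X : Type*) : Type _ :=
  X → ContinuousMultilinearMap ℝ (fun _ : Fin 4 => Vec d) ℝ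

/-- The differential at `y` of the inverse of the chart around `p`. -/
def chartInvDeriv (p : X) (y : Vec d) :
    Vec d →L[ℝ] Vec d :=
  mfderivWithin 𝓘(ℝ, Vec d) (𝓡∂ (d + 1)) (extChartAt (𝓡∂ (d + 1)) p).symm
    (range (𝓡∂ (d + 1))) y

/-- The components of `g` in the chart around `p`. -/
def chartMetric (g : BilinField d X) (p : X) (y : Vec d) : Bilin d :=
  (g ((extChartAt (𝓡∂ (d + 1)) p).symm y)).bilinearComp (chartInvDeriv p y) (chartInvDeriv p y)

/-- `g` is symmetric and positive definite at every point of `s`. -/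
def IsMetricOn (g : BilinField d X) (s : Set X) : Prop :=
  ∀ x ∈ s, (∀ v w, g x v w = g x w v) ∧ ∀ v, v ≠ 0 → 0 < g x v v

/-- The components of `g` in the charts are of class `C^{m,α}`, up to the boundary. -/
def IsHolderField (m : ℕ) (α : ℝ≥0) (g : BilinField d X) : Prop :=
  ∀ p : X, HolderContDiffOn m α (chartMetric g p) (extChartAt (𝓡∂ (d + 1)) p).target

/-- The tangent space of the boundary at a boundary point `x`: in the chart at `x`, the vectors
whose coordinate transversal to the boundary vanishes. -/
def boundaryTangent (x : X) : Submodule ℝ (TangentSpace (𝓡∂ (d + 1)) x) :=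
  LinearMap.ker (((EuclideanSpace.proj (0 : Fin (d + 1)) : Vec d →L[ℝ] ℝ).comp
    (mfderiv (𝓡∂ (d + 1)) 𝓘(ℝ, Vec d) (extChartAt (𝓡∂ (d + 1)) x) x)).toLinearMap)

/-- Smooth defining functions of the boundary. -/
def IsDefiningFunction (d : ℕ) {X : Type*} [TopologicalSpace X]
    [ChartedSpace (EuclideanHalfSpace (d + 1)) X] (r : X → ℝ) : Prop :=
  ContMDiff (𝓡∂ (d + 1)) 𝓘(ℝ, ℝ) ∞ r ∧
  (∀ x ∈ (𝓡∂ (d + 1)).interior X, 0 < r x) ∧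
  ∀ x ∈ (𝓡∂ (d + 1)).boundary X, r x = 0 ∧ mfderiv (𝓡∂ (d + 1)) 𝓘(ℝ, ℝ) r x ≠ 0

/-- The length of a path `γ : [0, 1] → X`. -/
def pathLength (g : BilinField d X) (γ : ℝ → X) : ℝ≥0∞ :=
  ∫⁻ t in Icc (0 : ℝ) 1, ENNReal.ofReal (Real.sqrt (g (γ t)
    (mfderivWithin 𝓘(ℝ, ℝ) (𝓡∂ (d + 1)) γ (Icc 0 1) t (1 : ℝ))
    (mfderivWithin 𝓘(ℝ, ℝ) (𝓡∂ (d + 1)) γ (Icc 0 1) t (1 : ℝ))))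

/-- The Riemannian distance of the interior of `X`: the infimum of the lengths of the `C^1` paths
that stay in the interior. -/
def interiorDist (g : BilinField d X) (x y : X) : ℝ≥0∞ :=
  ⨅ (γ : ℝ → X) (_ : ContMDiffOn 𝓘(ℝ, ℝ) (𝓡∂ (d + 1)) 1 γ (Icc 0 1) ∧
    (∀ t ∈ Icc (0 : ℝ) 1, γ t ∈ (𝓡∂ (d + 1)).interior X) ∧ γ 0 = x ∧ γ 1 = y), pathLength g γ

/-- The interior of `X` with the metric `g` is complete: Cauchy sequences converge. -/
def IsCompleteMetric (g : BilinField d X) : Prop :=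
  ∀ u : ℕ → X, (∀ i, u i ∈ (𝓡∂ (d + 1)).interior X) →
    (∀ ε : ℝ≥0∞, 0 < ε → ∃ N, ∀ i ≥ N, ∀ j ≥ N, interiorDist g (u i) (u j) < ε) →
    ∃ x ∈ (𝓡∂ (d + 1)).interior X, Tendsto u atTop (𝓝 x)

/-- `g`, of which only the values at interior points matter, is a complete Riemannian metric on
the interior of `X` that is conformally compact of order `C^{m,α}`: for some defining function
`r`, the metric `r² g` extends to a `C^{m,α}` metric `gbar` on `X`. The boundary is not empty. -/
def IsConformallyCompact (m : ℕ) (α : ℝ≥0) (g : BilinField d X) : Prop :=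
  ((𝓡∂ (d + 1)).boundary X).Nonempty ∧
  IsMetricOn g ((𝓡∂ (d + 1)).interior X) ∧
  IsCompleteMetric g ∧
  ∃ r : X → ℝ, IsDefiningFunction d r ∧
    ∃ gbar : BilinField d X, IsMetricOn gbar univ ∧ IsHolderField m α gbar ∧
      ∀ x ∈ (𝓡∂ (d + 1)).interior X, gbar x = (r x) ^ 2 • g x

/-- `Rm` is the curvature tensor `Rm(u, v, w, z) = g(R(u, v) w, z)`,
`R(u, v) = [∇_u, ∇_v] - ∇_{[u, v]}`, of the (at least `C^1`) metric `g` on the interior of `X`: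
it is continuous there, and in the charts it satisfies the classical formula
`Rm(u, v, w, z) = ∂_u Γ(v, w; z) - ∂_v Γ(u, w; z) + g(Γ(u, w), Γ(v, z)) - g(Γ(v, w), Γ(u, z))`
in the sense of distributions. For a `C^2` metric, integration by parts shows that this is the
classical curvature tensor; the metric that a `C^2` immersion induces is in general only `C^1`. -/
def IsCurvatureTensor (g : BilinField d X) (Rm : FourTensorField d X) : Prop :=
  ∀ (p : X) (u v w z : Vec d),
    let Ω : Set (Vec d) := interior (extChartAt (𝓡∂ (d + 1)) p).target
    let G : Vec d → Bilin d := chartMetric g p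
    let K : Vec d → ℝ := fun y => Rm ((extChartAt (𝓡∂ (d + 1)) p).symm y)
      ![chartInvDeriv p y u, chartInvDeriv p y v, chartInvDeriv p y w, chartInvDeriv p y z]
    ContinuousOn K Ω ∧
    ∀ φ : Vec d → ℝ, ContDiff ℝ ∞ φ → HasCompactSupport φ → tsupport φ ⊆ Ω →
      ∫ y, φ y * K y =
        ∫ y, (- (fderiv ℝ φ y u) * christoffelLower G y v w z
          + fderiv ℝ φ y v * christoffelLower G y u w z
          + φ y * (G y (christoffel G y u w) (christoffel G y v z)
            - G y (christoffel G y v w) (christoffel G y u z)))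

/-- The sectional curvature of the plane spanned by `u` and `v`. -/
def sectional (g : BilinField d X) (Rm : FourTensorField d X) (x : X)
    (u v : Vec d) : ℝ :=
  Rm x ![u, v, v, u] / (g x u u * g x v v - g x u v ^ 2)

/-- Asymptotically hyperbolic metrics (with compactification of class `C^{m,α}`), with asymptotic
sectional curvature `K < 0`: conformally compact metrics whose sectional curvatures tend to `K`
at the boundary, uniformly over all tangent planes. -/
def IsAsymptoticallyHyperbolic (m : ℕ) (α : ℝ≥0) (g : BilinField d X) (K : ℝ) : Prop :=
  IsConformallyCompact m α g ∧ K < 0 ∧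
  ∃ Rm : FourTensorField d X, IsCurvatureTensor g Rm ∧
    ∀ ε > 0, ∀ᶠ x in 𝓝ˢ ((𝓡∂ (d + 1)).boundary X), x ∈ (𝓡∂ (d + 1)).interior X →
      ∀ u v : Vec d, LinearIndependent ℝ ![u, v] →
        |sectional g Rm x u v - K| < ε

end Manifold

/-! ### Submanifolds -/

section Submanifold

variable {n k : ℕ} {X : Type*} [TopologicalSpace X] [ChartedSpace (EuclideanHalfSpace (n + 1)) X]
  {Y : Type*} [TopologicalSpace Y] [ChartedSpace (EuclideanHalfSpace (k + 1)) Y]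

/-- Maps of class `C^{m,α}` between manifolds with boundary. -/
def IsHolderMap (k n : ℕ) {X : Type*} [TopologicalSpace X]
    [ChartedSpace (EuclideanHalfSpace (n + 1)) X] {Y : Type*} [TopologicalSpace Y]
    [ChartedSpace (EuclideanHalfSpace (k + 1)) Y] (m : ℕ) (α : ℝ≥0) (f : Y → X) : Prop :=
  Continuous f ∧ ∀ p : Y,
    HolderContDiffOn m α (writtenInExtChartAt (𝓡∂ (k + 1)) (𝓡∂ (n + 1)) p f)
      ((extChartAt (𝓡∂ (k + 1)) p).target ∩
        (extChartAt (𝓡∂ (k + 1)) p).symm ⁻¹' (f ⁻¹' (extChartAt (𝓡∂ (n + 1)) (f p)).source))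

/-- The pullback `f^* g`. -/
def pullback (g : BilinField n X) (f : Y → X) : BilinField k Y := fun y =>
  let D : Vec k →L[ℝ] Vec n := mfderiv (𝓡∂ (k + 1)) (𝓡∂ (n + 1)) f y
  (g (f y)).bilinearComp D D

/-- `g(H, H)` at the interior point `y`, where `H` is the mean curvature vector of the immersion
`f` for the metric `g`, computed in the charts around `y` and `f y`. -/
def meanCurvatureNormSq (k : ℕ) {n : ℕ} {X : Type*} [TopologicalSpace X]
    [ChartedSpace (EuclideanHalfSpace (n + 1)) X] {Y : Type*} [TopologicalSpace Y]
    [ChartedSpace (EuclideanHalfSpace (k + 1)) Y] (g : BilinField n X) (f : Y → X) (y : Y) : ℝ :=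
  let F : Vec k → Vec n := writtenInExtChartAt (𝓡∂ (k + 1)) (𝓡∂ (n + 1)) y f
  let q : Vec k := extChartAt (𝓡∂ (k + 1)) y y
  let H : Vec n := meanCurvatureVector (chartMetric g (f y)) F q
  chartMetric g (f y) (F q) H H

/-- `f : Y → X` makes the interior of `Y` a conformally compact submanifold of the interior of
`X`: `f` is a `C^{2,α}` immersion that maps the interior of `Y` into the interior of `X` and the
boundary of `Y` into the boundary of `X` (hence is also an immersion between the boundaries), it
is transversal to the boundary of `X`, and `f^* g` is conformally compact of order `C^{m,α}`. -/
def IsConformallyCompactSubmanifold (k m : ℕ) (α : ℝ≥0) {n : ℕ} {X : Type*} [TopologicalSpace X]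
    [ChartedSpace (EuclideanHalfSpace (n + 1)) X] {Y : Type*} [TopologicalSpace Y]
    [ChartedSpace (EuclideanHalfSpace (k + 1)) Y] (g : BilinField n X) (f : Y → X) : Prop :=
  IsHolderMap k n 2 α f ∧
  (∀ y, Function.Injective (mfderiv (𝓡∂ (k + 1)) (𝓡∂ (n + 1)) f y)) ∧
  (∀ y ∈ (𝓡∂ (k + 1)).interior Y, f y ∈ (𝓡∂ (n + 1)).interior X) ∧
  (∀ y ∈ (𝓡∂ (k + 1)).boundary Y, f y ∈ (𝓡∂ (n + 1)).boundary X) ∧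
  (∀ y ∈ (𝓡∂ (k + 1)).boundary Y,
    LinearMap.range (mfderiv (𝓡∂ (k + 1)) (𝓡∂ (n + 1)) f y).toLinearMap
      ⊔ boundaryTangent (f y) = ⊤) ∧
  IsConformallyCompact m α (pullback g f : BilinField k Y)

/-- The conformally compact submanifold `f : Y → X` is asymptotically CMC with asymptotic mean
curvature `C`: `g(H, H) = C² + O(r)` at the boundary of `Y`, for a defining function `r` of the
boundary of `X` (the choice of which does not matter). -/
def IsAsymptoticallyCMC (k m : ℕ) (α : ℝ≥0) {n : ℕ} {X : Type*} [TopologicalSpace X]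
    [ChartedSpace (EuclideanHalfSpace (n + 1)) X] {Y : Type*} [TopologicalSpace Y]
    [ChartedSpace (EuclideanHalfSpace (k + 1)) Y] (g : BilinField n X) (f : Y → X) (C : ℝ) :
    Prop :=
  IsConformallyCompactSubmanifold k m α g f ∧ 0 ≤ C ∧
  ∃ r : X → ℝ, IsDefiningFunction n r ∧
    (fun y => meanCurvatureNormSq k g f y - C ^ 2)
      =O[𝓝ˢ ((𝓡∂ (k + 1)).boundary Y) ⊓ 𝓟 ((𝓡∂ (k + 1)).interior Y)] (fun y => r (f y))

end Submanifold

end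

end AHGeometry

/-!
The proof computes the curvature of `Y` from the Gauss equation and reads off its limit at `∂Y` from
the compactified metric `gbar = r² g`.

*The curvature of `Y`.* The pullback metric is only of class `C¹`, so its curvature is a
distribution. It is represented by the continuous tensor `immersionCurv`: the ambient curvature on
tangent vectors plus the quadratic expression in the second fundamental form. In charts
(`gauss_weak`), the classical derivation of the Gauss equation uses third derivatives of the
immersion only through `∂_u ∂_v ∂_w F = ∂_v ∂_u ∂_w F`. For the `C¹` function `∂_w F` this symmetry
holds in the sense of distributions (`integral_fderiv_fderiv_comm`), and the remaining derivatives
are moved to the test function by integration by parts. The identity is local (`weak_of_local`),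
and hence holds on the whole chart of `Y`
(`IsInteriorImmersion.isCurvatureTensor_immersionCurv`).

*The length of `dr`.* For `g = r⁻² gbar` the sectional curvatures tend to `-|dr|²` at the boundary,
where the length is that of `gbar` (`tendsto_classicalCurv_boundary`). Asymptotic curvature `-1`
therefore means `|dr| = 1` along `∂X` (`IsCompactification.inverse_fderivWithin_eq_one`).

*The second fundamental form.* Let `N` be the part of the `gbar`-gradient of `r` that is normal to
`Y`. Under the conformal change of the metric, `r · II = r · IIbar + hbar · N`, where `hbar` is the
metric that `gbar` induces on `Y` (`secondFundamentalForm_conformal`). The right-hand side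
(`ImmersionJet.scaledForm`) is continuous up to the boundary, where it equals `hbar · N`. Taking
traces gives `|H|² → (k + 1)² |N|²` (`ImmersionJet.tendsto_trace`), so the hypothesis on `H` means
that `|N|² = C² / (k + 1)²` on `∂Y` (`IsTransversalImmersion.boundaryNormalSq_eq`). The
contribution of `II` to the sectional curvatures of `Y` tends to `|N|²`, uniformly over all planes
(`ImmersionJet.eventually_gaussTerm`), so that they tend to `-1 + C² / (k + 1)²`
(`IsTransversalImmersion.eventually_sectional`).

*The bound on `C`.* By transversality `dr` does not vanish on the tangent spaces of `Y` along `∂Y`,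
so the gradient of `r` has a non-zero tangential part and `|N| < |dr| = 1`
(`IsTransversalImmersion.boundaryNormalSq_lt_one`), which is `C < k + 1`. If `X` has dimension one,
its sectional curvatures carry no information about `|dr|`, but then `N = 0`
because `Y` has the same dimension.
-/

namespace AHGeometry

noncomputable section

set_option maxSynthPendingDepth 3

/-! ### Positive definite forms and orthogonal projections -/

/-- `B` is an inner product: symmetric and positive definite. -/
def IsInner {d : ℕ} (B : Bilin d) : Prop :=
  (∀ v w, B v w = B w v) ∧ ∀ v, v ≠ 0 → 0 < B v v

/-- The coordinate vectors of the model space. -/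
abbrev stdVec {d : ℕ} (i : Fin (d + 1)) : Vec d := EuclideanSpace.single i (1 : ℝ)

lemma sum_smul_stdVec {d : ℕ} (v : Vec d) : ∑ i, v i • stdVec i = v := by
  ext j
  simp [Pi.single_apply]

lemma IsInner.isInvertible {d : ℕ} {B : Bilin d} (hB : IsInner B) :
    ContinuousLinearMap.IsInvertible B := by
  let A : Vec d →ₗ[ℝ] Vec d :=
    (InnerProductSpace.toDual ℝ (Vec d)).symm.toLinearEquiv.toLinearMap ∘ₗ B.toLinearMap
  have hA : Function.Injective A := by
    rw [← LinearMap.ker_eq_bot, LinearMap.ker_eq_bot']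
    intro v hv
    by_contra hne
    have h0 : B v = 0 := by
      have := (InnerProductSpace.toDual ℝ (Vec d)).symm.map_eq_zero_iff.1 (hv : _ = (0 : Vec d))
      exact this
    have := hB.2 v hne
    simp [h0] at this
  refine ⟨(LinearEquiv.ofInjectiveEndo A hA).toContinuousLinearEquiv.trans
    (InnerProductSpace.toDual ℝ (Vec d)).toContinuousLinearEquiv, ?_⟩
  ext v w
  simp [A]

lemma IsInner.apply_inverse {d : ℕ} {B : Bilin d} (hB : IsInner B) (c : Vec d →L[ℝ] ℝ) :
    B (B.inverse c) = c := by
  obtain ⟨e, he⟩ := hB.isInvertible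
  rw [← he]; simp

lemma IsInner.ext {d : ℕ} {B : Bilin d} (hB : IsInner B) {v w : Vec d}
    (h : ∀ x, B v x = B w x) : v = w := by
  by_contra hne
  have h1 := hB.2 (v - w) (sub_ne_zero.2 hne)
  rw [map_sub B, sub_apply, h, sub_self] at h1
  exact lt_irrefl _ h1

lemma IsInner.eq_zero {d : ℕ} {B : Bilin d} (hB : IsInner B) {v : Vec d}
    (h : B v v = 0) : v = 0 := by
  by_contra hne
  exact (hB.2 v hne).ne' h

lemma IsInner.comp {k n : ℕ} {B : Bilin n} (hB : IsInner B) {D : Vec k →L[ℝ] Vec n}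
    (hD : Function.Injective D) : IsInner (B.bilinearComp D D) := by
  refine ⟨fun v w => hB.1 _ _, fun v hv => hB.2 _ ?_⟩
  exact fun h => hv (hD (by simpa using h))

lemma IsInner.smul {d : ℕ} {B : Bilin d} (hB : IsInner B) {c : ℝ} (hc : 0 < c) :
    IsInner (c • B) := by
  refine ⟨fun v w => by simp [hB.1 v w], fun v hv => ?_⟩
  have := hB.2 v hv
  simp only [smul_apply, smul_eq_mul]
  positivity

/-- The Gram matrix of the coordinate vectors for the form `B(D ·, D ·)`. -/
def gram {k n : ℕ} (B : Bilin n) (D : Vec k →L[ℝ] Vec n) :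
    Matrix (Fin (k + 1)) (Fin (k + 1)) ℝ :=
  Matrix.of fun i j => B (D (stdVec i)) (D (stdVec j))

/-- The `B`-orthogonal projection on the complement of the range of `D`. -/
def nproj {k n : ℕ} (B : Bilin n) (D : Vec k →L[ℝ] Vec n) (v : Vec n) : Vec n :=
  v - ∑ i, ∑ j, ((gram B D)⁻¹ i j * B v (D (stdVec i))) • D (stdVec j)

lemma gram_isUnit {k n : ℕ} {B : Bilin n} (hB : IsInner B) {D : Vec k →L[ℝ] Vec n}
    (hD : Function.Injective D) : IsUnit (gram B D).det := by
  rw [← Matrix.isUnit_iff_isUnit_det, ← Matrix.mulVec_injective_iff_isUnit]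
  have key : ∀ x : Fin (k + 1) → ℝ, (gram B D).mulVec x = 0 → x = 0 := by
    intro x hx
    have h1 : ∀ i, B (D (stdVec i)) (D (∑ j, x j • stdVec j)) = 0 := by
      intro i
      have := congrFun hx i
      simp only [Matrix.mulVec, dotProduct, gram, Matrix.of_apply, Pi.zero_apply] at this
      simp only [map_sum, map_smul, smul_eq_mul]
      rw [← this]
      exact Finset.sum_congr rfl fun j _ => mul_comm _ _
    have h2 : (∑ j, x j • stdVec j : Vec k) = 0 := by
      apply (hB.comp hD).eq_zero
      simp only [ContinuousLinearMap.bilinearComp_apply]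
      conv_lhs => rw [map_sum D, map_sum B, sum_apply]
      refine Finset.sum_eq_zero fun i _ => ?_
      rw [map_smul, map_smul, smul_apply, ← map_sum, h1, smul_zero]
    ext i
    have := congrArg (fun v : Vec k => v i) h2
    simpa [Pi.single_apply] using this
  intro x y hxy
  have := key (x - y) (by rw [Matrix.mulVec_sub, hxy, sub_self])
  exact sub_eq_zero.1 this

lemma gram_inv_mul {k n : ℕ} {B : Bilin n} (hB : IsInner B) {D : Vec k →L[ℝ] Vec n}
    (hD : Function.Injective D) : (gram B D)⁻¹ * gram B D = 1 :=
  Matrix.nonsing_inv_mul _ (gram_isUnit hB hD)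

lemma nproj_orthogonal {k n : ℕ} {B : Bilin n} (hB : IsInner B) {D : Vec k →L[ℝ] Vec n}
    (hD : Function.Injective D) (v : Vec n) (w : Vec k) : B (nproj B D v) (D w) = 0 := by
  have key : ∀ l, B (nproj B D v) (D (stdVec l)) = 0 := by
    intro l
    have h1 : ∀ i, ∑ j, (gram B D)⁻¹ i j * B (D (stdVec j)) (D (stdVec l)) =
        if i = l then 1 else 0 := by
      intro i
      have := congrFun (congrFun (gram_inv_mul hB hD) i) l
      rw [Matrix.mul_apply, Matrix.one_apply] at this
      exact this
    have h2 : ∑ i, ∑ j, ((gram B D)⁻¹ i j * B v (D (stdVec i))) * B (D (stdVec j)) (D (stdVec l))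
        = B v (D (stdVec l)) := by
      calc _ = ∑ i, B v (D (stdVec i)) *
            ∑ j, (gram B D)⁻¹ i j * B (D (stdVec j)) (D (stdVec l)) := by
            refine Finset.sum_congr rfl fun i _ => ?_
            rw [Finset.mul_sum]
            refine Finset.sum_congr rfl fun j _ => by ring
        _ = _ := by simp [h1]
    rw [nproj, map_sub, sub_apply, map_sum, sum_apply,
      sub_eq_zero, ← h2]
    refine Finset.sum_congr rfl fun i _ => ?_
    rw [map_sum, sum_apply]
    refine Finset.sum_congr rfl fun j _ => ?_
    simp
  rw [← sum_smul_stdVec w, map_sum, map_sum]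
  refine Finset.sum_eq_zero fun i _ => ?_
  rw [map_smul, map_smul, key, smul_zero]

lemma exists_sub_nproj {k n : ℕ} (B : Bilin n) (D : Vec k →L[ℝ] Vec n) (v : Vec n) :
    ∃ w, v - nproj B D v = D w := by
  refine ⟨∑ i, ∑ j, ((gram B D)⁻¹ i j * B v (D (stdVec i))) • stdVec j, ?_⟩
  simp [nproj, map_sum]

/-- The orthogonal projection is characterized by orthogonality and by the fact that it changes
a vector by an element of the range. -/
lemma nproj_unique {k n : ℕ} {B : Bilin n} (hB : IsInner B) {D : Vec k →L[ℝ] Vec n}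
    (hD : Function.Injective D) {v x : Vec n} (h1 : ∀ w, B x (D w) = 0)
    (h2 : ∃ w, v - x = D w) : x = nproj B D v := by
  obtain ⟨w, hw⟩ := h2
  obtain ⟨w', hw'⟩ := exists_sub_nproj B D v
  have h3 : x - nproj B D v = D (w' - w) := by rw [map_sub, ← hw, ← hw']; abel
  rw [← sub_eq_zero]
  apply hB.eq_zero
  rw [map_sub B, sub_apply, h3]
  rw [h1, nproj_orthogonal hB hD, sub_zero]

lemma nproj_range {k n : ℕ} {B : Bilin n} (hB : IsInner B) {D : Vec k →L[ℝ] Vec n}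
    (hD : Function.Injective D) (w : Vec k) : nproj B D (D w) = 0 :=
  (nproj_unique hB hD (x := 0) (by simp) ⟨w, by simp⟩).symm

lemma nproj_add {k n : ℕ} (B : Bilin n) (D : Vec k →L[ℝ] Vec n) (v w : Vec n) :
    nproj B D (v + w) = nproj B D v + nproj B D w := by
  simp only [nproj, map_add, add_apply, mul_add, add_smul,
    Finset.sum_add_distrib]
  abel

lemma nproj_smul {k n : ℕ} (B : Bilin n) (D : Vec k →L[ℝ] Vec n) (c : ℝ) (v : Vec n) :
    nproj B D (c • v) = c • nproj B D v := by
  simp only [nproj, map_smul, smul_apply, smul_sub, Finset.smul_sum,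
    smul_smul, smul_eq_mul]
  congr 1
  refine Finset.sum_congr rfl fun i _ => Finset.sum_congr rfl fun j _ => ?_
  congr 1; ring

lemma nproj_sub {k n : ℕ} (B : Bilin n) (D : Vec k →L[ℝ] Vec n) (v w : Vec n) :
    nproj B D (v - w) = nproj B D v - nproj B D w := by
  rw [sub_eq_add_neg, nproj_add, ← neg_one_smul ℝ w, nproj_smul]
  simp [sub_eq_add_neg]

/-- Pythagoras: the inner product splits into normal and tangential parts. -/
lemma nproj_inner {k n : ℕ} {B : Bilin n} (hB : IsInner B) {D : Vec k →L[ℝ] Vec n}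
    (hD : Function.Injective D) (v w : Vec n) :
    B v w = B (nproj B D v) (nproj B D w) + B (v - nproj B D v) (w - nproj B D w) := by
  obtain ⟨a, ha⟩ := exists_sub_nproj B D v
  obtain ⟨b, hb⟩ := exists_sub_nproj B D w
  have h1 := nproj_orthogonal hB hD v b
  have h2 := nproj_orthogonal hB hD w a
  rw [hB.1] at h2
  have hv : v = nproj B D v + D a := by rw [← ha]; abel
  have hw : w = nproj B D w + D b := by rw [← hb]; abel
  conv_lhs => rw [hv, hw]
  rw [ha, hb]
  simp only [map_add, add_apply, h1, h2]
  ring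

/-- The normal projection does not change under a conformal change of the metric. -/
lemma nproj_smul_metric {k n : ℕ} {B : Bilin n} (hB : IsInner B) {D : Vec k →L[ℝ] Vec n}
    (hD : Function.Injective D) {c : ℝ} (hc : 0 < c) (v : Vec n) :
    nproj (c • B) D v = nproj B D v := by
  refine nproj_unique hB hD (fun w => ?_) (exists_sub_nproj _ _ _)
  have := nproj_orthogonal (hB.smul hc) hD v w
  simpa [hc.ne'] using this

/-- The normal projection only depends on the range of `D`. -/
lemma nproj_comp_right {k n : ℕ} {B : Bilin n} (hB : IsInner B) {D : Vec k →L[ℝ] Vec n}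
    (hD : Function.Injective D) {L : Vec k →L[ℝ] Vec k} (hL : Function.Bijective L) (v : Vec n) :
    nproj B (D.comp L) v = nproj B D v := by
  have hDL : Function.Injective (D.comp L) := hD.comp hL.1
  refine nproj_unique hB hD (fun w => ?_) ?_
  · obtain ⟨w', rfl⟩ := hL.2 w
    exact nproj_orthogonal hB hDL v w'
  · obtain ⟨w, hw⟩ := exists_sub_nproj B (D.comp L) v
    exact ⟨L w, hw⟩

/-- Naturality of the normal projection under a linear change of the ambient space. -/
lemma nproj_comp_left {k n : ℕ} (B : Bilin n) (D : Vec k →L[ℝ] Vec n)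
    (S : Vec n →L[ℝ] Vec n) (v : Vec n) :
    nproj B (S.comp D) (S v) = S (nproj (B.bilinearComp S S) D v) := by
  simp [nproj, map_sum, gram]

/-- The trace of a vector-valued form with respect to the form `B(D ·, D ·)`. -/
def traceForm {k n : ℕ} (B : Bilin n) (D : Vec k →L[ℝ] Vec n) (b : Vec k → Vec k → Vec n) :
    Vec n :=
  ∑ i, ∑ j, (gram B D)⁻¹ i j • b (stdVec i) (stdVec j)

/-- The trace does not depend on the choice of coordinates. -/
lemma traceForm_comp {k n : ℕ} {B : Bilin n} (hB : IsInner B) {D : Vec k →L[ℝ] Vec n}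
    (hD : Function.Injective D) {L : Vec k →L[ℝ] Vec k} (hL : Function.Bijective L)
    {b : Vec k → Vec k → Vec n} (hb : IsBilinearMap ℝ b) :
    traceForm B (D.comp L) (fun u v => b (L u) (L v)) = traceForm B D b := by
  have hsum : ∀ c d : Fin (k + 1) → ℝ, b (∑ i, c i • stdVec i) (∑ j, d j • stdVec j) =
      ∑ i, ∑ j, (c i * d j) • b (stdVec i) (stdVec j) := by
    intro c d
    change hb.toLinearMap _ _ = ∑ i, ∑ j, (c i * d j) • hb.toLinearMap _ _
    simp only [map_sum, LinearMap.sum_apply, map_smul, LinearMap.smul_apply,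
      Finset.smul_sum, smul_smul]
    rw [Finset.sum_comm]
    refine Finset.sum_congr rfl fun i _ => Finset.sum_congr rfl fun j _ => by rw [mul_comm]
  set J : Matrix (Fin (k + 1)) (Fin (k + 1)) ℝ := Matrix.of fun a i => (L (stdVec i)) a with hJ
  have hLJ : ∀ i, L (stdVec i) = ∑ a, J a i • stdVec a := fun i =>
    (sum_smul_stdVec (L (stdVec i))).symm
  have hgram : gram B (D.comp L) = J.transpose * gram B D * J := by
    ext i j
    simp only [gram, Matrix.of_apply, ContinuousLinearMap.comp_apply, hLJ, map_sum, map_smul,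
      sum_apply, smul_apply, Matrix.mul_apply,
      Matrix.transpose_apply, smul_eq_mul, Finset.sum_mul]
    refine Finset.sum_congr rfl fun a _ => ?_
    rw [Finset.mul_sum]
    exact Finset.sum_congr rfl fun c _ => by ring
  have hJ : IsUnit J.det := by
    have h1 := gram_isUnit hB (D := D.comp L) (hD.comp hL.1)
    rw [hgram, Matrix.det_mul] at h1
    exact isUnit_of_mul_isUnit_right h1
  have hJt : IsUnit J.transpose.det := by rwa [Matrix.det_transpose]
  have hinv : J * (gram B (D.comp L))⁻¹ * J.transpose = (gram B D)⁻¹ := by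
    rw [hgram, Matrix.mul_inv_rev, Matrix.mul_inv_rev, ← Matrix.mul_assoc, ← Matrix.mul_assoc,
      Matrix.mul_nonsing_inv _ hJ, Matrix.one_mul, Matrix.mul_assoc,
      Matrix.nonsing_inv_mul _ hJt, Matrix.mul_one]
  simp only [traceForm, ← hinv, Matrix.mul_apply, Matrix.transpose_apply, hLJ, hsum,
    Finset.smul_sum, Finset.sum_smul, Finset.sum_mul, smul_smul]
  have hcomm : ∀ t : Fin (k + 1) → Fin (k + 1) → Fin (k + 1) → Fin (k + 1) → Vec n,
      ∑ i, ∑ j, ∑ a, ∑ c, t i j a c = ∑ a, ∑ c, ∑ j, ∑ i, t i j a c := by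
    intro t
    have h1 : ∀ i, ∑ j, ∑ a, ∑ c, t i j a c = ∑ a, ∑ c, ∑ j, t i j a c := fun i => by
      rw [Finset.sum_comm]
      exact Finset.sum_congr rfl fun a _ => Finset.sum_comm
    simp only [h1]
    rw [Finset.sum_comm]
    refine Finset.sum_congr rfl fun a _ => ?_
    rw [Finset.sum_comm]
    exact Finset.sum_congr rfl fun c _ => Finset.sum_comm
  rw [hcomm]
  refine Finset.sum_congr rfl fun a _ => Finset.sum_congr rfl fun c _ =>
    Finset.sum_congr rfl fun j _ => Finset.sum_congr rfl fun i _ => ?_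
  congr 1; ring

/-! ### Christoffel symbols and second fundamental forms -/

/-- Transposition of bilinear forms. -/
def flipForm (d : ℕ) : Bilin d →L[ℝ] Bilin d :=
  ((ContinuousLinearMap.flipₗᵢ ℝ (Vec d) (Vec d) ℝ).toContinuousLinearEquiv :
    Bilin d →L[ℝ] Bilin d)

/-- The Christoffel symbols of the first kind as a linear function of the derivative `T` of the
metric: `(T u v w + T v u w - T w u v) / 2`. -/
def chrL (d : ℕ) : (Vec d →L[ℝ] Bilin d) →L[ℝ] (Vec d →L[ℝ] Bilin d) :=
  (1 / 2 : ℝ) • (ContinuousLinearMap.id ℝ _ +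
    ((ContinuousLinearMap.flipₗᵢ ℝ (Vec d) (Vec d)
      (Vec d →L[ℝ] ℝ)).toContinuousLinearEquiv : _ →L[ℝ] _) -
    (ContinuousLinearMap.compL ℝ (Vec d) (Bilin d) (Bilin d) (flipForm d)).comp
      ((ContinuousLinearMap.flipₗᵢ ℝ (Vec d) (Vec d)
        (Vec d →L[ℝ] ℝ)).toContinuousLinearEquiv : _ →L[ℝ] _))

lemma chrL_apply {d : ℕ} (T : Vec d →L[ℝ] Bilin d) (u v w : Vec d) :
    chrL d T u v w = (1 / 2 : ℝ) * (T u v w + T v u w - T w u v) := by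
  simp [chrL, flipForm]

lemma christoffelLower_eq {d : ℕ} (G : Vec d → Bilin d) (x u v : Vec d) :
    christoffelLower G x u v = chrL d (fderiv ℝ G x) u v := by
  ext w
  rw [chrL_apply]
  simp [christoffelLower]

/-- The second fundamental form as a function of the metric `B`, its derivative `T`, and the
first two derivatives `D` and `S` of the immersion. -/
def secondForm {k n : ℕ} (B : Bilin n) (T : Vec n →L[ℝ] Bilin n) (D : Vec k →L[ℝ] Vec n)
    (S : Vec k →L[ℝ] Vec k →L[ℝ] Vec n) (u v : Vec k) : Vec n :=
  nproj B D (S u v + B.inverse (chrL n T (D u) (D v)))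

lemma secondFundamentalForm_eq {k n : ℕ} (G : Vec n → Bilin n) (F : Vec k → Vec n)
    (q u v : Vec k) :
    secondFundamentalForm G F q u v = secondForm (G (F q)) (fderiv ℝ G (F q)) (fderiv ℝ F q)
      (fderiv ℝ (fderiv ℝ F) q) u v := by
  rw [secondForm, ← christoffelLower_eq]
  rfl

lemma meanCurvatureVector_eq {k n : ℕ} (G : Vec n → Bilin n) (F : Vec k → Vec n) (q : Vec k) :
    meanCurvatureVector G F q =
      traceForm (G (F q)) (fderiv ℝ F q) (secondFundamentalForm G F q) := rfl

lemma isBilinearMap_secondForm {k n : ℕ} (B : Bilin n) (T : Vec n →L[ℝ] Bilin n)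
    (D : Vec k →L[ℝ] Vec n) (S : Vec k →L[ℝ] Vec k →L[ℝ] Vec n) :
    IsBilinearMap ℝ (secondForm B T D S) where
  add_left u u' v := by
    simp only [secondForm, ← nproj_add, map_add, add_apply]
    congr 1; abel
  smul_left c u v := by
    simp only [secondForm, ← nproj_smul, map_smul, smul_apply, smul_add]
  add_right u v v' := by
    simp only [secondForm, ← nproj_add, map_add]
    congr 1; abel
  smul_right c u v := by
    simp only [secondForm, ← nproj_smul, map_smul, smul_add]

lemma isBilinearMap_secondFundamentalForm {k n : ℕ} (G : Vec n → Bilin n) (F : Vec k → Vec n)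
    (q : Vec k) : IsBilinearMap ℝ (secondFundamentalForm G F q) := by
  have h : secondFundamentalForm G F q = secondForm (G (F q)) (fderiv ℝ G (F q)) (fderiv ℝ F q)
      (fderiv ℝ (fderiv ℝ F) q) := by
    funext u v
    exact secondFundamentalForm_eq G F q u v
  rw [h]
  exact isBilinearMap_secondForm _ _ _ _

/-- The metric induced by `F` from `G`. -/
def inducedMetric {k n : ℕ} (G : Vec n → Bilin n) (F : Vec k → Vec n) (q : Vec k) : Bilin k :=
  (G (F q)).bilinearComp (fderiv ℝ F q) (fderiv ℝ F q)

lemma contDiff_bilinearComp {k n : ℕ} {N : ℕ∞ω} :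
    ContDiff ℝ N (fun p : Bilin n × (Vec k →L[ℝ] Vec n) =>
      (p.1.bilinearComp p.2 p.2 : Bilin k)) := by
  let f1 : (Vec k →L[ℝ] Vec n →L[ℝ] ℝ) →L[ℝ] (Vec n →L[ℝ] Vec k →L[ℝ] ℝ) :=
    ((ContinuousLinearMap.flipₗᵢ ℝ (Vec k) (Vec n) ℝ).toContinuousLinearEquiv : _ →L[ℝ] _)
  have h : (fun p : Bilin n × (Vec k →L[ℝ] Vec n) => (p.1.bilinearComp p.2 p.2 : Bilin k)) =
      fun p => flipForm k ((f1 (p.1.comp p.2)).comp p.2) := by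
    ext p u v
    simp [f1, flipForm]
  rw [h]
  exact (flipForm k).contDiff.comp
    ((f1.contDiff.comp (contDiff_fst.clm_comp contDiff_snd)).clm_comp contDiff_snd)

lemma fderiv_bilin_apply {E : Type*} [NormedAddCommGroup E] [NormedSpace ℝ E] {d : ℕ}
    {G : E → Bilin d} {x : E} (hG : DifferentiableAt ℝ G x) (u : E) (v w : Vec d) :
    fderiv ℝ (fun y => G y v w) x u = fderiv ℝ G x u v w := by
  have h := ((hG.hasFDerivAt.clm_apply (hasFDerivAt_const v x)).clm_apply (hasFDerivAt_const w x))
  rw [h.fderiv]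
  simp

lemma fderiv_symm_of_symm {E : Type*} [NormedAddCommGroup E] [NormedSpace ℝ E] {d : ℕ}
    {G : E → Bilin d} {x : E} (hG : DifferentiableAt ℝ G x)
    (hs : ∀ᶠ y in 𝓝 x, ∀ v w, G y v w = G y w v) (u : E) (v w : Vec d) :
    fderiv ℝ G x u v w = fderiv ℝ G x u w v := by
  rw [← fderiv_bilin_apply hG, ← fderiv_bilin_apply hG]
  congr 1
  exact Filter.EventuallyEq.fderiv_eq (hs.mono fun y hy => hy v w)

lemma differentiableAt_inducedMetric {k n : ℕ} {G : Vec n → Bilin n} {F : Vec k → Vec n}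
    {q : Vec k} (hF : ContDiffAt ℝ 2 F q) (hG : DifferentiableAt ℝ G (F q)) :
    DifferentiableAt ℝ (inducedMetric G F) q := by
  have hD : DifferentiableAt ℝ (fderiv ℝ F) q :=
    (hF.fderiv_right (m := 1) (by norm_num)).differentiableAt (by norm_num)
  have h1 : DifferentiableAt ℝ (fun y => (G (F y), fderiv ℝ F y)) q :=
    (hG.comp q (hF.differentiableAt (by norm_num))).prodMk hD
  have h2 := (contDiff_bilinearComp (k := k) (n := n) (N := 1)).differentiable (by norm_num)
    (G (F q), fderiv ℝ F q)
  exact DifferentiableAt.comp (f := fun y => (G (F y), fderiv ℝ F y)) q h2 h1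

lemma fderiv_inducedMetric {k n : ℕ} {G : Vec n → Bilin n} {F : Vec k → Vec n}
    {q : Vec k} (hF : ContDiffAt ℝ 2 F q) (hG : DifferentiableAt ℝ G (F q)) (u v w : Vec k) :
    fderiv ℝ (inducedMetric G F) q u v w =
      fderiv ℝ G (F q) (fderiv ℝ F q u) (fderiv ℝ F q v) (fderiv ℝ F q w) +
      G (F q) (fderiv ℝ (fderiv ℝ F) q u v) (fderiv ℝ F q w) +
      G (F q) (fderiv ℝ F q v) (fderiv ℝ (fderiv ℝ F) q u w) := by
  have hD : DifferentiableAt ℝ (fderiv ℝ F) q :=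
    (hF.fderiv_right (m := 1) (by norm_num)).differentiableAt (by norm_num)
  rw [← fderiv_bilin_apply (differentiableAt_inducedMetric hF hG)]
  have h1 : HasFDerivAt (fun y => G (F y)) ((fderiv ℝ G (F q)).comp (fderiv ℝ F q)) q :=
    hG.hasFDerivAt.comp q (hF.differentiableAt (by norm_num)).hasFDerivAt
  have h2 := (h1.clm_apply (hD.hasFDerivAt.clm_apply (hasFDerivAt_const v q))).clm_apply
    (hD.hasFDerivAt.clm_apply (hasFDerivAt_const w q))
  have h3 : (fun y => inducedMetric G F y v w) =
      fun y => G (F y) (fderiv ℝ F y v) (fderiv ℝ F y w) := by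
    ext y; rfl
  rw [h3, h2.fderiv]
  simp
  ring

/-- The derivative of the tangent map along the immersion: `D²F(u, v) + Γ(dF u, dF v)`. -/
def covDeriv {k n : ℕ} (G : Vec n → Bilin n) (F : Vec k → Vec n) (q u v : Vec k) : Vec n :=
  fderiv ℝ (fderiv ℝ F) q u v + christoffel G (F q) (fderiv ℝ F q u) (fderiv ℝ F q v)

lemma secondFundamentalForm_eq_nproj {k n : ℕ} (G : Vec n → Bilin n) (F : Vec k → Vec n)
    (q u v : Vec k) : secondFundamentalForm G F q u v =
      nproj (G (F q)) (fderiv ℝ F q) (covDeriv G F q u v) := rfl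

lemma apply_christoffel {d : ℕ} {G : Vec d → Bilin d} {x : Vec d} (hG : IsInner (G x))
    (u v w : Vec d) : G x (christoffel G x u v) w = christoffelLower G x u v w := by
  rw [christoffel, hG.apply_inverse]

lemma fderiv_fderiv_symm {k n : ℕ} {F : Vec k → Vec n} {q : Vec k} (hF : ContDiffAt ℝ 2 F q)
    (u v : Vec k) : fderiv ℝ (fderiv ℝ F) q u v = fderiv ℝ (fderiv ℝ F) q v u :=
  (hF.isSymmSndFDerivAt (by simp)).eq u v

/-- The Christoffel symbols of an induced metric: the Levi-Civita connection of the submanifold is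
the tangential part of the ambient one. -/
lemma christoffelLower_inducedMetric {k n : ℕ} {G : Vec n → Bilin n} {F : Vec k → Vec n}
    {q : Vec k} (hF : ContDiffAt ℝ 2 F q) (hG : DifferentiableAt ℝ G (F q))
    (hi : ∀ᶠ x in 𝓝 (F q), IsInner (G x)) (u v w : Vec k) :
    christoffelLower (inducedMetric G F) q u v w =
      G (F q) (covDeriv G F q u v) (fderiv ℝ F q w) := by
  have hG0 := hi.self_of_nhds
  rw [covDeriv, map_add, add_apply, apply_christoffel hG0, christoffelLower_eq,
    christoffelLower_eq, chrL_apply, chrL_apply]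
  simp only [fderiv_inducedMetric hF hG]
  rw [fderiv_fderiv_symm hF v u, fderiv_fderiv_symm hF w u, fderiv_fderiv_symm hF w v,
    hG0.1 (fderiv ℝ F q u) (fderiv ℝ (fderiv ℝ F) q v w),
    hG0.1 (fderiv ℝ F q v) (fderiv ℝ (fderiv ℝ F) q u w)]
  ring

/-! ### Naturality -/

/-- The transformation law of the Christoffel symbols under the change of coordinates `s`. -/
lemma covDeriv_coordChange {d : ℕ} {G' : Vec d → Bilin d} {s : Vec d → Vec d} {x : Vec d}
    (hs : ContDiffAt ℝ 2 s x) (hbij : Function.Bijective (fderiv ℝ s x))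
    (hG' : DifferentiableAt ℝ G' (s x)) (hi : ∀ᶠ y in 𝓝 (s x), IsInner (G' y)) (u v : Vec d) :
    covDeriv G' s x u v = fderiv ℝ s x (christoffel (inducedMetric G' s) x u v) := by
  refine hi.self_of_nhds.ext fun y => ?_
  obtain ⟨w, rfl⟩ := hbij.2 y
  rw [← christoffelLower_inducedMetric hs hG' hi]
  have h1 : IsInner (inducedMetric G' s x) := hi.self_of_nhds.comp hbij.1
  rw [← apply_christoffel h1]
  rfl

lemma fderiv_fderiv_comp {a b c : ℕ} {F : Vec a → Vec b} {s : Vec b → Vec c} {q : Vec a}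
    (hF : ContDiffAt ℝ 2 F q) (hs : ContDiffAt ℝ 2 s (F q)) (u v : Vec a) :
    fderiv ℝ (fderiv ℝ (s ∘ F)) q u v =
      fderiv ℝ (fderiv ℝ s) (F q) (fderiv ℝ F q u) (fderiv ℝ F q v) +
        fderiv ℝ s (F q) (fderiv ℝ (fderiv ℝ F) q u v) := by
  have h1 : ∀ᶠ y in 𝓝 q, fderiv ℝ (s ∘ F) y = (fderiv ℝ s (F y)).comp (fderiv ℝ F y) := by
    have e1 := hF.eventually (by simp)
    have e2 := hF.continuousAt.eventually (hs.eventually (by simp))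
    filter_upwards [e1, e2] with y h1 h2
    exact fderiv_comp y (h2.differentiableAt (by norm_num)) (h1.differentiableAt (by norm_num))
  have hDs : DifferentiableAt ℝ (fderiv ℝ s) (F q) :=
    (hs.fderiv_right (m := 1) (by norm_num)).differentiableAt (by norm_num)
  have hDF : DifferentiableAt ℝ (fderiv ℝ F) q :=
    (hF.fderiv_right (m := 1) (by norm_num)).differentiableAt (by norm_num)
  rw [Filter.EventuallyEq.fderiv_eq h1]
  have h2 := (hDs.hasFDerivAt.comp q (hF.differentiableAt (by norm_num)).hasFDerivAt).clm_comp
    hDF.hasFDerivAt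
  erw [h2.fderiv]
  simp
  abel

/-- Naturality of the second fundamental form under a change `s` of the ambient coordinates. -/
lemma secondFundamentalForm_comp_left {k n : ℕ} {G' : Vec n → Bilin n} {s : Vec n → Vec n}
    {F : Vec k → Vec n} {q : Vec k} (hF : ContDiffAt ℝ 2 F q) (hs : ContDiffAt ℝ 2 s (F q))
    (hbij : Function.Bijective (fderiv ℝ s (F q)))
    (hG' : DifferentiableAt ℝ G' (s (F q))) (hi : ∀ᶠ y in 𝓝 (s (F q)), IsInner (G' y))
    (u v : Vec k) :
    secondFundamentalForm G' (s ∘ F) q u v =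
      fderiv ℝ s (F q) (secondFundamentalForm (inducedMetric G' s) F q u v) := by
  have hD : fderiv ℝ (s ∘ F) q = (fderiv ℝ s (F q)).comp (fderiv ℝ F q) :=
    fderiv_comp q (hs.differentiableAt (by norm_num)) (hF.differentiableAt (by norm_num))
  have hA : covDeriv G' (s ∘ F) q u v =
      fderiv ℝ s (F q) (covDeriv (inducedMetric G' s) F q u v) := by
    rw [covDeriv, covDeriv, map_add, ← covDeriv_coordChange hs hbij hG' hi,
      fderiv_fderiv_comp hF hs, covDeriv, hD]
    simp only [ContinuousLinearMap.comp_apply, Function.comp_apply]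
    abel
  rw [secondFundamentalForm_eq_nproj, secondFundamentalForm_eq_nproj, hA, hD, nproj_comp_left]
  rfl

/-- Naturality of the second fundamental form under a change `τ` of the coordinates of the
submanifold. -/
lemma secondFundamentalForm_comp_right {k n : ℕ} {G : Vec n → Bilin n} {τ : Vec k → Vec k}
    {F : Vec k → Vec n} {q : Vec k} (hτ : ContDiffAt ℝ 2 τ q) (hF : ContDiffAt ℝ 2 F (τ q))
    (hbij : Function.Bijective (fderiv ℝ τ q)) (hinj : Function.Injective (fderiv ℝ F (τ q)))
    (hi : IsInner (G (F (τ q)))) (u v : Vec k) :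
    secondFundamentalForm G (F ∘ τ) q u v =
      secondFundamentalForm G F (τ q) (fderiv ℝ τ q u) (fderiv ℝ τ q v) := by
  have hD : fderiv ℝ (F ∘ τ) q = (fderiv ℝ F (τ q)).comp (fderiv ℝ τ q) :=
    fderiv_comp q (hF.differentiableAt (by norm_num)) (hτ.differentiableAt (by norm_num))
  have hA : covDeriv G (F ∘ τ) q u v = covDeriv G F (τ q) (fderiv ℝ τ q u) (fderiv ℝ τ q v) +
      fderiv ℝ F (τ q) (fderiv ℝ (fderiv ℝ τ) q u v) := by
    rw [covDeriv, covDeriv, fderiv_fderiv_comp hτ hF, hD]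
    simp only [ContinuousLinearMap.comp_apply, Function.comp_apply]
    abel
  rw [secondFundamentalForm_eq_nproj, secondFundamentalForm_eq_nproj, hA, hD]
  rw [Function.comp_apply, nproj_comp_right hi hinj hbij, nproj_add, nproj_range hi hinj, add_zero]

lemma secondFundamentalForm_congr {k n : ℕ} {G G' : Vec n → Bilin n} {F F' : Vec k → Vec n}
    {q : Vec k} (hF : F =ᶠ[𝓝 q] F') (hG : G =ᶠ[𝓝 (F q)] G') (u v : Vec k) :
    secondFundamentalForm G F q u v = secondFundamentalForm G' F' q u v := by
  rw [secondFundamentalForm_eq, secondFundamentalForm_eq, hF.fderiv.fderiv_eq, hF.fderiv_eq,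
    ← hF.self_of_nhds, hG.fderiv_eq, hG.self_of_nhds]

/-! ### Conformal changes of the metric -/

/-- The change of the Christoffel symbols under a conformal change `ρ⁻² G` of the metric. -/
lemma christoffelLower_conformal {d : ℕ} {G : Vec d → Bilin d} {ρ : Vec d → ℝ} {x : Vec d}
    (hG : DifferentiableAt ℝ G x) (hρ : DifferentiableAt ℝ ρ x) (h0 : ρ x ≠ 0)
    (u v w : Vec d) :
    christoffelLower (fun y => (ρ y ^ 2)⁻¹ • G y) x u v w =
      (ρ x ^ 2)⁻¹ * christoffelLower G x u v w - (ρ x ^ 3)⁻¹ * (fderiv ℝ ρ x u * G x v w +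
        fderiv ℝ ρ x v * G x u w - fderiv ℝ ρ x w * G x u v) := by
  have h1 : HasFDerivAt (fun y => (ρ y ^ 2)⁻¹) (-(2 * (ρ x ^ 3)⁻¹) • fderiv ℝ ρ x) x := by
    have h := (hasDerivAt_inv (pow_ne_zero 2 h0)).comp_hasFDerivAt x (hρ.hasFDerivAt.pow 2)
    refine h.congr_fderiv ?_
    ext z
    simp
    field_simp
  have h2 : fderiv ℝ (fun y => (ρ y ^ 2)⁻¹ • G y) x = _ := (h1.smul hG.hasFDerivAt).fderiv
  rw [christoffelLower_eq, christoffelLower_eq, chrL_apply, chrL_apply, h2]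
  simp
  field_simp
  ring

lemma christoffel_conformal {d : ℕ} {G : Vec d → Bilin d} {ρ : Vec d → ℝ} {x : Vec d}
    (hG : DifferentiableAt ℝ G x) (hρ : DifferentiableAt ℝ ρ x) (h0 : ρ x ≠ 0)
    (hi : IsInner (G x)) (u v : Vec d) :
    christoffel (fun y => (ρ y ^ 2)⁻¹ • G y) x u v =
      christoffel G x u v - (ρ x)⁻¹ • (fderiv ℝ ρ x u • v + fderiv ℝ ρ x v • u -
        G x u v • (G x).inverse (fderiv ℝ ρ x)) := by
  have hi' : IsInner ((ρ x ^ 2)⁻¹ • G x) := hi.smul (by positivity)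
  refine hi'.ext fun w => ?_
  rw [apply_christoffel (G := fun y => (ρ y ^ 2)⁻¹ • G y) hi',
    christoffelLower_conformal hG hρ h0, smul_apply, smul_apply, map_sub, sub_apply,
    apply_christoffel hi]
  simp only [map_smul, map_sub, map_add, smul_apply, sub_apply, add_apply, hi.apply_inverse,
    smul_eq_mul]
  field_simp

/-- The change of the second fundamental form under a conformal change of the metric: it changes
by the induced metric times the normal part of the gradient of the conformal factor. -/
lemma secondFundamentalForm_conformal {k n : ℕ} {G : Vec n → Bilin n} {ρ : Vec n → ℝ}
    {F : Vec k → Vec n} {q : Vec k} (hG : DifferentiableAt ℝ G (F q))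
    (hρ : DifferentiableAt ℝ ρ (F q)) (h0 : ρ (F q) ≠ 0) (hi : IsInner (G (F q)))
    (hinj : Function.Injective (fderiv ℝ F q)) (u v : Vec k) :
    secondFundamentalForm (fun y => (ρ y ^ 2)⁻¹ • G y) F q u v =
      secondFundamentalForm G F q u v + ((ρ (F q))⁻¹ * inducedMetric G F q u v) •
        nproj (G (F q)) (fderiv ℝ F q) ((G (F q)).inverse (fderiv ℝ ρ (F q))) := by
  rw [secondFundamentalForm_eq_nproj, secondFundamentalForm_eq_nproj, covDeriv, covDeriv,
    christoffel_conformal hG hρ h0 hi, nproj_smul_metric hi hinj (by positivity), ← add_sub_assoc,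
    nproj_sub, nproj_smul]
  simp only [nproj_add, nproj_sub, nproj_smul, nproj_range hi hinj, smul_zero,
    zero_add, zero_sub, smul_neg, sub_neg_eq_add, smul_smul]
  rfl

/-! ### Integration by parts -/

lemma contDiff_of_tsupport_subset {E F : Type*} [NormedAddCommGroup E] [NormedSpace ℝ E]
    [NormedAddCommGroup F] [NormedSpace ℝ F] {N : ℕ∞ω} {U : Set E} (hU : IsOpen U) {f : E → F}
    (hf : ContDiffOn ℝ N f U) (hs : tsupport f ⊆ U) : ContDiff ℝ N f := by
  rw [contDiff_iff_contDiffAt]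
  intro x
  by_cases hx : x ∈ U
  · exact hf.contDiffAt (hU.mem_nhds hx)
  · have h1 : f =ᶠ[𝓝 x] fun _ => 0 :=
      notMem_tsupport_iff_eventuallyEq.1 fun h => hx (hs h)
    exact contDiffAt_const.congr_of_eventuallyEq h1

lemma continuous_mul_of_tsupport {E F : Type*} [TopologicalSpace E] [NormedAddCommGroup F]
    [NormedSpace ℝ F] {U : Set E} (hU : IsOpen U)
    {φ : E → ℝ} {g : E → F} (hφ : Continuous φ) (hs : tsupport φ ⊆ U) (hg : ContinuousOn g U) :
    Continuous fun y => φ y • g y := by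
  rw [continuous_iff_continuousAt]
  intro x
  by_cases hx : x ∈ U
  · exact hφ.continuousAt.smul (hg.continuousAt (hU.mem_nhds hx))
  · have h1 : φ =ᶠ[𝓝 x] fun _ => 0 :=
      notMem_tsupport_iff_eventuallyEq.1 fun h => hx (hs h)
    have h2 : (fun y => φ y • g y) =ᶠ[𝓝 x] fun _ => 0 := by
      filter_upwards [h1] with y hy
      simp [hy]
    exact continuousAt_const.congr h2.symm

lemma integrable_mul_of_tsupport {k : ℕ} {U : Set (Vec k)} (hU : IsOpen U) {φ g : Vec k → ℝ}
    (hφ : Continuous φ) (hc : HasCompactSupport φ) (hs : tsupport φ ⊆ U)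
    (hg : ContinuousOn g U) : Integrable fun y => φ y * g y :=
  (continuous_mul_of_tsupport hU hφ hs hg).integrable_of_hasCompactSupport hc.mul_right

lemma integral_fderiv_mul_eq {k : ℕ} {U : Set (Vec k)} (hU : IsOpen U) {φ g : Vec k → ℝ}
    (hφ : ContDiff ℝ 1 φ) (hc : HasCompactSupport φ) (hs : tsupport φ ⊆ U)
    (hg : ContDiffOn ℝ 1 g U) (u : Vec k) :
    ∫ y, fderiv ℝ φ y u * g y = - ∫ y, φ y * fderiv ℝ g y u := by
  have hcφ : HasCompactSupport fun y => fderiv ℝ φ y u := hc.fderiv_apply ℝ u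
  have hsφ : tsupport (fun y => fderiv ℝ φ y u) ⊆ U :=
    (tsupport_fderiv_apply_subset ℝ u).trans hs
  have hgc : ContinuousOn (fun y => fderiv ℝ g y u) U :=
    (hg.continuousOn_fderiv_of_isOpen hU (by norm_num)).clm_apply continuousOn_const
  have hφc : Continuous fun y => fderiv ℝ φ y u :=
    (hφ.continuous_fderiv (by norm_num)).clm_apply continuous_const
  have h := integral_mul_fderiv_eq_neg_fderiv_mul_of_integrable (μ := (volume : Measure (Vec k)))
    (f := g) (g := φ) (v := u)
    (by simpa only [mul_comm] using integrable_mul_of_tsupport hU hφ.continuous hc hs hgc)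
    (by simpa only [mul_comm] using integrable_mul_of_tsupport hU hφc hcφ hsφ hg.continuousOn)
    (by simpa only [mul_comm] using
      integrable_mul_of_tsupport hU hφ.continuous hc hs hg.continuousOn)
    (fun x hx => (hg.contDiffAt (hU.mem_nhds (hs hx))).differentiableAt (by norm_num))
    (fun x _ => hφ.differentiable (by norm_num) x)
  simpa only [mul_comm] using h

open scoped Convolution in
/-- Weak symmetry of the second derivatives of a `C¹` function: `∂_u ∂_v P = ∂_v ∂_u P` in the sense
of distributions. It is the symmetry of the second derivative of the convolution of `P` with the
test function. -/
lemma integral_fderiv_fderiv_comm_of_compact {k n : ℕ} {ψ : Vec k → Vec n →L[ℝ] ℝ}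
    {P : Vec k → Vec n} (hψ : ContDiff ℝ 1 ψ) (hcψ : HasCompactSupport ψ) (hP : ContDiff ℝ 1 P)
    (hcP : HasCompactSupport P) (u v : Vec k) :
    ∫ y, fderiv ℝ ψ y u (fderiv ℝ P y v) = ∫ y, fderiv ℝ ψ y v (fderiv ℝ P y u) := by
  let L : (Vec n →L[ℝ] ℝ) →L[ℝ] Vec n →L[ℝ] ℝ := ContinuousLinearMap.id ℝ _
  let P' : Vec k → Vec n := fun y => P (-y)
  have hP' : ContDiff ℝ 1 P' := hP.comp contDiff_neg
  have hcP' : HasCompactSupport P' := hcP.comp_homeomorph (Homeomorph.neg (Vec k))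
  have hDP' : ∀ y, fderiv ℝ P' y = - fderiv ℝ P (-y) := fun y => by
    have h := (hP.differentiable (by norm_num) (-y)).hasFDerivAt.comp y (hasFDerivAt_id y).neg
    refine h.fderiv.trans ?_
    ext z
    simp
  have hcD : Continuous (fderiv ℝ P') := hP'.continuous_fderiv (by norm_num)
  have h1 : ∀ x, HasFDerivAt (ψ ⋆[L, volume] P')
      ((ψ ⋆[L.precompR (Vec k), volume] fderiv ℝ P') x) x := fun x =>
    hcP'.hasFDerivAt_convolution_right L hψ.continuous.locallyIntegrable hP' x
  have h2 : HasFDerivAt (ψ ⋆[L.precompR (Vec k), volume] fderiv ℝ P')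
      ((fderiv ℝ ψ ⋆[(L.precompR (Vec k)).precompL (Vec k), volume] fderiv ℝ P') 0) 0 :=
    hcψ.hasFDerivAt_convolution_left _ hψ hcD.locallyIntegrable 0
  have hsym := second_derivative_symmetric h1 h2
  have hint : Integrable fun t => ((L.precompR (Vec k)).precompL (Vec k)) (fderiv ℝ ψ t)
      (fderiv ℝ P' (0 - t)) := by
    refine Continuous.integrable_of_hasCompactSupport ?_ ?_
    · have := hψ.continuous_fderiv (by norm_num)
      fun_prop
    · exact ((hcψ.fderiv ℝ).mono' (fun t ht => subset_tsupport _ (by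
        intro h0
        apply ht
        simp [h0])))
  have hval : ∀ a b, ((fderiv ℝ ψ ⋆[(L.precompR (Vec k)).precompL (Vec k), volume]
      fderiv ℝ P') 0) a b = - ∫ y, fderiv ℝ ψ y a (fderiv ℝ P y b) := by
    intro a b
    rw [convolution_def, ContinuousLinearMap.integral_apply hint,
      ContinuousLinearMap.integral_apply (hint.apply_continuousLinearMap a), ← integral_neg]
    refine integral_congr_ae (Eventually.of_forall fun t => ?_)
    simp [hDP', L, ContinuousLinearMap.precompR_apply, ContinuousLinearMap.precompL_apply]
  have := hsym u v
  rw [hval, hval] at this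
  linarith

lemma integral_fderiv_fderiv_comm {k n : ℕ} {U : Set (Vec k)} (hU : IsOpen U)
    {ψ : Vec k → Vec n →L[ℝ] ℝ}
    {P : Vec k → Vec n} (hψ : ContDiff ℝ 1 ψ) (hcψ : HasCompactSupport ψ) (hs : tsupport ψ ⊆ U)
    (hP : ContDiffOn ℝ 1 P U) (u v : Vec k) :
    ∫ y, fderiv ℝ ψ y u (fderiv ℝ P y v) = ∫ y, fderiv ℝ ψ y v (fderiv ℝ P y u) := by
  obtain ⟨K, hK1, hK2, hK3⟩ := exists_compact_between hcψ hU hs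
  obtain ⟨χ, hχ2, hχ3, -⟩ := exists_contMDiffMap_one_nhds_of_subset_interior (n := ⊤)
    𝓘(ℝ, Vec k) (isClosed_tsupport ψ) hK2
  have hχ1 : ContDiff ℝ ∞ χ := χ.contMDiff.contDiff
  have hχ3 : tsupport χ ⊆ K := closure_minimal
    (fun x hx => by_contra fun h => hx (hχ3 x h)) hK1.isClosed
  have hχc : HasCompactSupport χ := hK1.of_isClosed_subset (isClosed_tsupport _) hχ3
  have hsP : tsupport (fun y => χ y • P y) ⊆ U :=
    (tsupport_smul_subset_left χ P).trans (hχ3.trans hK3)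
  have hP' : ContDiff ℝ 1 fun y => χ y • P y :=
    contDiff_of_tsupport_subset hU ((hχ1.of_le (by simp)).contDiffOn.smul hP) hsP
  have h := integral_fderiv_fderiv_comm_of_compact hψ hcψ hP' (hχc.smul_right (f' := P)) u v
  have key : ∀ a b y, fderiv ℝ ψ y a (fderiv ℝ (fun y => χ y • P y) y b) =
      fderiv ℝ ψ y a (fderiv ℝ P y b) := by
    intro a b y
    by_cases hy : y ∈ tsupport ψ
    · have e : (fun y => χ y • P y) =ᶠ[𝓝 y] P := by
        filter_upwards [eventually_nhdsSet_iff_forall.1 hχ2 y hy] with z hz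
        rw [hz, one_smul]
      rw [e.fderiv_eq]
    · have e : ψ =ᶠ[𝓝 y] fun _ => 0 := notMem_tsupport_iff_eventuallyEq.1 hy
      rw [e.fderiv_eq]
      simp
  simpa only [key] using h

/-! ### The Gauss equation -/

/-- The field of Christoffel symbols of the first kind, as trilinear forms. -/
def chrField {d : ℕ} (G : Vec d → Bilin d) (x : Vec d) : Vec d →L[ℝ] Bilin d :=
  chrL d (fderiv ℝ G x)

/-- The classical curvature tensor of a metric of class `C²` in coordinates. -/
def classicalCurv {d : ℕ} (G : Vec d → Bilin d) (x u v w z : Vec d) : ℝ :=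
  fderiv ℝ (chrField G) x u v w z - fderiv ℝ (chrField G) x v u w z +
    G x (christoffel G x u w) (christoffel G x v z) -
    G x (christoffel G x v w) (christoffel G x u z)

/-- The right-hand side of the Gauss equation. -/
def gaussCurv {k n : ℕ} (G : Vec n → Bilin n) (F : Vec k → Vec n) (q u v w z : Vec k) : ℝ :=
  classicalCurv G (F q) (fderiv ℝ F q u) (fderiv ℝ F q v) (fderiv ℝ F q w) (fderiv ℝ F q z) +
    G (F q) (secondFundamentalForm G F q v w) (secondFundamentalForm G F q u z) -
    G (F q) (secondFundamentalForm G F q u w) (secondFundamentalForm G F q v z)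

lemma christoffelLower_eq_chrField {d : ℕ} (G : Vec d → Bilin d) (x u v : Vec d) :
    christoffelLower G x u v = chrField G x u v :=
  christoffelLower_eq G x u v

/-- The Gauss formula: the tangential part of `D²F + Γ(dF, dF)` is the connection of the induced
metric. -/
lemma covDeriv_eq_nproj_add {k n : ℕ} {G : Vec n → Bilin n} {F : Vec k → Vec n}
    {q : Vec k} (hF : ContDiffAt ℝ 2 F q) (hG : DifferentiableAt ℝ G (F q))
    (hi : ∀ᶠ x in 𝓝 (F q), IsInner (G x)) (hinj : Function.Injective (fderiv ℝ F q))
    (u v : Vec k) : covDeriv G F q u v - secondFundamentalForm G F q u v =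
      fderiv ℝ F q (christoffel (inducedMetric G F) q u v) := by
  have hG0 := hi.self_of_nhds
  have h : covDeriv G F q u v - fderiv ℝ F q (christoffel (inducedMetric G F) q u v) =
      secondFundamentalForm G F q u v := by
    refine nproj_unique hG0 hinj (fun w => ?_) ⟨_, sub_sub_cancel _ _⟩
    rw [map_sub, sub_apply, ← christoffelLower_inducedMetric hF hG hi,
      ← apply_christoffel (hG0.comp hinj : IsInner (inducedMetric G F q))]
    exact sub_self _
  rw [← h, sub_sub_cancel]

lemma covDeriv_inner {k n : ℕ} {G : Vec n → Bilin n} {F : Vec k → Vec n}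
    {q : Vec k} (hF : ContDiffAt ℝ 2 F q) (hG : DifferentiableAt ℝ G (F q))
    (hi : ∀ᶠ x in 𝓝 (F q), IsInner (G x)) (hinj : Function.Injective (fderiv ℝ F q))
    (u v w z : Vec k) : G (F q) (covDeriv G F q u v) (covDeriv G F q w z) =
      G (F q) (secondFundamentalForm G F q u v) (secondFundamentalForm G F q w z) +
      inducedMetric G F q (christoffel (inducedMetric G F) q u v)
        (christoffel (inducedMetric G F) q w z) := by
  rw [nproj_inner hi.self_of_nhds hinj, ← secondFundamentalForm_eq_nproj,
    ← secondFundamentalForm_eq_nproj, covDeriv_eq_nproj_add hF hG hi hinj,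
    covDeriv_eq_nproj_add hF hG hi hinj]
  rfl

/-- The covector `x ↦ G(x, dF z)` along the immersion `F`. -/
def tangentCovector {k n : ℕ} (G : Vec n → Bilin n) (F : Vec k → Vec n) (z q : Vec k) :
    Vec n →L[ℝ] ℝ :=
  flipForm n (G (F q)) (fderiv ℝ F q z)

/-- The ambient Christoffel symbols of the first kind, evaluated on coordinate tangent vectors. -/
def tangentChr {k n : ℕ} (G : Vec n → Bilin n) (F : Vec k → Vec n) (v w z q : Vec k) : ℝ :=
  chrField G (F q) (fderiv ℝ F q v) (fderiv ℝ F q w) (fderiv ℝ F q z)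

section Regularity

variable {k n : ℕ} {G : Vec n → Bilin n} {F : Vec k → Vec n} {q : Vec k}

lemma contDiffAt_chrField {d : ℕ} {G : Vec d → Bilin d} {x : Vec d} (hG : ContDiffAt ℝ 2 G x) :
    ContDiffAt ℝ 1 (chrField G) x :=
  (chrL d).contDiff.contDiffAt.comp x (hG.fderiv_right (m := 1) (by norm_num))

lemma contDiffAt_tangentCovector (hF : ContDiffAt ℝ 2 F q) (hG : ContDiffAt ℝ 2 G (F q))
    (z : Vec k) : ContDiffAt ℝ 1 (tangentCovector G F z) q := by
  have hF1 : ContDiffAt ℝ 1 F q := hF.of_le (by norm_num)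
  have h1 : ContDiffAt ℝ 1 (fun y => G (F y)) q := (hG.of_le (by norm_num)).comp q hF1
  have h2 : ContDiffAt ℝ 1 (fun y => flipForm n (G (F y))) q :=
    (flipForm n).contDiff.contDiffAt.comp q h1
  exact h2.clm_apply ((hF.fderiv_right (m := 1) (by norm_num)).clm_apply contDiffAt_const)

lemma contDiffAt_tangentChr (hF : ContDiffAt ℝ 2 F q) (hG : ContDiffAt ℝ 2 G (F q))
    (v w z : Vec k) : ContDiffAt ℝ 1 (tangentChr G F v w z) q := by
  have hF1 : ContDiffAt ℝ 1 F q := hF.of_le (by norm_num)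
  have hD : ContDiffAt ℝ 1 (fderiv ℝ F) q := hF.fderiv_right (m := 1) (by norm_num)
  have h1 : ContDiffAt ℝ 1 (fun y => chrField G (F y)) q := (contDiffAt_chrField hG).comp q hF1
  exact ((h1.clm_apply (hD.clm_apply contDiffAt_const)).clm_apply
    (hD.clm_apply contDiffAt_const)).clm_apply (hD.clm_apply contDiffAt_const)

lemma fderiv_tangentCovector (hF : ContDiffAt ℝ 2 F q) (hG : ContDiffAt ℝ 2 G (F q))
    (u z : Vec k) (x : Vec n) : fderiv ℝ (tangentCovector G F z) q u x =
      fderiv ℝ G (F q) (fderiv ℝ F q u) x (fderiv ℝ F q z) +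
      G (F q) x (fderiv ℝ (fderiv ℝ F) q u z) := by
  have hD : DifferentiableAt ℝ (fderiv ℝ F) q :=
    (hF.fderiv_right (m := 1) (by norm_num)).differentiableAt (by norm_num)
  have h1 : HasFDerivAt (fun y => G (F y)) ((fderiv ℝ G (F q)).comp (fderiv ℝ F q)) q :=
    (hG.differentiableAt (by norm_num)).hasFDerivAt.comp q
      (hF.differentiableAt (by norm_num)).hasFDerivAt
  have h2 : HasFDerivAt (fun y => flipForm n (G (F y)))
      ((flipForm n).comp ((fderiv ℝ G (F q)).comp (fderiv ℝ F q))) q :=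
    (flipForm n).hasFDerivAt.comp q h1
  have h3 : HasFDerivAt (tangentCovector G F z) _ q :=
    h2.clm_apply (hD.hasFDerivAt.clm_apply (hasFDerivAt_const z q))
  rw [h3.fderiv]
  simp [flipForm]
  ring

lemma fderiv_tangentChr (hF : ContDiffAt ℝ 2 F q) (hG : ContDiffAt ℝ 2 G (F q))
    (u v w z : Vec k) : fderiv ℝ (tangentChr G F v w z) q u =
      fderiv ℝ (chrField G) (F q) (fderiv ℝ F q u) (fderiv ℝ F q v) (fderiv ℝ F q w)
        (fderiv ℝ F q z) +
      chrField G (F q) (fderiv ℝ (fderiv ℝ F) q u v) (fderiv ℝ F q w) (fderiv ℝ F q z) +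
      chrField G (F q) (fderiv ℝ F q v) (fderiv ℝ (fderiv ℝ F) q u w) (fderiv ℝ F q z) +
      chrField G (F q) (fderiv ℝ F q v) (fderiv ℝ F q w) (fderiv ℝ (fderiv ℝ F) q u z) := by
  have hD : DifferentiableAt ℝ (fderiv ℝ F) q :=
    (hF.fderiv_right (m := 1) (by norm_num)).differentiableAt (by norm_num)
  have h1 : HasFDerivAt (fun y => chrField G (F y))
      ((fderiv ℝ (chrField G) (F q)).comp (fderiv ℝ F q)) q :=
    ((contDiffAt_chrField hG).differentiableAt (by norm_num)).hasFDerivAt.comp q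
      (hF.differentiableAt (by norm_num)).hasFDerivAt
  have hDv : ∀ v, HasFDerivAt (fun y => fderiv ℝ F y v) _ q := fun v =>
    hD.hasFDerivAt.clm_apply (hasFDerivAt_const v q)
  have h3 : HasFDerivAt (tangentChr G F v w z) _ q :=
    ((h1.clm_apply (hDv v)).clm_apply (hDv w)).clm_apply (hDv z)
  rw [h3.fderiv]
  simp
  ring

/-- The pointwise algebra behind the Gauss equation: the third derivatives of `F` having been
removed by integration by parts, the remaining terms give the curvature of the ambient metric and
the second fundamental form. -/
lemma gaussCurv_eq (hF : ContDiffAt ℝ 2 F q) (hG : ContDiffAt ℝ 2 G (F q))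
    (hi : ∀ᶠ x in 𝓝 (F q), IsInner (G x)) (hinj : Function.Injective (fderiv ℝ F q))
    (u v w z : Vec k) :
    gaussCurv G F q u v w z =
      fderiv ℝ (tangentCovector G F z) q u (fderiv ℝ (fderiv ℝ F) q v w) -
      fderiv ℝ (tangentCovector G F z) q v (fderiv ℝ (fderiv ℝ F) q u w) +
      fderiv ℝ (tangentChr G F v w z) q u - fderiv ℝ (tangentChr G F u w z) q v +
      (inducedMetric G F q (christoffel (inducedMetric G F) q u w)
        (christoffel (inducedMetric G F) q v z) -
      inducedMetric G F q (christoffel (inducedMetric G F) q v w)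
        (christoffel (inducedMetric G F) q u z)) := by
  have hG1 : DifferentiableAt ℝ G (F q) := hG.differentiableAt (by norm_num)
  have hG0 := hi.self_of_nhds
  have hsT : ∀ a b c, fderiv ℝ G (F q) a b c = fderiv ℝ G (F q) a c b :=
    fderiv_symm_of_symm hG1 (hi.mono fun y hy => hy.1)
  have e1 := covDeriv_inner hF hG1 hi hinj v w u z
  have e2 := covDeriv_inner hF hG1 hi hinj u w v z
  have hΓ : ∀ a b c, G (F q) (christoffel G (F q) a b) c = chrField G (F q) a b c := fun a b c => by
    rw [apply_christoffel hG0, christoffelLower_eq_chrField]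
  have hΓ' : ∀ a b c, G (F q) c (christoffel G (F q) a b) = chrField G (F q) a b c :=
      fun a b c => by
    rw [hG0.1, hΓ]
  -- compatibility of the Levi-Civita connection with the metric
  have hcomp : ∀ a b c, fderiv ℝ G (F q) a b c =
      chrField G (F q) a b c + chrField G (F q) a c b := by
    intro a b c
    rw [chrField, chrL_apply, chrL_apply, hsT a c b]
    ring
  simp only [covDeriv, map_add, add_apply] at e1 e2
  rw [hΓ' _ _ (fderiv ℝ (fderiv ℝ F) q v w), hΓ _ _ (fderiv ℝ (fderiv ℝ F) q u z)] at e1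
  rw [hΓ' _ _ (fderiv ℝ (fderiv ℝ F) q u w), hΓ _ _ (fderiv ℝ (fderiv ℝ F) q v z)] at e2
  rw [gaussCurv, classicalCurv, fderiv_tangentCovector hF hG, fderiv_tangentCovector hF hG,
    fderiv_tangentChr hF hG, fderiv_tangentChr hF hG, hcomp, hcomp, fderiv_fderiv_symm hF v u]
  linarith

end Regularity

/-! ### Continuity of the geometric quantities -/

lemma continuousAt_inverse {d : ℕ} {B : Bilin d} (hB : IsInner B) :
    ContinuousAt (fun B : Bilin d => ContinuousLinearMap.inverse B) B := by
  obtain ⟨e, he⟩ := hB.isInvertible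
  rw [← he]
  exact (contDiffAt_map_inverse (n := 0) e).continuousAt

lemma continuous_gram (k n : ℕ) :
    Continuous fun p : Bilin n × (Vec k →L[ℝ] Vec n) => gram p.1 p.2 := by
  refine continuous_matrix fun i j => ?_
  simp only [gram, Matrix.of_apply]
  fun_prop

lemma continuousAt_gram_inv {k n : ℕ} {p : Bilin n × (Vec k →L[ℝ] Vec n)} (hB : IsInner p.1)
    (hD : Function.Injective p.2) (i j : Fin (k + 1)) :
    ContinuousAt (fun p : Bilin n × (Vec k →L[ℝ] Vec n) => (gram p.1 p.2)⁻¹ i j) p := by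
  have h : ∀ p : Bilin n × (Vec k →L[ℝ] Vec n), (gram p.1 p.2)⁻¹ i j =
      ((gram p.1 p.2).det)⁻¹ * (gram p.1 p.2).adjugate i j := fun p => by
    rw [Matrix.inv_def, Ring.inverse_eq_inv']
    rfl
  simp only [h]
  refine ContinuousAt.mul (ContinuousAt.inv₀ ?_ (gram_isUnit hB hD).ne_zero) ?_
  · exact (continuous_gram k n).matrix_det.continuousAt
  · exact ((continuous_gram k n).matrix_adjugate.matrix_elem i j).continuousAt

lemma continuousAt_nproj {k n : ℕ} {p : Bilin n × (Vec k →L[ℝ] Vec n) × Vec n}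
    (hB : IsInner p.1) (hD : Function.Injective p.2.1) :
    ContinuousAt (fun p : Bilin n × (Vec k →L[ℝ] Vec n) × Vec n => nproj p.1 p.2.1 p.2.2) p := by
  unfold nproj
  refine ContinuousAt.sub (by fun_prop) (tendsto_finsetSum _ fun i _ =>
    tendsto_finsetSum _ fun j _ => Tendsto.smul (Tendsto.mul ?_ ?_) ?_)
  · exact ContinuousAt.comp (f := fun p : Bilin n × (Vec k →L[ℝ] Vec n) × Vec n => (p.1, p.2.1))
      (continuousAt_gram_inv (p := (p.1, p.2.1)) hB hD i j) (by fun_prop)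
  · exact (show Continuous fun p : Bilin n × (Vec k →L[ℝ] Vec n) × Vec n =>
      p.1 p.2.2 (p.2.1 (stdVec i)) by fun_prop).continuousAt
  · exact (show Continuous fun p : Bilin n × (Vec k →L[ℝ] Vec n) × Vec n =>
      p.2.1 (stdVec j) by fun_prop).continuousAt

section ContinuousAt

variable {Z : Type*} [TopologicalSpace Z] {k n : ℕ} {z : Z}

lemma _root_.ContinuousAt.nproj {B : Z → Bilin n} {D : Z → Vec k →L[ℝ] Vec n} {v : Z → Vec n}
    (hB : ContinuousAt B z) (hD : ContinuousAt D z) (hv : ContinuousAt v z)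
    (hi : IsInner (B z)) (hinj : Function.Injective (D z)) :
    ContinuousAt (fun y => AHGeometry.nproj (B y) (D y) (v y)) z :=
  ContinuousAt.comp (f := fun y => (B y, D y, v y))
    (continuousAt_nproj (p := (B z, D z, v z)) hi hinj) (hB.prodMk (hD.prodMk hv))

lemma _root_.ContinuousAt.bilinInverse {B : Z → Bilin n} (hB : ContinuousAt B z)
    (hi : IsInner (B z)) : ContinuousAt (fun y => ContinuousLinearMap.inverse (B y)) z :=
  ContinuousAt.comp (f := B) (continuousAt_inverse hi) hB

lemma _root_.ContinuousAt.secondForm {B : Z → Bilin n} {T : Z → Vec n →L[ℝ] Bilin n}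
    {D : Z → Vec k →L[ℝ] Vec n} {S : Z → Vec k →L[ℝ] Vec k →L[ℝ] Vec n} {u v : Z → Vec k}
    (hB : ContinuousAt B z) (hT : ContinuousAt T z) (hD : ContinuousAt D z)
    (hS : ContinuousAt S z) (hu : ContinuousAt u z) (hv : ContinuousAt v z)
    (hi : IsInner (B z)) (hinj : Function.Injective (D z)) :
    ContinuousAt (fun y => AHGeometry.secondForm (B y) (T y) (D y) (S y) (u y) (v y)) z := by
  refine ContinuousAt.nproj hB hD (ContinuousAt.add ?_ ?_) hi hinj
  · exact (hS.clm_apply hu).clm_apply hv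
  · refine (hB.bilinInverse hi).clm_apply ?_
    exact (((chrL n).continuous.continuousAt.comp hT).clm_apply (hD.clm_apply hu)).clm_apply
      (hD.clm_apply hv)

end ContinuousAt

lemma continuousAt_secondFundamentalForm {k n : ℕ} {G : Vec n → Bilin n} {F : Vec k → Vec n}
    {q : Vec k} (hF : ContDiffAt ℝ 2 F q) (hG : ContDiffAt ℝ 2 G (F q)) (hi : IsInner (G (F q)))
    (hinj : Function.Injective (fderiv ℝ F q)) (u v : Vec k) :
    ContinuousAt (fun q => secondFundamentalForm G F q u v) q := by
  simp only [secondFundamentalForm_eq]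
  have hD : ContDiffAt ℝ 1 (fderiv ℝ F) q := hF.fderiv_right (m := 1) (by norm_num)
  refine ContinuousAt.secondForm ?_ ?_ hD.continuousAt ?_ continuousAt_const continuousAt_const
    hi hinj
  · exact hG.continuousAt.comp hF.continuousAt
  · exact ContinuousAt.comp (f := F) (hG.fderiv_right (m := 1) (by norm_num)).continuousAt
      hF.continuousAt
  · exact (hD.fderiv_right (m := 0) (by norm_num)).continuousAt

/-- The classical curvature depends continuously on the point and on the vectors. -/
lemma continuousAt_classicalCurv {Z : Type*} [TopologicalSpace Z] {s : Z} {d : ℕ}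
    {G : Vec d → Bilin d} {x u v w z : Z → Vec d} (hG : ContDiffAt ℝ 2 G (x s))
    (hi : IsInner (G (x s))) (hx : ContinuousAt x s)
    (hu : ContinuousAt u s) (hv : ContinuousAt v s) (hw : ContinuousAt w s)
    (hz : ContinuousAt z s) :
    ContinuousAt (fun y => classicalCurv G (x y) (u y) (v y) (w y) (z y)) s := by
  have hc := contDiffAt_chrField hG
  have h1 : ContinuousAt (fun y => fderiv ℝ (chrField G) (x y)) s :=
    ContinuousAt.comp (f := x) (hc.fderiv_right (m := 0) (by norm_num)).continuousAt hx
  have h2 : ContinuousAt (fun y => chrField G (x y)) s := ContinuousAt.comp (f := x)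
    hc.continuousAt hx
  have h3 : ContinuousAt (fun y => G (x y)) s := ContinuousAt.comp (f := x) hG.continuousAt hx
  have h4 : ∀ {a b : Z → Vec d}, ContinuousAt a s → ContinuousAt b s →
      ContinuousAt (fun y => christoffel G (x y) (a y) (b y)) s := fun {a b} ha hb => by
    simp only [christoffel, christoffelLower_eq_chrField]
    exact (h3.bilinInverse hi).clm_apply ((h2.clm_apply ha).clm_apply hb)
  unfold classicalCurv
  refine ContinuousAt.sub (ContinuousAt.add (ContinuousAt.sub ?_ ?_) ?_) ?_
  · exact (((h1.clm_apply hu).clm_apply hv).clm_apply hw).clm_apply hz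
  · exact (((h1.clm_apply hv).clm_apply hu).clm_apply hw).clm_apply hz
  · exact (h3.clm_apply (h4 hu hw)).clm_apply (h4 hv hz)
  · exact (h3.clm_apply (h4 hv hw)).clm_apply (h4 hu hz)

lemma continuousAt_gaussCurv {k n : ℕ} {G : Vec n → Bilin n} {F : Vec k → Vec n}
    {q : Vec k} (hF : ContDiffAt ℝ 2 F q) (hG : ContDiffAt ℝ 2 G (F q)) (hi : IsInner (G (F q)))
    (hinj : Function.Injective (fderiv ℝ F q)) (u v w z : Vec k) :
    ContinuousAt (fun q => gaussCurv G F q u v w z) q := by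
  have hD : ContinuousAt (fderiv ℝ F) q :=
    (hF.fderiv_right (m := 1) (by norm_num)).continuousAt
  have hGF : ContinuousAt (fun q => G (F q)) q := hG.continuousAt.comp hF.continuousAt
  have hII := continuousAt_secondFundamentalForm hF hG hi hinj
  have hDa : ∀ a, ContinuousAt (fun y => fderiv ℝ F y a) q := fun a =>
    hD.clm_apply continuousAt_const
  refine ContinuousAt.sub (ContinuousAt.add ?_ ?_) ?_
  · exact continuousAt_classicalCurv hG hi hF.continuousAt (hDa u) (hDa v) (hDa w) (hDa z)
  · exact (hGF.clm_apply (hII v w)).clm_apply (hII u z)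
  · exact (hGF.clm_apply (hII u w)).clm_apply (hII v z)

/-! ### The Gauss equation in the sense of distributions -/

/-- The integrals of the terms by which the two sides of the weak Gauss equation differ cancel in
three pairs. -/
lemma integral_cancel {k : ℕ} {a b c d e f : Vec k → ℝ} (ha : Integrable a) (hb : Integrable b)
    (hc : Integrable c) (hd : Integrable d) (he : Integrable e) (hf : Integrable f)
    (h1 : ∫ y, a y = ∫ y, b y) (h2 : ∫ y, c y = - ∫ y, d y) (h3 : ∫ y, e y = - ∫ y, f y) :
    ∫ y, ((a y - b y + (c y + d y)) - (e y + f y)) = 0 := by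
  have hab : Integrable fun y => a y - b y := ha.sub hb
  have hcd : Integrable fun y => c y + d y := hc.add hd
  have hef : Integrable fun y => e y + f y := he.add hf
  have habcd : Integrable fun y => a y - b y + (c y + d y) := hab.add hcd
  rw [integral_sub habcd hef, integral_add hab hcd, integral_sub ha hb, integral_add hc hd,
    integral_add he hf, h1, h2, h3]
  ring

/-- The Gauss equation in the sense of distributions, for immersions of class `C²`. -/
theorem gauss_weak {k n : ℕ} {G : Vec n → Bilin n} {F : Vec k → Vec n} {U : Set (Vec k)}
    (hU : IsOpen U) (hF : ∀ y ∈ U, ContDiffAt ℝ 2 F y) (hG : ∀ y ∈ U, ContDiffAt ℝ 2 G (F y))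
    (hi : ∀ y ∈ U, ∀ᶠ x in 𝓝 (F y), IsInner (G x))
    (hinj : ∀ y ∈ U, Function.Injective (fderiv ℝ F y)) (u v w z : Vec k)
    {φ : Vec k → ℝ} (hφ : ContDiff ℝ ∞ φ) (hc : HasCompactSupport φ) (hs : tsupport φ ⊆ U) :
    ∫ y, φ y * gaussCurv G F y u v w z =
      ∫ y, (- (fderiv ℝ φ y u) * christoffelLower (inducedMetric G F) y v w z
          + fderiv ℝ φ y v * christoffelLower (inducedMetric G F) y u w z
          + φ y * (inducedMetric G F y (christoffel (inducedMetric G F) y u w)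
              (christoffel (inducedMetric G F) y v z)
            - inducedMetric G F y (christoffel (inducedMetric G F) y v w)
              (christoffel (inducedMetric G F) y u z))) := by
  have hφ1 : ContDiff ℝ 1 φ := hφ.of_le (by simp)
  -- `P = ∂_w F` carries the third derivatives of `F`; they enter paired with `ψ = φ · G(·, ∂_z F)`
  set P : Vec k → Vec n := fun y => fderiv ℝ F y w with hPdef
  set τ := tangentCovector G F z with hτdef
  set ψ : Vec k → Vec n →L[ℝ] ℝ := fun y => φ y • τ y with hψdef
  have hD : ∀ y ∈ U, ContDiffAt ℝ 1 (fderiv ℝ F) y := fun y hy =>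
    (hF y hy).fderiv_right (m := 1) (by norm_num)
  have hP : ContDiffOn ℝ 1 P U := fun y hy =>
    ((hD y hy).clm_apply contDiffAt_const).contDiffWithinAt
  have hDP : ∀ y ∈ U, ∀ a, fderiv ℝ P y a = fderiv ℝ (fderiv ℝ F) y a w := by
    intro y hy a
    have h := ((hD y hy).differentiableAt (by norm_num)).hasFDerivAt.clm_apply
      (hasFDerivAt_const w y)
    rw [h.fderiv]
    simp
  have hτ : ContDiffOn ℝ 1 τ U := fun y hy =>
    (contDiffAt_tangentCovector (hF y hy) (hG y hy) z).contDiffWithinAt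
  have hsψ : tsupport ψ ⊆ U := (tsupport_smul_subset_left φ τ).trans hs
  have hψ : ContDiff ℝ 1 ψ := contDiff_of_tsupport_subset hU (hφ1.contDiffOn.smul hτ) hsψ
  have hcψ : HasCompactSupport ψ := hc.smul_right
  have hDψ : ∀ y ∈ U, ∀ a x,
      fderiv ℝ ψ y a x = fderiv ℝ φ y a * τ y x + φ y * fderiv ℝ τ y a x := by
    intro y hy a x
    have h := (hφ1.differentiable (by norm_num) y).hasFDerivAt.smul
      (((hτ.contDiffAt (hU.mem_nhds hy)).differentiableAt (by norm_num)).hasFDerivAt)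
    have h' : fderiv ℝ ψ y = _ := h.fderiv
    rw [h']
    simp
    ring
  have hχ : ∀ a, ContDiffOn ℝ 1 (tangentChr G F a w z) U := fun a y hy =>
    (contDiffAt_tangentChr (hF y hy) (hG y hy) a w z).contDiffWithinAt
  have hoff : ∀ y ∉ U, φ y = 0 ∧ fderiv ℝ φ y = 0 ∧ fderiv ℝ ψ y = 0 := by
    intro y hy
    have e1 : φ =ᶠ[𝓝 y] fun _ => 0 := notMem_tsupport_iff_eventuallyEq.1 fun h => hy (hs h)
    have e2 : ψ =ᶠ[𝓝 y] fun _ => 0 := notMem_tsupport_iff_eventuallyEq.1 fun h => hy (hsψ h)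
    exact ⟨e1.self_of_nhds, by rw [e1.fderiv_eq]; simp, by rw [e2.fderiv_eq]; simp⟩
  -- `∂_u ∂_v P = ∂_v ∂_u P` weakly, and integration by parts for the ambient Christoffel symbols
  have I1 := integral_fderiv_fderiv_comm hU hψ hcψ hsψ hP u v
  have I2 := integral_fderiv_mul_eq hU hφ1 hc hs (hχ v) u
  have I3 := integral_fderiv_mul_eq hU hφ1 hc hs (hχ u) v
  -- the two integrands differ by terms whose integrals cancel
  have key : ∀ y, φ y * gaussCurv G F y u v w z -
      (- (fderiv ℝ φ y u) * christoffelLower (inducedMetric G F) y v w z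
          + fderiv ℝ φ y v * christoffelLower (inducedMetric G F) y u w z
          + φ y * (inducedMetric G F y (christoffel (inducedMetric G F) y u w)
              (christoffel (inducedMetric G F) y v z)
            - inducedMetric G F y (christoffel (inducedMetric G F) y v w)
              (christoffel (inducedMetric G F) y u z))) =
      ((fderiv ℝ ψ y u (fderiv ℝ P y v) - fderiv ℝ ψ y v (fderiv ℝ P y u)) +
      (fderiv ℝ φ y u * tangentChr G F v w z y + φ y * fderiv ℝ (tangentChr G F v w z) y u)) -
      (fderiv ℝ φ y v * tangentChr G F u w z y + φ y * fderiv ℝ (tangentChr G F u w z) y v) := by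
    intro y
    by_cases hy : y ∈ U
    · have hG1 : DifferentiableAt ℝ G (F y) := (hG y hy).differentiableAt (by norm_num)
      rw [gaussCurv_eq (hF y hy) (hG y hy) (hi y hy) (hinj y hy), hDP y hy, hDP y hy,
        hDψ y hy, hDψ y hy, christoffelLower_inducedMetric (hF y hy) hG1 (hi y hy),
        christoffelLower_inducedMetric (hF y hy) hG1 (hi y hy)]
      have e : ∀ a, G (F y) (covDeriv G F y a w) (fderiv ℝ F y z) =
          τ y (fderiv ℝ (fderiv ℝ F) y a w) + tangentChr G F a w z y := by
        intro a
        rw [covDeriv, map_add, add_apply, apply_christoffel (hi y hy).self_of_nhds,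
          christoffelLower_eq_chrField]
        simp [hτdef, tangentCovector, flipForm, tangentChr]
      rw [e, e]
      ring
    · obtain ⟨h1, h2, h3⟩ := hoff y hy
      simp [h1, h2, h3]
  have hKc : ContinuousOn (fun y => gaussCurv G F y u v w z) U := fun y hy =>
    (continuousAt_gaussCurv (hF y hy) (hG y hy) (hi y hy).self_of_nhds (hinj y hy)
      u v w z).continuousWithinAt
  have hDφ : ∀ a, Continuous fun y => fderiv ℝ φ y a := fun a =>
    (hφ1.continuous_fderiv (by norm_num)).clm_apply continuous_const
  have hψP : ∀ a b, Integrable fun y => fderiv ℝ ψ y a (fderiv ℝ P y b) := by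
    intro a b
    have hsub : tsupport (fun y => fderiv ℝ ψ y a (fderiv ℝ P y b)) ⊆ tsupport ψ := by
      refine (closure_mono fun y hy => ?_).trans (tsupport_fderiv_subset ℝ)
      intro h0
      exact hy (by simp [h0])
    have hcont : Continuous fun y => fderiv ℝ ψ y a (fderiv ℝ P y b) := by
      refine continuous_of_tsupport fun y hy => ?_
      have hyU := hU.mem_nhds (hsψ (hsub hy))
      exact ((hψ.continuous_fderiv (by norm_num)).continuousAt.clm_apply
        continuousAt_const).clm_apply
        (((hP.continuousOn_fderiv_of_isOpen hU (by norm_num)).continuousAt hyU).clm_apply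
          continuousAt_const)
    exact hcont.integrable_of_hasCompactSupport
      (hcψ.of_isClosed_subset (isClosed_tsupport _) hsub)
  have hφχ : ∀ a b, Integrable fun y => fderiv ℝ φ y a * tangentChr G F b w z y := fun a b =>
    integrable_mul_of_tsupport hU (hDφ a) (hc.fderiv_apply ℝ a)
      ((tsupport_fderiv_apply_subset ℝ a).trans hs) (hχ b).continuousOn
  have hφχ' : ∀ a b, Integrable fun y => φ y * fderiv ℝ (tangentChr G F b w z) y a := fun a b =>
    integrable_mul_of_tsupport hU hφ.continuous hc hs
      (((hχ b).continuousOn_fderiv_of_isOpen hU (by norm_num)).clm_apply continuousOn_const)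
  have hR : Integrable fun y =>
      ((fderiv ℝ ψ y u (fderiv ℝ P y v) - fderiv ℝ ψ y v (fderiv ℝ P y u)) +
      (fderiv ℝ φ y u * tangentChr G F v w z y + φ y * fderiv ℝ (tangentChr G F v w z) y u)) -
      (fderiv ℝ φ y v * tangentChr G F u w z y + φ y * fderiv ℝ (tangentChr G F u w z) y v) :=
    (((hψP u v).sub (hψP v u)).add ((hφχ u v).add (hφχ' u v))).sub ((hφχ v u).add (hφχ' v u))
  have hA := integrable_mul_of_tsupport hU hφ.continuous hc hs hKc
  have hzero := integral_cancel (hψP u v) (hψP v u) (hφχ u v) (hφχ' u v) (hφχ v u) (hφχ' v u)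
    I1 I2 I3
  rw [← sub_eq_zero, ← hzero]
  rw [← integral_sub hA ((hA.sub hR).congr (Eventually.of_forall fun y => ?_))]
  · exact integral_congr_ae (Eventually.of_forall key)
  · have := key y
    simp only [Pi.sub_apply]
    linarith

/-! ### Continuous curvature tensors are classical -/

lemma classicalCurv_eq_gaussCurv_id {d : ℕ} {G : Vec d → Bilin d} {x : Vec d}
    (hi : IsInner (G x)) (u v w z : Vec d) :
    gaussCurv G id x u v w z = classicalCurv G x u v w z := by
  have hII : ∀ a b, secondFundamentalForm G id x a b = 0 := fun a b => by
    rw [secondFundamentalForm_eq_nproj, fderiv_id]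
    exact nproj_range (D := ContinuousLinearMap.id ℝ (Vec d)) hi Function.injective_id _
  simp [gaussCurv, hII]

lemma inducedMetric_id {d : ℕ} (G : Vec d → Bilin d) : inducedMetric G id = G := by
  ext x u v
  simp [inducedMetric]

/-- A continuous function that represents the curvature in the sense of distributions is the
classical curvature if the metric is of class `C²`. -/
lemma eq_classicalCurv_of_weak {d : ℕ} {G : Vec d → Bilin d} {Ω : Set (Vec d)} (hΩ : IsOpen Ω)
    (hG : ContDiffOn ℝ 2 G Ω) (hi : ∀ x ∈ Ω, IsInner (G x)) (u v w z : Vec d) {K : Vec d → ℝ}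
    (hK : ContinuousOn K Ω)
    (hw : ∀ φ : Vec d → ℝ, ContDiff ℝ ∞ φ → HasCompactSupport φ → tsupport φ ⊆ Ω →
      ∫ y, φ y * K y =
        ∫ y, (- (fderiv ℝ φ y u) * christoffelLower G y v w z
          + fderiv ℝ φ y v * christoffelLower G y u w z
          + φ y * (G y (christoffel G y u w) (christoffel G y v z)
            - G y (christoffel G y v w) (christoffel G y u z)))) :
    ∀ x ∈ Ω, K x = classicalCurv G x u v w z := by
  have hGx : ∀ x ∈ Ω, ContDiffAt ℝ 2 G x := fun x hx => hG.contDiffAt (hΩ.mem_nhds hx)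
  have hcc : ContinuousOn (fun x => classicalCurv G x u v w z) Ω := fun x hx =>
    (continuousAt_classicalCurv (x := id) (hGx x hx) (hi x hx) continuousAt_id continuousAt_const
      continuousAt_const continuousAt_const continuousAt_const).continuousWithinAt
  have hae : ∀ᵐ x ∂(volume : Measure (Vec d)), x ∈ Ω → K x - classicalCurv G x u v w z = 0 := by
    refine hΩ.ae_eq_zero_of_integral_contDiff_smul_eq_zero
      ((hK.sub hcc).locallyIntegrableOn hΩ.measurableSet) fun φ hφ hc hs => ?_
    have h1 := hw φ hφ hc hs
    -- for the identity map the weak Gauss equation says that the classical curvature represents the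
    -- distributional one
    have h2 := gauss_weak (F := id) hΩ (fun y _ => contDiffAt_id) hGx
      (fun y hy => Filter.Eventually.mono (hΩ.eventually_mem hy) hi)
      (fun y _ => by rw [fderiv_id]; exact Function.injective_id) u v w z hφ hc hs
    rw [inducedMetric_id] at h2
    have h3 : ∫ y, φ y * gaussCurv G id y u v w z = ∫ y, φ y * classicalCurv G y u v w z := by
      refine integral_congr_ae (Eventually.of_forall fun y => ?_)
      by_cases hy : y ∈ Ω
      · simp only [classicalCurv_eq_gaussCurv_id (hi y hy)]
      · have : φ y = 0 := image_eq_zero_of_notMem_tsupport fun h => hy (hs h)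
        simp [this]
    simp only [smul_eq_mul, mul_sub]
    rw [integral_sub (integrable_mul_of_tsupport hΩ hφ.continuous hc hs hK)
      (integrable_mul_of_tsupport hΩ hφ.continuous hc hs hcc), h1, ← h2, h3, sub_self]
  have heq : EqOn K (fun x => classicalCurv G x u v w z) Ω := by
    refine Measure.eqOn_open_of_ae_eq (μ := volume) ?_ hΩ hK hcc
    rw [Filter.EventuallyEq, ae_restrict_iff' hΩ.measurableSet]
    filter_upwards [hae] with x hx hxΩ
    exact sub_eq_zero.1 (hx hxΩ)
  exact heq

/-! ### Boundary behaviour of conformally compact metrics -/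

lemma tendsto_interior_of_continuousOn {E F : Type*} [TopologicalSpace E]
    [TopologicalSpace F] {f : E → F} {t : Set E} {x : E} (hf : ContinuousOn f t)
    (hx : x ∈ t) : Tendsto f (𝓝[interior t] x) (𝓝 (f x)) :=
  (hf x hx).mono_left (nhdsWithin_mono x interior_subset)

section Boundary

variable {E F : Type*} [NormedAddCommGroup E] [NormedSpace ℝ E]
  [NormedAddCommGroup F] [NormedSpace ℝ F]

lemma fderivWithin_eq_fderiv_of_mem_interior {f : E → F} {t : Set E} {x : E}
    (hx : x ∈ interior t) : fderivWithin ℝ f t x = fderiv ℝ f x :=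
  fderivWithin_of_mem_nhds (mem_interior_iff_mem_nhds.1 hx)

lemma _root_.Filter.Tendsto.clm_apply {ι : Type*} {l : Filter ι} {L : ι → E →L[ℝ] F} {v : ι → E}
    {L₀ : E →L[ℝ] F} {v₀ : E} (hL : Tendsto L l (𝓝 L₀)) (hv : Tendsto v l (𝓝 v₀)) :
    Tendsto (fun i => L i (v i)) l (𝓝 (L₀ v₀)) :=
  (isBoundedBilinearMap_apply.continuous.tendsto (L₀, v₀)).comp (hL.prodMk_nhds hv)

/-- The derivatives at interior points converge at the boundary to the one-sided derivative. -/
lemma tendsto_fderiv_interior {f : E → F} {t : Set E} {x : E} (hf : ContDiffOn ℝ 1 f t)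
    (ht : UniqueDiffOn ℝ t) (hx : x ∈ t) :
    Tendsto (fderiv ℝ f) (𝓝[interior t] x) (𝓝 (fderivWithin ℝ f t x)) := by
  refine (tendsto_interior_of_continuousOn (hf.continuousOn_fderivWithin ht (by norm_num))
    hx).congr' ?_
  filter_upwards [self_mem_nhdsWithin] with y hy
  exact fderivWithin_eq_fderiv_of_mem_interior hy

lemma fderiv_fderivWithin_of_mem_interior {f : E → F} {t : Set E} {x : E}
    (hx : x ∈ interior t) : fderiv ℝ (fderivWithin ℝ f t) x = fderiv ℝ (fderiv ℝ f) x := by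
  refine Filter.EventuallyEq.fderiv_eq ?_
  filter_upwards [isOpen_interior.mem_nhds hx] with y hy
  exact fderivWithin_eq_fderiv_of_mem_interior hy

lemma tendsto_fderiv_fderiv_interior {f : E → F} {t : Set E} {x : E} (hf : ContDiffOn ℝ 2 f t)
    (ht : UniqueDiffOn ℝ t) (hx : x ∈ t) :
    Tendsto (fderiv ℝ (fderiv ℝ f)) (𝓝[interior t] x)
      (𝓝 (fderivWithin ℝ (fderivWithin ℝ f t) t x)) := by
  refine (tendsto_fderiv_interior (hf.fderivWithin ht (m := 1) (by norm_num)) ht hx).congr' ?_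
  filter_upwards [self_mem_nhdsWithin] with y hy
  exact fderiv_fderivWithin_of_mem_interior hy

end Boundary

lemma IsInner.inverse_symm {d : ℕ} {B : Bilin d} (hB : IsInner B) (c : Vec d →L[ℝ] ℝ)
    (v : Vec d) : B v (B.inverse c) = c v := by
  rw [hB.1, hB.apply_inverse]

/-- The leading part of the difference of the Christoffel symbols under a conformal change. -/
def conformalTerm {d : ℕ} (B : Bilin d) (c : Vec d →L[ℝ] ℝ) (u v : Vec d) : Vec d :=
  c u • v + c v • u - B u v • B.inverse c

/-- The algebraic identity that gives the curvature `-|dr|²` at the boundary. -/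
lemma conformalTerm_identity {d : ℕ} {B : Bilin d} (hB : IsInner B) (c : Vec d →L[ℝ] ℝ)
    (u v : Vec d) :
    3 * c u * B (conformalTerm B c v v) u - 3 * c v * B (conformalTerm B c u v) u +
      B (conformalTerm B c u v) (conformalTerm B c v u) -
      B (conformalTerm B c v v) (conformalTerm B c u u) =
      - (c (B.inverse c)) * (B u u * B v v - B u v ^ 2) := by
  simp only [conformalTerm, map_add, map_sub, map_smul, add_apply, sub_apply, smul_apply,
    smul_eq_mul, hB.apply_inverse, hB.inverse_symm]
  rw [hB.1 v u]
  ring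

/-- At the boundary the sectional curvatures of `ρ⁻² G` tend to `-|dρ|²`. The factor `ρ ^ 4` is that
by which the squared areas for `G` and `ρ⁻² G` differ. -/
lemma tendsto_classicalCurv_boundary {d : ℕ} {G : Vec d → Bilin d} {ρ : Vec d → ℝ}
    {t : Set (Vec d)} {x₀ : Vec d} (ht : UniqueDiffOn ℝ t) (hx₀ : x₀ ∈ t)
    (hG : ContDiffOn ℝ 2 G t) (hρ : ContDiffOn ℝ 2 ρ t) (hi : ∀ x ∈ t, IsInner (G x))
    (hpos : ∀ x ∈ interior t, 0 < ρ x) (h0 : ρ x₀ = 0) (u v : Vec d) :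
    Tendsto (fun x => ρ x ^ 4 * classicalCurv (fun y => (ρ y ^ 2)⁻¹ • G y) x u v v u)
      (𝓝[interior t] x₀) (𝓝 (- (fderivWithin ℝ ρ t x₀ ((G x₀).inverse (fderivWithin ℝ ρ t x₀))) *
        (G x₀ u u * G x₀ v v - G x₀ u v ^ 2))) := by
  set l := 𝓝[interior t] x₀
  set c₀ := fderivWithin ℝ ρ t x₀ with hc₀
  have hGx : ∀ x ∈ interior t, DifferentiableAt ℝ G x := fun x hx =>
    (hG.contDiffAt (mem_interior_iff_mem_nhds.1 hx)).differentiableAt (by norm_num)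
  have hρx : ∀ x ∈ interior t, DifferentiableAt ℝ ρ x := fun x hx =>
    (hρ.contDiffAt (mem_interior_iff_mem_nhds.1 hx)).differentiableAt (by norm_num)
  have hρl : Tendsto ρ l (𝓝 0) := h0 ▸ tendsto_interior_of_continuousOn hρ.continuousOn hx₀
  have hGl : Tendsto G l (𝓝 (G x₀)) := tendsto_interior_of_continuousOn hG.continuousOn hx₀
  have hdρ : Tendsto (fderiv ℝ ρ) l (𝓝 c₀) :=
    tendsto_fderiv_interior (hρ.of_le (by norm_num)) ht hx₀
  have hinv : Tendsto (fun x => ContinuousLinearMap.inverse (G x)) l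
      (𝓝 (ContinuousLinearMap.inverse (G x₀))) :=
    (continuousAt_inverse (hi x₀ hx₀)).tendsto.comp hGl
  -- the Christoffel symbols of `G` and the leading terms, smooth up to the boundary
  set f : Vec d → Vec d → Vec d → Vec d → ℝ := fun a b c x => chrL d (fderivWithin ℝ G t x) a b c
  set κ : Vec d → Vec d → Vec d → Vec d → ℝ := fun a b c x =>
    fderivWithin ℝ ρ t x a * G x b c + fderivWithin ℝ ρ t x b * G x a c -
      fderivWithin ℝ ρ t x c * G x a b
  have hf : ∀ a b c, ContDiffOn ℝ 1 (f a b c) t := fun a b c =>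
    ((((chrL d).contDiff.comp_contDiffOn (hG.fderivWithin ht (m := 1) (by norm_num))).clm_apply
      contDiffOn_const).clm_apply contDiffOn_const).clm_apply contDiffOn_const
  have hρ1 : ContDiffOn ℝ 1 (fderivWithin ℝ ρ t) t := hρ.fderivWithin ht (m := 1) (by norm_num)
  have hG1 : ContDiffOn ℝ 1 G t := hG.of_le (by norm_num)
  have hGab : ∀ a b, ContDiffOn ℝ 1 (fun x => G x a b) t := fun a b =>
    (hG1.clm_apply contDiffOn_const).clm_apply contDiffOn_const
  have hρa : ∀ a, ContDiffOn ℝ 1 (fun x => fderivWithin ℝ ρ t x a) t := fun a =>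
    hρ1.clm_apply contDiffOn_const
  have hκ : ∀ a b c, ContDiffOn ℝ 1 (κ a b c) t := fun a b c =>
    (((hρa a).mul (hGab b c)).add ((hρa b).mul (hGab a c))).sub ((hρa c).mul (hGab a b))
  have hκB : ∀ a b c, κ a b c x₀ = G x₀ (conformalTerm (G x₀) c₀ a b) c := fun a b c => by
    simp only [κ, conformalTerm, map_add, map_sub, map_smul, add_apply, sub_apply, smul_apply,
      smul_eq_mul, (hi x₀ hx₀).apply_inverse]
    ring
  have hchr : ∀ a b c, ∀ x ∈ interior t, chrField (fun y => (ρ y ^ 2)⁻¹ • G y) x a b c =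
      (ρ x ^ 2)⁻¹ * f a b c x - (ρ x ^ 3)⁻¹ * κ a b c x := by
    intro a b c x hx
    rw [← christoffelLower_eq_chrField, christoffelLower_conformal (hGx x hx) (hρx x hx)
      (hpos x hx).ne', christoffelLower_eq]
    simp only [f, κ, fderivWithin_eq_fderiv_of_mem_interior hx]
  have hC2 : ∀ x ∈ interior t, ContDiffAt ℝ 2 (fun y => (ρ y ^ 2)⁻¹ • G y) x := by
    intro x hx
    have hx' := mem_interior_iff_mem_nhds.1 hx
    exact (((hρ.contDiffAt hx').pow 2).inv (pow_ne_zero 2 (hpos x hx).ne')).smul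
      (hG.contDiffAt hx')
  -- of the derivative of the Christoffel symbols `ρ⁻² f - ρ⁻³ κ`, only the term in which `ρ⁻³` is
  -- differentiated survives multiplication by `ρ ^ 4` in the limit
  have hD : ∀ e a b c, ∀ x ∈ interior t,
      ρ x ^ 4 * fderiv ℝ (chrField (fun y => (ρ y ^ 2)⁻¹ • G y)) x e a b c =
        ρ x ^ 2 * fderiv ℝ (f a b c) x e - 2 * ρ x * fderiv ℝ ρ x e * f a b c x +
          3 * fderiv ℝ ρ x e * κ a b c x - ρ x * fderiv ℝ (κ a b c) x e := by
    intro e a b c x hx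
    have hx' := mem_interior_iff_mem_nhds.1 hx
    have hρ0 := (hpos x hx).ne'
    have hd := ((contDiffAt_chrField (hC2 x hx)).differentiableAt (by norm_num)).hasFDerivAt
    have h1 := (((hd.clm_apply (hasFDerivAt_const a x)).clm_apply (hasFDerivAt_const b x)).clm_apply
      (hasFDerivAt_const c x)).fderiv
    have h2 : (fun y => chrField (fun y => (ρ y ^ 2)⁻¹ • G y) y a b c) =ᶠ[𝓝 x]
        fun y => (ρ y ^ 2)⁻¹ * f a b c y - (ρ y ^ 3)⁻¹ * κ a b c y := by
      filter_upwards [isOpen_interior.mem_nhds hx] with y hy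
      exact hchr a b c y hy
    have hfd := (((hf a b c).contDiffAt hx').differentiableAt (by norm_num)).hasFDerivAt
    have hκd := (((hκ a b c).contDiffAt hx').differentiableAt (by norm_num)).hasFDerivAt
    have hi2 := (hasDerivAt_inv (pow_ne_zero 2 hρ0)).comp_hasFDerivAt x
      ((hρx x hx).hasFDerivAt.pow 2)
    have hi3 := (hasDerivAt_inv (pow_ne_zero 3 hρ0)).comp_hasFDerivAt x
      ((hρx x hx).hasFDerivAt.pow 3)
    have h3 := ((hi2.mul hfd).sub (hi3.mul hκd)).fderiv
    have h4 := congrArg (fun L => L e) (h1.symm.trans (h2.fderiv_eq.trans h3))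
    simp at h4
    rw [h4]
    field_simp
    ring
  have hcΓ : ∀ a b, ∀ x ∈ interior t, christoffel (fun y => (ρ y ^ 2)⁻¹ • G y) x a b =
      (ρ x)⁻¹ • (ρ x • christoffel G x a b - conformalTerm (G x) (fderiv ℝ ρ x) a b) := by
    intro a b x hx
    rw [christoffel_conformal (hGx x hx) (hρx x hx) (hpos x hx).ne' (hi x (interior_subset hx)),
      smul_sub (ρ x)⁻¹ (ρ x • _), smul_smul, inv_mul_cancel₀ (hpos x hx).ne', one_smul]
    rfl
  have hΓl : ∀ a b, Tendsto (fun x => ρ x • christoffel G x a b -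
      conformalTerm (G x) (fderiv ℝ ρ x) a b) l (𝓝 (- conformalTerm (G x₀) c₀ a b)) := by
    intro a b
    have hDG : Tendsto (fderiv ℝ G) l (𝓝 (fderivWithin ℝ G t x₀)) :=
      tendsto_fderiv_interior hG1 ht hx₀
    have h1 : Tendsto (fun x => christoffel G x a b) l
        (𝓝 ((G x₀).inverse (chrL d (fderivWithin ℝ G t x₀) a b))) := by
      simp only [christoffel, christoffelLower_eq]
      exact hinv.clm_apply (((((chrL d).continuous.tendsto _).comp hDG).clm_apply
        tendsto_const_nhds).clm_apply tendsto_const_nhds)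
    have hca : ∀ a, Tendsto (fun x => fderiv ℝ ρ x a) l (𝓝 (c₀ a)) := fun a =>
      hdρ.clm_apply tendsto_const_nhds
    have h2 : Tendsto (fun x => conformalTerm (G x) (fderiv ℝ ρ x) a b) l
        (𝓝 (conformalTerm (G x₀) c₀ a b)) :=
      (((hca a).smul_const b).add ((hca b).smul_const a)).sub
        (((hGl.clm_apply tendsto_const_nhds).clm_apply tendsto_const_nhds).smul
          (hinv.clm_apply hdρ))
    simpa using (hρl.smul h1).sub h2
  have hDl : ∀ e a b c, Tendsto (fun x => ρ x ^ 2 * fderiv ℝ (f a b c) x e -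
      2 * ρ x * fderiv ℝ ρ x e * f a b c x + 3 * fderiv ℝ ρ x e * κ a b c x -
      ρ x * fderiv ℝ (κ a b c) x e) l
      (𝓝 (3 * c₀ e * G x₀ (conformalTerm (G x₀) c₀ a b) c)) := by
    intro e a b c
    have h1 := (tendsto_fderiv_interior (hf a b c) ht hx₀).clm_apply
      (tendsto_const_nhds (x := e))
    have h2 := (tendsto_fderiv_interior (hκ a b c) ht hx₀).clm_apply
      (tendsto_const_nhds (x := e))
    have h3 := tendsto_interior_of_continuousOn (hf a b c).continuousOn hx₀
    have h4 := tendsto_interior_of_continuousOn (hκ a b c).continuousOn hx₀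
    have h5 := hdρ.clm_apply (tendsto_const_nhds (x := e))
    have h6 := ((((hρl.pow 2).mul h1).sub (((hρl.const_mul 2).mul h5).mul h3)).add
      ((h5.const_mul 3).mul h4)).sub (hρl.mul h2)
    rw [hκB] at h6
    simpa using h6
  have hlim := (((hDl u v v u).sub (hDl v u v u)).add
    ((hGl.clm_apply (hΓl u v)).clm_apply (hΓl v u))).sub
    ((hGl.clm_apply (hΓl v v)).clm_apply (hΓl u u))
  rw [← conformalTerm_identity (hi x₀ hx₀)]
  simp only [map_neg, neg_apply, neg_neg] at hlim
  refine hlim.congr' ?_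
  filter_upwards [self_mem_nhdsWithin] with x hx
  have hρ0 := (hpos x hx).ne'
  rw [classicalCurv, hcΓ _ _ x hx, hcΓ _ _ x hx, hcΓ _ _ x hx, hcΓ _ _ x hx, ← hD u v v u x hx,
    ← hD v u v u x hx]
  simp only [map_smul, smul_apply, smul_eq_mul]
  field_simp

/-! ### Sectional curvature as a function of the plane -/

/-- The numerator of the second fundamental form term of the Gauss equation. -/
def gaussTerm {k n : ℕ} (B : Bilin n) (b : Vec k → Vec k → Vec n) (u v : Vec k) : ℝ :=
  B (b v v) (b u u) - B (b u v) (b v u)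

/-- The squared area of the parallelogram spanned by `u` and `v`. -/
def areaSq {k : ℕ} (h : Bilin k) (u v : Vec k) : ℝ :=
  h u u * h v v - h u v ^ 2

section GaussTerm

variable {k n : ℕ} {B : Bilin n} {b : Vec k → Vec k → Vec n}

lemma gaussTerm_shear (hB : ∀ x y, B x y = B y x) (hb : IsBilinearMap ℝ b) (u v : Vec k) (t : ℝ) :
    gaussTerm B b u (v + t • u) = gaussTerm B b u v := by
  simp only [gaussTerm, hb.add_left, hb.add_right, hb.smul_left, hb.smul_right, map_add, map_smul,
    add_apply, smul_apply, smul_eq_mul]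
  rw [hB (b u u) (b v u)]
  ring

lemma gaussTerm_smul (hb : IsBilinearMap ℝ b) (u v : Vec k) (s t : ℝ) :
    gaussTerm B b (s • u) (t • v) = (s ^ 2 * t ^ 2) * gaussTerm B b u v := by
  simp only [gaussTerm, hb.smul_left, hb.smul_right, map_smul, smul_apply, smul_eq_mul]
  ring

lemma areaSq_shear {h : Bilin k} (hh : ∀ x y, h x y = h y x) (u v : Vec k) (t : ℝ) :
    areaSq h u (v + t • u) = areaSq h u v := by
  simp only [areaSq, map_add, map_smul, add_apply, smul_apply, smul_eq_mul]
  rw [hh v u]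
  ring

/-- An estimate of the Gauss term on orthogonal unit vectors holds for all planes. Orthogonality is
that of `h`, while the vectors are units for the norm of the model space: they range over a compact
set that does not depend on `h`. -/
lemma gaussTerm_ratio_of_orthogonal {h : Bilin k} (hB : ∀ x y, B x y = B y x)
    (hb : IsBilinearMap ℝ b) (hh : IsInner h) {ν ε : ℝ}
    (H : ∀ u v : Vec k, ‖u‖ = 1 → ‖v‖ = 1 → h u v = 0 →
      |gaussTerm B b u v / (h u u * h v v) - ν| < ε)
    {u v : Vec k} (huv : LinearIndependent ℝ ![u, v]) :
    |gaussTerm B b u v / areaSq h u v - ν| < ε := by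
  have hu : u ≠ 0 := huv.ne_zero 0
  have hhu := hh.2 u hu
  set t := - (h u v / h u u) with ht
  set v₁ := v + t • u with hv₁
  have hv₁0 : v₁ ≠ 0 := by
    intro h0
    have := (LinearIndependent.pair_iff.1 huv t 1 (by rw [one_smul, add_comm]; exact h0)).2
    exact one_ne_zero this
  have horth : h u v₁ = 0 := by
    simp only [hv₁, map_add, map_smul, smul_eq_mul, ht]
    field_simp
    ring
  have hnu : ‖u‖ ≠ 0 := norm_ne_zero_iff.2 hu
  have hnv : ‖v₁‖ ≠ 0 := norm_ne_zero_iff.2 hv₁0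
  have key := H (‖u‖⁻¹ • u) (‖v₁‖⁻¹ • v₁) (norm_smul_inv_norm (𝕜 := ℝ) hu)
    (norm_smul_inv_norm (𝕜 := ℝ) hv₁0) (by simp [horth])
  have hhv := hh.2 v₁ hv₁0
  rw [gaussTerm_smul hb] at key
  have e1 : areaSq h u v = h u u * h v₁ v₁ := by
    rw [← areaSq_shear hh.1 u v t, ← hv₁, areaSq, horth]
    ring
  rw [e1, ← gaussTerm_shear hB hb u v t, ← hv₁]
  convert key using 3
  simp only [map_smul, smul_apply, smul_eq_mul]
  field_simp

end GaussTerm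

/-! ### The limit of the second fundamental form at the boundary -/

/-- The data at a point of an immersion into a conformally compact space: the compactified metric,
its derivative, the first two derivatives of the immersion, the value of the defining function and
its differential. -/
abbrev ImmersionJet (k n : ℕ) : Type :=
  Bilin n × (Vec n →L[ℝ] Bilin n) × (Vec k →L[ℝ] Vec n) × (Vec k →L[ℝ] Vec k →L[ℝ] Vec n) × ℝ ×
    (Vec n →L[ℝ] ℝ)

namespace ImmersionJet

variable {k n : ℕ} (w : ImmersionJet k n)

/-- The compactified metric of the ambient space. -/
abbrev metric : Bilin n := w.1

/-- The differential of the immersion. -/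
abbrev tangent : Vec k →L[ℝ] Vec n := w.2.2.1

/-- The metric that the compactified metric induces. -/
def induced : Bilin k := w.metric.bilinearComp w.tangent w.tangent

/-- The normal part of the gradient of the defining function. -/
def normalGrad : Vec n :=
  nproj w.metric w.tangent (ContinuousLinearMap.inverse w.metric w.2.2.2.2.2)

/-- The second fundamental form for the complete metric, multiplied by the defining function. It
extends continuously to the boundary. -/
def scaledForm (u v : Vec k) : Vec n :=
  w.2.2.2.2.1 • secondForm w.metric w.2.1 w.tangent w.2.2.2.1 u v + w.induced u v • w.normalGrad

lemma isBilinearMap_scaledForm : IsBilinearMap ℝ w.scaledForm := by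
  have hb := isBilinearMap_secondForm w.metric w.2.1 w.tangent w.2.2.2.1
  constructor <;> intros <;>
    simp only [scaledForm, hb.add_left, hb.add_right, hb.smul_left, hb.smul_right, map_add,
      map_smul, add_apply, smul_apply, smul_eq_mul] <;> module

variable {w}

section Continuity

variable {Z : Type*} [TopologicalSpace Z] {z : Z} {W : Z → ImmersionJet k n} {u v : Z → Vec k}

lemma continuousAt_induced (hW : ContinuousAt W z) (hu : ContinuousAt u z)
    (hv : ContinuousAt v z) : ContinuousAt (fun y => (W y).induced (u y) (v y)) z := by
  simp only [induced, ContinuousLinearMap.bilinearComp_apply]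
  have hD : ContinuousAt (fun y => (W y).2.2.1) z := hW.snd.snd.fst
  exact (hW.fst.clm_apply (hD.clm_apply hu)).clm_apply (hD.clm_apply hv)

lemma continuousAt_scaledForm (hi : IsInner (W z).metric) (hinj : Function.Injective (W z).tangent)
    (hW : ContinuousAt W z) (hu : ContinuousAt u z) (hv : ContinuousAt v z) :
    ContinuousAt (fun y => (W y).scaledForm (u y) (v y)) z := by
  have hB : ContinuousAt (fun y => (W y).1) z := hW.fst
  have hD : ContinuousAt (fun y => (W y).2.2.1) z := hW.snd.snd.fst
  refine ContinuousAt.add (ContinuousAt.smul hW.snd.snd.snd.snd.fst ?_)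
    ((continuousAt_induced hW hu hv).smul ?_)
  · exact ContinuousAt.secondForm hB hW.snd.fst hD hW.snd.snd.snd.fst hu hv hi hinj
  · exact hB.nproj hD ((hB.bilinInverse hi).clm_apply hW.snd.snd.snd.snd.snd) hi hinj

end Continuity

lemma scaledForm_of_boundary (h0 : w.2.2.2.2.1 = 0) (u v : Vec k) :
    w.scaledForm u v = w.induced u v • w.normalGrad := by
  rw [scaledForm, h0, zero_smul, zero_add]

/-- The squared length of the trace of the second fundamental form tends to `(k + 1)²` times that
of the normal gradient. At the boundary the scaled form is the induced metric times the normal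
gradient, and the trace of a metric with respect to itself is the dimension. -/
lemma tendsto_trace (hi : IsInner w.metric) (hinj : Function.Injective w.tangent)
    (h0 : w.2.2.2.2.1 = 0) :
    Tendsto (fun w : ImmersionJet k n => w.metric (traceForm w.metric w.tangent w.scaledForm)
      (traceForm w.metric w.tangent w.scaledForm)) (𝓝 w)
      (𝓝 ((k + 1 : ℝ) ^ 2 * w.metric w.normalGrad w.normalGrad)) := by
  have htr : ContinuousAt
      (fun w : ImmersionJet k n => traceForm w.metric w.tangent w.scaledForm) w := by
    refine tendsto_finsetSum _ fun i _ => tendsto_finsetSum _ fun j _ => Tendsto.smul ?_ ?_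
    · exact ContinuousAt.comp (f := fun w : ImmersionJet k n => (w.metric, w.tangent))
        (continuousAt_gram_inv (p := (w.metric, w.tangent)) hi hinj i j) (by fun_prop)
    · exact continuousAt_scaledForm (W := fun w : ImmersionJet k n => w) hi hinj continuousAt_id
        continuousAt_const continuousAt_const
  have hval : traceForm w.metric w.tangent w.scaledForm = (k + 1 : ℝ) • w.normalGrad := by
    have h1 : ∀ i, ∑ j, (gram w.metric w.tangent)⁻¹ i j * w.induced (stdVec i) (stdVec j) = 1 := by
      intro i
      have := congrFun (congrFun (gram_inv_mul hi hinj) i) i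
      rw [Matrix.mul_apply, Matrix.one_apply_eq] at this
      rw [← this]
      refine Finset.sum_congr rfl fun j _ => ?_
      congr 1
      exact hi.1 _ _
    simp only [traceForm, scaledForm_of_boundary h0, smul_smul, ← Finset.sum_smul, h1]
    simp
  have hB : ContinuousAt (fun w : ImmersionJet k n => w.metric) w := by fun_prop
  have := (hB.clm_apply htr).clm_apply htr
  rw [ContinuousAt, hval] at this
  simp only [map_smul, smul_apply, smul_eq_mul] at this
  convert this using 2
  ring

/-- The second fundamental form term of the Gauss equation tends to the squared length of the
normal gradient, uniformly over all planes. -/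
lemma eventually_gaussTerm (hi : IsInner w.metric) (hinj : Function.Injective w.tangent)
    (h0 : w.2.2.2.2.1 = 0) {ε : ℝ} (hε : 0 < ε) :
    ∀ᶠ w' : ImmersionJet k n in 𝓝 w, IsInner w'.metric → Function.Injective w'.tangent →
      ∀ u v : Vec k, LinearIndependent ℝ ![u, v] →
        |gaussTerm w'.metric w'.scaledForm u v / areaSq w'.induced u v -
          w.metric w.normalGrad w.normalGrad| < ε := by
  set ν := w.metric w.normalGrad w.normalGrad with hν
  have hind : IsInner w.induced := hi.comp hinj
  -- the ratio for orthogonal vectors, corrected so that its limit does not depend on the plane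
  have hcomp : IsCompact (Metric.sphere (0 : Vec k) 1 ×ˢ Metric.sphere (0 : Vec k) 1) :=
    (isCompact_sphere _ _).prod (isCompact_sphere _ _)
  have hev := hcomp.eventually_forall_of_forall_eventually (x₀ := w)
    (P := fun w' p => |(gaussTerm w'.metric w'.scaledForm p.1 p.2 + ν * w'.induced p.1 p.2 *
      w'.induced p.2 p.1) / (w'.induced p.1 p.1 * w'.induced p.2 p.2) - ν| < ε) ?_
  · filter_upwards [hev] with w' hw' hi' hinj' u v huv
    refine gaussTerm_ratio_of_orthogonal hi'.1 w'.isBilinearMap_scaledForm (hi'.comp hinj' :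
      IsInner w'.induced) (fun a b ha hb hab => ?_) huv
    change w'.induced a b = 0 at hab
    have := hw' (a, b) ⟨by simpa using ha, by simpa using hb⟩
    simp only [hab, mul_zero, zero_mul, add_zero] at this
    exact this
  · rintro ⟨u, v⟩ ⟨hu, hv⟩
    have hu0 : u ≠ 0 := by rintro rfl; simp at hu
    have hv0 : v ≠ 0 := by rintro rfl; simp at hv
    have huu := hind.2 u hu0
    have hvv := hind.2 v hv0
    have hβ : ∀ {f g : Vec k × Vec k → Vec k}, Continuous f → Continuous g →
        ContinuousAt (fun p : ImmersionJet k n × Vec k × Vec k =>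
          p.1.scaledForm (f p.2) (g p.2)) (w, u, v) := fun {f g} hf hg =>
      continuousAt_scaledForm (W := fun p : ImmersionJet k n × Vec k × Vec k => p.1) hi hinj
        continuousAt_fst (hf.comp continuous_snd).continuousAt (hg.comp continuous_snd).continuousAt
    have hh : ∀ {f g : Vec k × Vec k → Vec k}, Continuous f → Continuous g →
        ContinuousAt (fun p : ImmersionJet k n × Vec k × Vec k =>
          p.1.induced (f p.2) (g p.2)) (w, u, v) := fun {f g} hf hg =>
      continuousAt_induced (W := fun p : ImmersionJet k n × Vec k × Vec k => p.1)
        continuousAt_fst (hf.comp continuous_snd).continuousAt (hg.comp continuous_snd).continuousAt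
    have hB : ContinuousAt (fun p : ImmersionJet k n × Vec k × Vec k => p.1.metric) (w, u, v) := by
      fun_prop
    have hc : ContinuousAt (fun p : ImmersionJet k n × Vec k × Vec k =>
        |(gaussTerm p.1.metric p.1.scaledForm p.2.1 p.2.2 + ν * p.1.induced p.2.1 p.2.2 *
          p.1.induced p.2.2 p.2.1) / (p.1.induced p.2.1 p.2.1 * p.1.induced p.2.2 p.2.2) - ν|)
        (w, u, v) := by
      refine ((ContinuousAt.div (ContinuousAt.add (ContinuousAt.sub ?_ ?_)
        ((continuousAt_const.mul ?_).mul ?_)) (ContinuousAt.mul ?_ ?_) ?_).sub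
        continuousAt_const).abs
      · exact (hB.clm_apply (hβ continuous_snd continuous_snd)).clm_apply
          (hβ continuous_fst continuous_fst)
      · exact (hB.clm_apply (hβ continuous_fst continuous_snd)).clm_apply
          (hβ continuous_snd continuous_fst)
      · exact hh continuous_fst continuous_snd
      · exact hh continuous_snd continuous_fst
      · exact hh continuous_fst continuous_fst
      · exact hh continuous_snd continuous_snd
      · exact (mul_pos huu hvv).ne'
    refine hc.eventually_lt continuousAt_const ?_
    simp only [gaussTerm, scaledForm_of_boundary h0, map_smul, smul_apply, smul_eq_mul, ← hν]
    rw [abs_lt]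
    have : (w.induced u u * (w.induced v v * ν) - w.induced v u * (w.induced u v * ν) +
        ν * w.induced u v * w.induced v u) / (w.induced u u * w.induced v v) - ν = 0 := by
      field_simp
      ring
    rw [this]
    exact ⟨by linarith, hε⟩

/-- The normal part of the gradient is shorter than the gradient, unless the defining function is
stationary on the submanifold. -/
lemma normalGrad_lt (hi : IsInner w.metric) (hinj : Function.Injective w.tangent) {a : Vec k}
    (ha : w.2.2.2.2.2 (w.tangent a) ≠ 0) :
    w.metric w.normalGrad w.normalGrad <
      w.2.2.2.2.2 (ContinuousLinearMap.inverse w.metric w.2.2.2.2.2) := by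
  set v := ContinuousLinearMap.inverse w.metric w.2.2.2.2.2
  have h1 := nproj_inner hi hinj v v
  rw [hi.apply_inverse] at h1
  have h2 : v - w.normalGrad ≠ 0 := by
    intro h0
    have h3 : w.metric (v - w.normalGrad) (w.tangent a) = w.2.2.2.2.2 (w.tangent a) := by
      rw [map_sub, sub_apply, hi.apply_inverse, normalGrad, nproj_orthogonal hi hinj, sub_zero]
    rw [h0, map_zero, zero_apply] at h3
    exact ha h3.symm
  have h3 := hi.2 _ h2
  rw [h1]
  change _ < w.metric w.normalGrad w.normalGrad + w.metric (v - w.normalGrad) (v - w.normalGrad)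
  linarith

lemma normalGrad_eq_zero (hi : IsInner w.metric) (hinj : Function.Injective w.tangent)
    (hsurj : Function.Surjective w.tangent) : w.normalGrad = 0 := by
  obtain ⟨a, ha⟩ := hsurj (ContinuousLinearMap.inverse w.metric w.2.2.2.2.2)
  rw [normalGrad, ← ha, nproj_range hi hinj]

end ImmersionJet

/-! ### Charts of manifolds with boundary -/

section Charts

variable {d : ℕ} {X : Type*} [TopologicalSpace X] [ChartedSpace (EuclideanHalfSpace (d + 1)) X]
  [IsManifold (𝓡∂ (d + 1)) ∞ X]

lemma symm_mem_interior {p : X} {z : Vec d}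
    (hz : z ∈ interior (extChartAt (𝓡∂ (d + 1)) p).target) :
    (extChartAt (𝓡∂ (d + 1)) p).symm z ∈ (𝓡∂ (d + 1)).interior X := by
  have hz' := interior_subset hz
  have hs := (extChartAt (𝓡∂ (d + 1)) p).map_target hz'
  refine ((𝓡∂ (d + 1)).isInteriorPoint_iff_of_mem_atlas (n := ∞) (by simp)
    (chart_mem_atlas _ p) (by simpa using hs)).2 ?_
  change extChartAt (𝓡∂ (d + 1)) p ((extChartAt (𝓡∂ (d + 1)) p).symm z) ∈
    interior (extChartAt (𝓡∂ (d + 1)) p).target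
  rwa [(extChartAt (𝓡∂ (d + 1)) p).right_inv hz']

lemma mem_interior_target {p x : X} (hx : x ∈ (extChartAt (𝓡∂ (d + 1)) p).source)
    (hxi : x ∈ (𝓡∂ (d + 1)).interior X) :
    extChartAt (𝓡∂ (d + 1)) p x ∈ interior (extChartAt (𝓡∂ (d + 1)) p).target :=
  ((𝓡∂ (d + 1)).isInteriorPoint_iff_of_mem_atlas (n := ∞) (by simp)
    (chart_mem_atlas _ p) (by simpa using hx)).1 hxi

omit [IsManifold (𝓡∂ (d + 1)) ∞ X] in
lemma range_mem_nhds_of_mem_interior {p : X} {z : Vec d}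
    (hz : z ∈ interior (extChartAt (𝓡∂ (d + 1)) p).target) : range (𝓡∂ (d + 1)) ∈ 𝓝 z :=
  mem_of_superset (mem_interior_iff_mem_nhds.1 hz) (extChartAt_target_subset_range p)

lemma isInvertible_chartInvDeriv {p : X} {z : Vec d}
    (hz : z ∈ (extChartAt (𝓡∂ (d + 1)) p).target) :
    ContinuousLinearMap.IsInvertible (chartInvDeriv p z) :=
  haveI : IsManifold (𝓡∂ (d + 1)) 1 X := IsManifold.of_le (n := ∞) (by simp)
  isInvertible_mfderivWithin_extChartAt_symm hz

lemma bijective_chartInvDeriv {p : X} {z : Vec d}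
    (hz : z ∈ (extChartAt (𝓡∂ (d + 1)) p).target) : Function.Bijective (chartInvDeriv p z) :=
  (isInvertible_chartInvDeriv hz).bijective

omit [IsManifold (𝓡∂ (d + 1)) ∞ X] in
lemma chartInvDeriv_eq_mfderiv {p : X} {z : Vec d}
    (hz : z ∈ interior (extChartAt (𝓡∂ (d + 1)) p).target) :
    chartInvDeriv p z = mfderiv 𝓘(ℝ, Vec d) (𝓡∂ (d + 1)) (extChartAt (𝓡∂ (d + 1)) p).symm z :=
  mfderivWithin_of_mem_nhds (range_mem_nhds_of_mem_interior hz)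

lemma mdifferentiableAt_symm {p : X} {z : Vec d}
    (hz : z ∈ interior (extChartAt (𝓡∂ (d + 1)) p).target) :
    MDifferentiableAt 𝓘(ℝ, Vec d) (𝓡∂ (d + 1)) (extChartAt (𝓡∂ (d + 1)) p).symm z :=
  ((contMDiffOn_extChartAt_symm (n := ∞) p).contMDiffAt
    (mem_interior_iff_mem_nhds.1 hz)).mdifferentiableAt (by simp)

lemma IsInner.chartMetric {g : BilinField d X} {p : X} {z : Vec d}
    (hz : z ∈ (extChartAt (𝓡∂ (d + 1)) p).target)
    (hg : IsInner (g ((extChartAt (𝓡∂ (d + 1)) p).symm z))) : IsInner (chartMetric g p z) :=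
  hg.comp (bijective_chartInvDeriv hz).1

end Charts

section Maps

variable {n k : ℕ} {X : Type*} [TopologicalSpace X] [ChartedSpace (EuclideanHalfSpace (n + 1)) X]
  [IsManifold (𝓡∂ (n + 1)) ∞ X]
  {Y : Type*} [TopologicalSpace Y] [ChartedSpace (EuclideanHalfSpace (k + 1)) Y]
  [IsManifold (𝓡∂ (k + 1)) ∞ Y]

/-- The map `f` in the charts around `p` and `P`. -/
def chartMap (k n : ℕ) {X : Type*} [TopologicalSpace X]
    [ChartedSpace (EuclideanHalfSpace (n + 1)) X] {Y : Type*} [TopologicalSpace Y]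
    [ChartedSpace (EuclideanHalfSpace (k + 1)) Y] (f : Y → X) (p : Y) (P : X) : Vec k → Vec n :=
  fun q => extChartAt (𝓡∂ (n + 1)) P (f ((extChartAt (𝓡∂ (k + 1)) p).symm q))

/-- The points of the chart around `p` where `f` takes values in the chart around `P`. -/
def chartDomain (k n : ℕ) {X : Type*} [TopologicalSpace X]
    [ChartedSpace (EuclideanHalfSpace (n + 1)) X] {Y : Type*} [TopologicalSpace Y]
    [ChartedSpace (EuclideanHalfSpace (k + 1)) Y] (f : Y → X) (p : Y) (P : X) : Set (Vec k) :=
  (extChartAt (𝓡∂ (k + 1)) p).target ∩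
    (extChartAt (𝓡∂ (k + 1)) p).symm ⁻¹' (f ⁻¹' (extChartAt (𝓡∂ (n + 1)) P).source)

variable {f : Y → X} {p : Y} {P : X} {q : Vec k}

omit [IsManifold (𝓡∂ (n + 1)) ∞ X] [IsManifold (𝓡∂ (k + 1)) ∞ Y] in
lemma chartDomain_mem_nhdsWithin (hf : Continuous f) (hq : q ∈ chartDomain k n f p P) :
    chartDomain k n f p P ∈ 𝓝[(extChartAt (𝓡∂ (k + 1)) p).target] q := by
  have h1 := (continuousOn_extChartAt_symm (I := 𝓡∂ (k + 1)) p) q hq.1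
  have h2 : f ⁻¹' (extChartAt (𝓡∂ (n + 1)) P).source ∈
      𝓝 ((extChartAt (𝓡∂ (k + 1)) p).symm q) :=
    ((isOpen_extChartAt_source P).preimage hf).mem_nhds hq.2
  exact inter_mem self_mem_nhdsWithin (h1 h2)

omit [IsManifold (𝓡∂ (n + 1)) ∞ X] [IsManifold (𝓡∂ (k + 1)) ∞ Y] in
lemma mem_interior_chartDomain (hf : Continuous f)
    (hq : q ∈ interior (extChartAt (𝓡∂ (k + 1)) p).target)
    (hq' : f ((extChartAt (𝓡∂ (k + 1)) p).symm q) ∈ (extChartAt (𝓡∂ (n + 1)) P).source) :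
    q ∈ interior (chartDomain k n f p P) := by
  rw [mem_interior_iff_mem_nhds]
  have h := chartDomain_mem_nhdsWithin hf
    (show q ∈ chartDomain k n f p P from ⟨interior_subset hq, hq'⟩)
  rwa [nhdsWithin_eq_nhds.2 (mem_interior_iff_mem_nhds.1 hq)] at h

omit [IsManifold (𝓡∂ (n + 1)) ∞ X] [IsManifold (𝓡∂ (k + 1)) ∞ Y] in
lemma interior_chartDomain_subset :
    interior (chartDomain k n f p P) ⊆ interior (extChartAt (𝓡∂ (k + 1)) p).target :=
  interior_mono inter_subset_left

lemma chartMap_mem_interior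
    (hfi : ∀ y ∈ (𝓡∂ (k + 1)).interior Y, f y ∈ (𝓡∂ (n + 1)).interior X)
    (hq : q ∈ interior (chartDomain k n f p P)) :
    chartMap k n f p P q ∈ interior (extChartAt (𝓡∂ (n + 1)) P).target :=
  mem_interior_target (interior_subset hq).2
    (hfi _ (symm_mem_interior (interior_chartDomain_subset hq)))

omit [IsManifold (𝓡∂ (n + 1)) ∞ X] [IsManifold (𝓡∂ (k + 1)) ∞ Y] in
lemma symm_chartMap (hq : q ∈ chartDomain k n f p P) :
    (extChartAt (𝓡∂ (n + 1)) P).symm (chartMap k n f p P q) =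
      f ((extChartAt (𝓡∂ (k + 1)) p).symm q) :=
  (extChartAt (𝓡∂ (n + 1)) P).left_inv hq.2

lemma contDiffAt_chartMap {N : WithTop ℕ∞} (hN : N ≤ ((⊤ : ℕ∞) : WithTop ℕ∞))
    (hf : ContMDiff (𝓡∂ (k + 1)) (𝓡∂ (n + 1)) N f)
    (hq : q ∈ interior (chartDomain k n f p P)) : ContDiffAt ℝ N (chartMap k n f p P) q := by
  have hq' := interior_chartDomain_subset hq
  have h1 : ContMDiffAt 𝓘(ℝ, Vec k) (𝓡∂ (k + 1)) N (extChartAt (𝓡∂ (k + 1)) p).symm q :=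
    ((contMDiffOn_extChartAt_symm (n := ∞) p).contMDiffAt
      (mem_interior_iff_mem_nhds.1 hq')).of_le hN
  have h2 : ContMDiffAt (𝓡∂ (n + 1)) 𝓘(ℝ, Vec n) N (extChartAt (𝓡∂ (n + 1)) P)
      (f ((extChartAt (𝓡∂ (k + 1)) p).symm q)) :=
    (contMDiffAt_extChartAt' (n := ∞) (by simpa using (interior_subset hq).2)).of_le hN
  exact (h2.comp q ((hf _).comp q h1)).contDiffAt

/-- The differential of `f` in charts. -/
lemma chartInvDeriv_comp_fderiv (hf : ContMDiff (𝓡∂ (k + 1)) (𝓡∂ (n + 1)) 2 f)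
    (hfi : ∀ y ∈ (𝓡∂ (k + 1)).interior Y, f y ∈ (𝓡∂ (n + 1)).interior X)
    (hq : q ∈ interior (chartDomain k n f p P)) (u : Vec k) :
    chartInvDeriv P (chartMap k n f p P q) (fderiv ℝ (chartMap k n f p P) q u) =
      (mfderiv (𝓡∂ (k + 1)) (𝓡∂ (n + 1)) f ((extChartAt (𝓡∂ (k + 1)) p).symm q) :
        Vec k →L[ℝ] Vec n) (chartInvDeriv p q u) := by
  have hF := contDiffAt_chartMap (show (2 : WithTop ℕ∞) ≤ ((⊤ : ℕ∞) : WithTop ℕ∞) from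
      WithTop.coe_le_coe.2 (le_top : ((2 : ℕ) : ℕ∞) ≤ ⊤)) hf hq
  have hFd : MDifferentiableAt 𝓘(ℝ, Vec k) 𝓘(ℝ, Vec n) (chartMap k n f p P) q :=
    (hF.differentiableAt (by norm_num)).mdifferentiableAt
  have hq' := interior_chartDomain_subset hq
  have hz := chartMap_mem_interior hfi hq
  have e : (extChartAt (𝓡∂ (n + 1)) P).symm ∘ chartMap k n f p P =ᶠ[𝓝 q]
      f ∘ (extChartAt (𝓡∂ (k + 1)) p).symm := by
    filter_upwards [isOpen_interior.mem_nhds hq] with y hy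
    exact symm_chartMap (interior_subset hy)
  have h1 := mfderiv_comp (I := 𝓘(ℝ, Vec k)) (I' := 𝓘(ℝ, Vec n)) (I'' := 𝓡∂ (n + 1)) q
    (mdifferentiableAt_symm hz) hFd
  have h2 := mfderiv_comp (I := 𝓘(ℝ, Vec k)) (I' := 𝓡∂ (k + 1)) (I'' := 𝓡∂ (n + 1)) q
    ((hf _).mdifferentiableAt (by norm_num)) (mdifferentiableAt_symm hq')
  have h3 := h1.symm.trans (e.mfderiv_eq.trans h2)
  have h4 := congrArg (fun L : Vec k →L[ℝ] Vec n => L u) h3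
  rw [chartInvDeriv_eq_mfderiv hz, chartInvDeriv_eq_mfderiv hq', ← mfderiv_eq_fderiv]
  exact h4

/-- The components of the pullback metric are the induced metric of the components. -/
lemma chartMetric_pullback (g : BilinField n X) (hf : ContMDiff (𝓡∂ (k + 1)) (𝓡∂ (n + 1)) 2 f)
    (hfi : ∀ y ∈ (𝓡∂ (k + 1)).interior Y, f y ∈ (𝓡∂ (n + 1)).interior X)
    (hq : q ∈ interior (chartDomain k n f p P)) :
    chartMetric (pullback g f : BilinField k Y) p q =
      inducedMetric (chartMetric g P) (chartMap k n f p P) q := by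
  ext u v
  simp only [chartMetric, pullback, inducedMetric, ContinuousLinearMap.bilinearComp_apply]
  rw [chartInvDeriv_comp_fderiv hf hfi hq, chartInvDeriv_comp_fderiv hf hfi hq,
    symm_chartMap (interior_subset hq)]
  rfl

lemma injective_fderiv_chartMap (hf : ContMDiff (𝓡∂ (k + 1)) (𝓡∂ (n + 1)) 2 f)
    (hfi : ∀ y ∈ (𝓡∂ (k + 1)).interior Y, f y ∈ (𝓡∂ (n + 1)).interior X)
    (hinj : ∀ y, Function.Injective (mfderiv (𝓡∂ (k + 1)) (𝓡∂ (n + 1)) f y))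
    (hq : q ∈ interior (chartDomain k n f p P)) :
    Function.Injective (fderiv ℝ (chartMap k n f p P) q) := by
  intro u v huv
  have h1 := chartInvDeriv_comp_fderiv hf hfi hq u
  rw [huv, chartInvDeriv_comp_fderiv hf hfi hq v] at h1
  exact (bijective_chartInvDeriv (interior_subset (interior_chartDomain_subset hq))).1
    (hinj _ h1.symm)

end Maps

section Transition

variable {d : ℕ} {X : Type*} [TopologicalSpace X] [ChartedSpace (EuclideanHalfSpace (d + 1)) X]
  [IsManifold (𝓡∂ (d + 1)) ∞ X] {p Q : X} {z : Vec d}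

/-- The derivative of the inverse chart is the derivative of the change to the chart at the point,
in which the tangent space is identified with the model space. -/
lemma chartInvDeriv_eq_fderiv (hz : z ∈ interior (extChartAt (𝓡∂ (d + 1)) p).target) :
    chartInvDeriv p z =
      fderiv ℝ (chartMap d d id p ((extChartAt (𝓡∂ (d + 1)) p).symm z)) z := by
  refine (chartInvDeriv_eq_mfderiv hz).trans ((mdifferentiableAt_symm hz).mfderiv.trans ?_)
  simp only [modelWithCornersSelf_coe, range_id, fderivWithin_univ]
  rfl

lemma chartMetric_eq_inducedMetric (g : BilinField d X)
    (hz : z ∈ interior (chartDomain d d (id : X → X) p Q)) :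
    chartMetric g p z = inducedMetric (chartMetric g Q) (chartMap d d (id : X → X) p Q) z := by
  have h := chartMetric_pullback (P := Q) g (f := (id : X → X)) (p := p) contMDiff_id
    (fun y hy => hy) hz
  rw [← h]
  congr 1
  ext x u v
  simp only [pullback]
  rw [mfderiv_id]
  rfl

end Transition

/-! ### Distributional identities are local -/

/-- A first order identity in the sense of distributions holds if it holds near every point. -/
lemma weak_of_local {k : ℕ} {Ω : Set (Vec k)} (hΩ : IsOpen Ω) {K a b c : Vec k → ℝ} {u v : Vec k}
    (hK : ContinuousOn K Ω) (ha : ContinuousOn a Ω) (hb : ContinuousOn b Ω) (hc : ContinuousOn c Ω)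
    (hloc : ∀ x ∈ Ω, ∃ U : Set (Vec k), IsOpen U ∧ x ∈ U ∧
      ∀ φ : Vec k → ℝ, ContDiff ℝ ∞ φ → HasCompactSupport φ → tsupport φ ⊆ U →
        ∫ y, φ y * K y = ∫ y, (-(fderiv ℝ φ y u) * a y + fderiv ℝ φ y v * b y + φ y * c y))
    {φ : Vec k → ℝ} (hφ : ContDiff ℝ ∞ φ) (hφc : HasCompactSupport φ) (hφs : tsupport φ ⊆ Ω) :
    ∫ y, φ y * K y = ∫ y, (-(fderiv ℝ φ y u) * a y + fderiv ℝ φ y v * b y + φ y * c y) := by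
  choose! U hUo hxU hU using hloc
  obtain ⟨t, hcover⟩ := hφc.isCompact.elim_nhds_subcover' (fun x _ => U x)
    (fun x hx => (hUo x (hφs hx)).mem_nhds (hxU x (hφs hx)))
  obtain ⟨f, hf⟩ := SmoothPartitionOfUnity.exists_isSubordinate 𝓘(ℝ, Vec k) (isClosed_tsupport φ)
    (fun i : t => U (i : tsupport φ)) (fun i => hUo _ (hφs (i : tsupport φ).2))
    (fun x hx => by simpa using hcover hx)
  -- the pieces of the test function, each supported where the identity is known
  let ψ : t → Vec k → ℝ := fun i y => φ y * f i y
  have hsum : φ = fun y => ∑ i, ψ i y := by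
    funext y
    by_cases hy : y ∈ tsupport φ
    · have h1 := f.sum_eq_one hy
      rw [finsum_eq_sum_of_fintype] at h1
      simp only [ψ, ← Finset.mul_sum, h1, mul_one]
    · simp [ψ, image_eq_zero_of_notMem_tsupport hy]
  have hψ : ∀ i, ContDiff ℝ ∞ (ψ i) := fun i => hφ.mul (f i).contMDiff.contDiff
  have hψc : ∀ i, HasCompactSupport (ψ i) := fun i => hφc.mul_right
  have hψs : ∀ i, tsupport (ψ i) ⊆ Ω := fun i => (tsupport_mul_subset_left).trans hφs
  have hψU : ∀ i : t, tsupport (ψ i) ⊆ U (i : tsupport φ) := fun i =>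
    (tsupport_mul_subset_right).trans (hf i)
  have hD : ∀ y w, fderiv ℝ φ y w = ∑ i, fderiv ℝ (ψ i) y w := by
    intro y w
    have h : fderiv ℝ φ y = fderiv ℝ (fun y => ∑ i, ψ i y) y :=
      congrArg (fun F => fderiv ℝ F y) hsum
    rw [h, fderiv_fun_sum fun i _ => (hψ i).differentiable (by simp) y, sum_apply]
  have hDi : ∀ i w, ∀ g : Vec k → ℝ, ContinuousOn g Ω →
      Integrable fun y => fderiv ℝ (ψ i) y w * g y := fun i w g hg =>
    integrable_mul_of_tsupport hΩ (((hψ i).continuous_fderiv (by simp)).clm_apply continuous_const)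
      ((hψc i).fderiv_apply ℝ w) ((tsupport_fderiv_apply_subset ℝ w).trans (hψs i)) hg
  have hψi : ∀ i, ∀ g : Vec k → ℝ, ContinuousOn g Ω → Integrable fun y => ψ i y * g y :=
    fun i g hg => integrable_mul_of_tsupport hΩ (hψ i).continuous (hψc i) (hψs i) hg
  have h1 : ∫ y, φ y * K y = ∑ i, ∫ y, ψ i y * K y := by
    rw [← integral_finsetSum _ fun i _ => hψi i K hK]
    refine integral_congr_ae (.of_forall fun y => ?_)
    have hy : φ y = ∑ i, ψ i y := congrFun hsum y
    simp only [← Finset.sum_mul]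
    rw [hy]
  rw [h1, Finset.sum_congr rfl fun (i : t) _ =>
    hU _ (hφs (i : tsupport φ).2) (ψ i) (hψ i) (hψc i) (hψU i), ← integral_finsetSum]
  · refine integral_congr_ae (.of_forall fun y => ?_)
    simp only [Finset.sum_add_distrib, ← Finset.sum_mul, Finset.sum_neg_distrib, ← hD]
    have hy : φ y = ∑ i, ψ i y := congrFun hsum y
    rw [← hy]
  · intro i _
    simp only [neg_mul]
    exact ((hDi i u a ha).neg.add (hDi i v b hb)).add (hψi i c hc)

/-! ### Second fundamental form and curvature of immersed manifolds -/

lemma continuousAt_christoffelLower {d : ℕ} {G : Vec d → Bilin d} {x : Vec d}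
    (hG : ContDiffAt ℝ 1 G x) (u v : Vec d) :
    ContinuousAt (fun y => christoffelLower G y u v) x := by
  simp only [christoffelLower_eq_chrField]
  have h : ContinuousAt (chrField G) x :=
    (chrL d).continuous.continuousAt.comp (hG.fderiv_right (m := 0) (by norm_num)).continuousAt
  exact (h.clm_apply continuousAt_const).clm_apply continuousAt_const

lemma continuousAt_christoffel {d : ℕ} {G : Vec d → Bilin d} {x : Vec d}
    (hG : ContDiffAt ℝ 1 G x) (hi : IsInner (G x)) (u v : Vec d) :
    ContinuousAt (fun y => christoffel G y u v) x :=
  (hG.continuousAt.bilinInverse hi).clm_apply (continuousAt_christoffelLower hG u v)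

lemma christoffelLower_congr {d : ℕ} {G G' : Vec d → Bilin d} {x : Vec d} (h : G =ᶠ[𝓝 x] G')
    (u v : Vec d) : christoffelLower G x u v = christoffelLower G' x u v := by
  rw [christoffelLower, christoffelLower, h.fderiv_eq]

lemma christoffel_congr {d : ℕ} {G G' : Vec d → Bilin d} {x : Vec d} (h : G =ᶠ[𝓝 x] G')
    (u v : Vec d) : christoffel G x u v = christoffel G' x u v := by
  rw [christoffel, christoffel, h.self_of_nhds, christoffelLower_congr h]

lemma classicalCurv_congr {d : ℕ} {G G' : Vec d → Bilin d} {x : Vec d} (h : G =ᶠ[𝓝 x] G')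
    (u v w z : Vec d) : classicalCurv G x u v w z = classicalCurv G' x u v w z := by
  have h' : chrField G =ᶠ[𝓝 x] chrField G' := by
    filter_upwards [h.fderiv (𝕜 := ℝ)] with y hy
    ext u v w
    simp [chrField, hy]
  rw [classicalCurv, classicalCurv, h'.fderiv_eq]
  simp only [christoffel_congr h, h.self_of_nhds]

section Immersions

variable {n k : ℕ} {X : Type*} [TopologicalSpace X] [ChartedSpace (EuclideanHalfSpace (n + 1)) X]
  {Y : Type*} [TopologicalSpace Y] [ChartedSpace (EuclideanHalfSpace (k + 1)) Y]

/-- `f` is a `C^2` immersion that maps the interior of `Y` to the interior of `X`, on which `g` is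
a `C^2` metric. -/
structure IsInteriorImmersion (k n : ℕ) {X : Type*} [TopologicalSpace X]
    [ChartedSpace (EuclideanHalfSpace (n + 1)) X] {Y : Type*} [TopologicalSpace Y]
    [ChartedSpace (EuclideanHalfSpace (k + 1)) Y] (g : BilinField n X) (f : Y → X) : Prop where
  contMDiff : ContMDiff (𝓡∂ (k + 1)) (𝓡∂ (n + 1)) 2 f
  mapsTo : ∀ y ∈ (𝓡∂ (k + 1)).interior Y, f y ∈ (𝓡∂ (n + 1)).interior X
  injective : ∀ y, Function.Injective (mfderiv (𝓡∂ (k + 1)) (𝓡∂ (n + 1)) f y)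
  isInner : ∀ x ∈ (𝓡∂ (n + 1)).interior X, IsInner (g x)
  contDiffOn : ∀ P : X,
    ContDiffOn ℝ 2 (chartMetric g P) (interior (extChartAt (𝓡∂ (n + 1)) P).target)

/-- The second fundamental form of `f` at `y`, in the charts around `y` and `f y`: these are the
charts that identify the tangent spaces at `y` and `f y` with the model spaces. -/
def immersionForm (g : BilinField n X) (f : Y → X) (y : Y) (u v : Vec k) : Vec n :=
  secondFundamentalForm (chartMetric g (f y)) (chartMap k n f y (f y))
    (extChartAt (𝓡∂ (k + 1)) y y) u v

lemma isBilinearMap_immersionForm (g : BilinField n X) (f : Y → X) (y : Y) :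
    IsBilinearMap ℝ (immersionForm g f y : Vec k → Vec k → Vec n) :=
  isBilinearMap_secondFundamentalForm _ _ _

variable {g : BilinField n X} {f : Y → X} {p : Y} {P : X} {q : Vec k}

/-- The chart expressions of `f` in two pairs of charts. -/
lemma transition_comp_chartMap (hq : q ∈ interior (chartDomain k n f p P)) :
    chartMap n n (id : X → X) P (f ((extChartAt (𝓡∂ (k + 1)) p).symm q)) ∘ chartMap k n f p P
      =ᶠ[𝓝 q] chartMap k n f ((extChartAt (𝓡∂ (k + 1)) p).symm q)
        (f ((extChartAt (𝓡∂ (k + 1)) p).symm q)) ∘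
        chartMap k k (id : Y → Y) p ((extChartAt (𝓡∂ (k + 1)) p).symm q) := by
  have hτ : q ∈ interior (chartDomain k k (id : Y → Y) p ((extChartAt (𝓡∂ (k + 1)) p).symm q)) :=
    mem_interior_chartDomain continuous_id (interior_chartDomain_subset hq)
      (mem_extChartAt_source (I := 𝓡∂ (k + 1)) ((extChartAt (𝓡∂ (k + 1)) p).symm q))
  filter_upwards [isOpen_interior.mem_nhds hq, isOpen_interior.mem_nhds hτ] with q' h1 h2
  simp only [Function.comp_apply]
  rw [chartMap, symm_chartMap (interior_subset h1), id, chartMap,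
    symm_chartMap (interior_subset h2), id]

namespace IsInteriorImmersion

variable [IsManifold (𝓡∂ (n + 1)) ∞ X] [IsManifold (𝓡∂ (k + 1)) ∞ Y]
  (h : IsInteriorImmersion k n g f)
include h

lemma contDiffAt_chartMap (hq : q ∈ interior (chartDomain k n f p P)) :
    ContDiffAt ℝ 2 (chartMap k n f p P) q :=
  AHGeometry.contDiffAt_chartMap (WithTop.coe_le_coe.2 (le_top : ((2 : ℕ) : ℕ∞) ≤ ⊤)) h.contMDiff hq

lemma chartMap_mem (hq : q ∈ interior (chartDomain k n f p P)) :
    chartMap k n f p P q ∈ interior (extChartAt (𝓡∂ (n + 1)) P).target :=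
  chartMap_mem_interior h.mapsTo hq

lemma injective_fderiv (hq : q ∈ interior (chartDomain k n f p P)) :
    Function.Injective (fderiv ℝ (chartMap k n f p P) q) :=
  injective_fderiv_chartMap h.contMDiff h.mapsTo h.injective hq

omit [IsManifold (𝓡∂ (k + 1)) ∞ Y] in
lemma isInner_chartMetric {z : Vec n} (hz : z ∈ interior (extChartAt (𝓡∂ (n + 1)) P).target) :
    IsInner (chartMetric g P z) :=
  .chartMetric (interior_subset hz) (h.isInner _ (symm_mem_interior hz))

omit [IsManifold (𝓡∂ (n + 1)) ∞ X] [IsManifold (𝓡∂ (k + 1)) ∞ Y] in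
lemma contDiffAt_chartMetric {z : Vec n} (hz : z ∈ interior (extChartAt (𝓡∂ (n + 1)) P).target) :
    ContDiffAt ℝ 2 (chartMetric g P) z :=
  (h.contDiffOn P).contDiffAt (isOpen_interior.mem_nhds hz)

omit [IsManifold (𝓡∂ (k + 1)) ∞ Y] in
lemma eventually_isInner_chartMetric {z : Vec n}
    (hz : z ∈ interior (extChartAt (𝓡∂ (n + 1)) P).target) :
    ∀ᶠ x in 𝓝 z, IsInner (chartMetric g P x) := by
  filter_upwards [isOpen_interior.mem_nhds hz] with x hx using h.isInner_chartMetric hx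

omit [IsManifold (𝓡∂ (n + 1)) ∞ X] in
lemma mem_center {y : Y} (hy : y ∈ (𝓡∂ (k + 1)).interior Y) :
    extChartAt (𝓡∂ (k + 1)) y y ∈ interior (chartDomain k n f y (f y)) :=
  mem_interior_chartDomain h.contMDiff.continuous
    (mem_interior_target (mem_extChartAt_source y) hy)
    (by rw [extChartAt_to_inv]; exact mem_extChartAt_source _)

/-- The second fundamental form in arbitrary charts. -/
lemma chartInvDeriv_secondFundamentalForm (hq : q ∈ interior (chartDomain k n f p P))
    (u v : Vec k) :
    chartInvDeriv P (chartMap k n f p P q)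
      (secondFundamentalForm (chartMetric g P) (chartMap k n f p P) q u v) =
    immersionForm g f ((extChartAt (𝓡∂ (k + 1)) p).symm q)
      (chartInvDeriv p q u) (chartInvDeriv p q v) := by
  have hq' := interior_chartDomain_subset hq
  have hz := h.chartMap_mem hq
  have hzx := symm_chartMap (interior_subset hq)
  have hτq : q ∈ interior
      (chartDomain k k (id : Y → Y) p ((extChartAt (𝓡∂ (k + 1)) p).symm q)) :=
    mem_interior_chartDomain continuous_id hq' (mem_extChartAt_source (I := 𝓡∂ (k + 1)) _)
  have hJ := chartInvDeriv_eq_fderiv hz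
  have hL := chartInvDeriv_eq_fderiv hq'
  have he := transition_comp_chartMap hq
  have hcen := h.mem_center (symm_mem_interior hq')
  rw [hzx] at hJ
  set y := (extChartAt (𝓡∂ (k + 1)) p).symm q with hy
  set F := chartMap k n f p P with hF
  -- the changes of charts in the ambient space and in the submanifold
  set s := chartMap n n (id : X → X) P (f y) with hs
  set τ := chartMap k k (id : Y → Y) p y with hτ
  have hsz : F q ∈ interior (chartDomain n n (id : X → X) P (f y)) :=
    mem_interior_chartDomain continuous_id hz
      (by rw [hzx]; exact mem_extChartAt_source (I := 𝓡∂ (n + 1)) _)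
  have hsc : ContDiffAt ℝ 2 s (F q) := AHGeometry.contDiffAt_chartMap
    (WithTop.coe_le_coe.2 (le_top : ((2 : ℕ) : ℕ∞) ≤ ⊤)) contMDiff_id hsz
  have hτc : ContDiffAt ℝ 2 τ q := AHGeometry.contDiffAt_chartMap
    (WithTop.coe_le_coe.2 (le_top : ((2 : ℕ) : ℕ∞) ≤ ⊤)) contMDiff_id hτq
  have hs1 : s (F q) ∈ interior (extChartAt (𝓡∂ (n + 1)) (f y)).target :=
    chartMap_mem_interior (fun _ hx => hx) hsz
  have hG : chartMetric g P =ᶠ[𝓝 (F q)] inducedMetric (chartMetric g (f y)) s := by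
    filter_upwards [isOpen_interior.mem_nhds hsz] with x hx using chartMetric_eq_inducedMetric g hx
  have hFy := h.contDiffAt_chartMap hcen
  have h1 := secondFundamentalForm_comp_left (h.contDiffAt_chartMap hq) hsc
    (by rw [← hJ]; exact bijective_chartInvDeriv (interior_subset hz))
    ((h.contDiffAt_chartMetric hs1).differentiableAt (by norm_num))
    (h.eventually_isInner_chartMetric hs1) u v
  have h2 := secondFundamentalForm_comp_right (G := chartMetric g (f y)) (τ := τ)
    (F := chartMap k n f y (f y)) (q := q) hτc hFy
    (by rw [← hL]; exact bijective_chartInvDeriv (interior_subset hq'))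
    (h.injective_fderiv hcen) (h.isInner_chartMetric (h.chartMap_mem hcen)) u v
  rw [secondFundamentalForm_congr (EventuallyEq.refl _ F) hG, hJ, ← h1,
    secondFundamentalForm_congr he (EventuallyEq.refl _ _), h2, hL]
  rfl

/-- The mean curvature in arbitrary charts. -/
lemma meanCurvatureNormSq_eq (hq : q ∈ interior (chartDomain k n f p P)) :
    meanCurvatureNormSq k g f ((extChartAt (𝓡∂ (k + 1)) p).symm q) =
      chartMetric g P (chartMap k n f p P q)
        (meanCurvatureVector (chartMetric g P) (chartMap k n f p P) q)
        (meanCurvatureVector (chartMetric g P) (chartMap k n f p P) q) := by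
  have hq' := interior_chartDomain_subset hq
  have hz := h.chartMap_mem hq
  have hzx := symm_chartMap (interior_subset hq)
  have hτq : q ∈ interior
      (chartDomain k k (id : Y → Y) p ((extChartAt (𝓡∂ (k + 1)) p).symm q)) :=
    mem_interior_chartDomain continuous_id hq' (mem_extChartAt_source (I := 𝓡∂ (k + 1)) _)
  have hJ := chartInvDeriv_eq_fderiv hz
  have hL := chartInvDeriv_eq_fderiv hq'
  have he := transition_comp_chartMap hq
  have hcen := h.mem_center (symm_mem_interior hq')
  have hII := h.chartInvDeriv_secondFundamentalForm hq
  rw [hzx] at hJ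
  set y := (extChartAt (𝓡∂ (k + 1)) p).symm q with hy
  set F := chartMap k n f p P with hF
  set s := chartMap n n (id : X → X) P (f y) with hs
  set τ := chartMap k k (id : Y → Y) p y with hτ
  have hsz : F q ∈ interior (chartDomain n n (id : X → X) P (f y)) :=
    mem_interior_chartDomain continuous_id hz
      (by rw [hzx]; exact mem_extChartAt_source (I := 𝓡∂ (n + 1)) _)
  have hsc : ContDiffAt ℝ 2 s (F q) := AHGeometry.contDiffAt_chartMap
    (WithTop.coe_le_coe.2 (le_top : ((2 : ℕ) : ℕ∞) ≤ ⊤)) contMDiff_id hsz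
  have hτc : ContDiffAt ℝ 2 τ q := AHGeometry.contDiffAt_chartMap
    (WithTop.coe_le_coe.2 (le_top : ((2 : ℕ) : ℕ∞) ≤ ⊤)) contMDiff_id hτq
  have hFy := h.contDiffAt_chartMap hcen
  -- the differentials in the two pairs of charts
  have hD := he.fderiv_eq (𝕜 := ℝ)
  rw [fderiv_comp q (hsc.differentiableAt (by norm_num))
    ((h.contDiffAt_chartMap hq).differentiableAt (by norm_num)),
    fderiv_comp q (hFy.differentiableAt (by norm_num)) (hτc.differentiableAt (by norm_num)),
    ← hJ, ← hL] at hD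
  have hGe : chartMetric g P (F q) = inducedMetric (chartMetric g (f y)) s (F q) :=
    chartMetric_eq_inducedMetric g hsz
  have hc : s (F q) = chartMap k n f y (f y) (extChartAt (𝓡∂ (k + 1)) y y) := he.self_of_nhds
  have htr := traceForm_comp (h.isInner_chartMetric (h.chartMap_mem hcen)) (h.injective_fderiv hcen)
    (bijective_chartInvDeriv (interior_subset hq')) (isBilinearMap_immersionForm g f y)
  have hH : meanCurvatureVector (chartMetric g (f y)) (chartMap k n f y (f y))
      (extChartAt (𝓡∂ (k + 1)) y y) =
      chartInvDeriv P (F q) (meanCurvatureVector (chartMetric g P) F q) := by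
    rw [meanCurvatureVector_eq, meanCurvatureVector_eq]
    refine htr.symm.trans ?_
    rw [← hc]
    simp only [← hII]
    have hD' : (fderiv ℝ (chartMap k n f y (f y)) (extChartAt (𝓡∂ (k + 1)) y y)).comp
        (chartInvDeriv p q) = (chartInvDeriv P (F q)).comp (fderiv ℝ F q) := hD.symm
    rw [hD', hGe, inducedMetric, ← hJ]
    simp only [traceForm, map_sum, map_smul]
    rfl
  change chartMetric g (f y) (chartMap k n f y (f y) (extChartAt (𝓡∂ (k + 1)) y y))
    (meanCurvatureVector (chartMetric g (f y)) (chartMap k n f y (f y))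
      (extChartAt (𝓡∂ (k + 1)) y y)) (meanCurvatureVector (chartMetric g (f y))
      (chartMap k n f y (f y)) (extChartAt (𝓡∂ (k + 1)) y y)) = _
  rw [hH, hGe, ← hc, inducedMetric, ← hJ]
  rfl

end IsInteriorImmersion

end Immersions

/-! ### The curvature tensor of an immersed manifold -/

/-- The quadratic expression in the second fundamental form that the Gauss equation adds to the
curvature tensor of the ambient space. -/
def gaussTensor {k n : ℕ} (B : Bilin n) (b : Vec k →L[ℝ] Vec k →L[ℝ] Vec n) :
    ContinuousMultilinearMap ℝ (fun _ : Fin 4 => Vec k) ℝ where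
  toFun m := B (b (m 1) (m 2)) (b (m 0) (m 3)) - B (b (m 0) (m 2)) (b (m 1) (m 3))
  map_update_add' := by
    intro inst m i x y
    obtain rfl : inst = instDecidableEqFin 4 := Subsingleton.elim _ _
    fin_cases i <;> simp <;> ring
  map_update_smul' := by
    intro inst m i c x
    obtain rfl : inst = instDecidableEqFin 4 := Subsingleton.elim _ _
    fin_cases i <;> simp <;> ring
  cont := by fun_prop

section ImmersionCurvature

variable {n k : ℕ} {X : Type*} [TopologicalSpace X] [ChartedSpace (EuclideanHalfSpace (n + 1)) X]
  {Y : Type*} [TopologicalSpace Y] [ChartedSpace (EuclideanHalfSpace (k + 1)) Y]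

/-- The curvature tensor that the Gauss equation assigns to the immersion `f` into a manifold with
curvature tensor `Rm`. -/
def immersionCurv (g : BilinField n X) (Rm : FourTensorField n X) (f : Y → X) :
    FourTensorField k Y := fun y =>
  let D : Vec k →L[ℝ] Vec n := mfderiv (𝓡∂ (k + 1)) (𝓡∂ (n + 1)) f y
  (Rm (f y)).compContinuousLinearMap (fun _ => D) +
  gaussTensor (g (f y)) ((isBilinearMap_immersionForm g f y).toLinearMap.toContinuousBilinearMap)

lemma immersionCurv_apply (g : BilinField n X) (Rm : FourTensorField n X) (f : Y → X) (y : Y)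
    (D : Vec k →L[ℝ] Vec n) (hD : D = mfderiv (𝓡∂ (k + 1)) (𝓡∂ (n + 1)) f y) (u v w z : Vec k) :
    (immersionCurv g Rm f : FourTensorField k Y) y ![u, v, w, z] =
      Rm (f y) ![D u, D v, D w, D z] +
      (g (f y) (immersionForm g f y v w) (immersionForm g f y u z) -
        g (f y) (immersionForm g f y u w) (immersionForm g f y v z)) := by
  have h : (fun i => D (![u, v, w, z] i)) = ![D u, D v, D w, D z] := by
    funext i
    fin_cases i <;> rfl
  rw [← h]
  subst hD
  rfl

variable {g : BilinField n X} {Rm : FourTensorField n X} {f : Y → X} {p : Y} {P : X} {q : Vec k}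
  [IsManifold (𝓡∂ (n + 1)) ∞ X] [IsManifold (𝓡∂ (k + 1)) ∞ Y]

/-- The curvature tensor of a `C^2` metric is the classical one. -/
lemma IsCurvatureTensor.eq_classicalCurv (hRm : IsCurvatureTensor g Rm)
    (hi : ∀ x ∈ (𝓡∂ (n + 1)).interior X, IsInner (g x))
    (hG : ContDiffOn ℝ 2 (chartMetric g P) (interior (extChartAt (𝓡∂ (n + 1)) P).target))
    {x : Vec n} (hx : x ∈ interior (extChartAt (𝓡∂ (n + 1)) P).target) (u v w z : Vec n) :
    Rm ((extChartAt (𝓡∂ (n + 1)) P).symm x)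
      ![chartInvDeriv P x u, chartInvDeriv P x v, chartInvDeriv P x w, chartInvDeriv P x z] =
      classicalCurv (chartMetric g P) x u v w z :=
  eq_classicalCurv_of_weak isOpen_interior hG
    (fun _ hy => .chartMetric (interior_subset hy) (hi _ (symm_mem_interior hy))) u v w z
    (hRm P u v w z).1 (hRm P u v w z).2 x hx

namespace IsInteriorImmersion

variable (h : IsInteriorImmersion k n g f)
include h

/-- The Gauss equation in charts. -/
lemma immersionCurv_eq_gaussCurv (hRm : IsCurvatureTensor g Rm)
    (hq : q ∈ interior (chartDomain k n f p P)) (u v w z : Vec k) :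
    (immersionCurv g Rm f : FourTensorField k Y) ((extChartAt (𝓡∂ (k + 1)) p).symm q)
      ![chartInvDeriv p q u, chartInvDeriv p q v, chartInvDeriv p q w, chartInvDeriv p q z] =
      gaussCurv (chartMetric g P) (chartMap k n f p P) q u v w z := by
  obtain ⟨D, hD⟩ : ∃ D : Vec k →L[ℝ] Vec n, D = mfderiv (𝓡∂ (k + 1)) (𝓡∂ (n + 1)) f
    ((extChartAt (𝓡∂ (k + 1)) p).symm q) := ⟨_, rfl⟩
  have hDu : ∀ u, D (chartInvDeriv p q u) =
      chartInvDeriv P (chartMap k n f p P q) (fderiv ℝ (chartMap k n f p P) q u) := fun u => by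
    rw [hD]
    exact (chartInvDeriv_comp_fderiv h.contMDiff h.mapsTo hq u).symm
  rw [immersionCurv_apply g Rm f _ D hD]
  simp only [hDu, ← h.chartInvDeriv_secondFundamentalForm hq, ← symm_chartMap (interior_subset hq)]
  rw [hRm.eq_classicalCurv h.isInner (h.contDiffOn P) (h.chartMap_mem hq), gaussCurv, add_sub_assoc]
  rfl

lemma chartMetric_pullback_eventuallyEq (hq : q ∈ interior (chartDomain k n f p P)) :
    chartMetric (pullback g f : BilinField k Y) p =ᶠ[𝓝 q]
      inducedMetric (chartMetric g P) (chartMap k n f p P) := by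
  filter_upwards [isOpen_interior.mem_nhds hq] with y hy using
    chartMetric_pullback g h.contMDiff h.mapsTo hy

lemma contDiffAt_chartMetric_pullback (hq : q ∈ interior (chartDomain k n f p P)) :
    ContDiffAt ℝ 1 (chartMetric (pullback g f : BilinField k Y) p) q := by
  refine ContDiffAt.congr_of_eventuallyEq ?_ (h.chartMetric_pullback_eventuallyEq hq)
  have hF := h.contDiffAt_chartMap hq
  have hG := h.contDiffAt_chartMetric (h.chartMap_mem hq)
  exact ContDiffAt.comp (f := fun y => (chartMetric g P (chartMap k n f p P y),
    fderiv ℝ (chartMap k n f p P) y)) q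
    (contDiff_bilinearComp (k := k) (n := n) (N := 1)).contDiffAt
    (((hG.of_le (by norm_num)).comp q (hF.of_le (by norm_num))).prodMk
      (hF.fderiv_right (m := 1) (by norm_num)))

omit [IsManifold (𝓡∂ (n + 1)) ∞ X] [IsManifold (𝓡∂ (k + 1)) ∞ Y] in
lemma mem_chartDomain_self (hq : q ∈ interior (extChartAt (𝓡∂ (k + 1)) p).target) :
    q ∈ interior (chartDomain k n f p (f ((extChartAt (𝓡∂ (k + 1)) p).symm q))) :=
  mem_interior_chartDomain h.contMDiff.continuous hq (mem_extChartAt_source _)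

/-- The Gauss equation computes the curvature of the pullback metric, which may be only `C^1`. -/
lemma isCurvatureTensor_immersionCurv (hRm : IsCurvatureTensor g Rm) :
    IsCurvatureTensor (pullback g f : BilinField k Y) (immersionCurv g Rm f) := by
  intro p u v w z Ω G K
  -- the ambient chart is the one around `f x`, which covers only a neighbourhood of `x` in `Ω`
  have hKeq : ∀ x ∈ Ω,
      ∀ y ∈ interior (chartDomain k n f p (f ((extChartAt (𝓡∂ (k + 1)) p).symm x))),
      K y = gaussCurv (chartMetric g (f ((extChartAt (𝓡∂ (k + 1)) p).symm x)))
        (chartMap k n f p (f ((extChartAt (𝓡∂ (k + 1)) p).symm x))) y u v w z :=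
    fun x hx y hy => h.immersionCurv_eq_gaussCurv hRm hy u v w z
  have hKc : ContinuousOn K Ω := by
    intro x hx
    have hx' := h.mem_chartDomain_self hx
    refine ((continuousAt_gaussCurv (h.contDiffAt_chartMap hx')
      (h.contDiffAt_chartMetric (h.chartMap_mem hx')) (h.isInner_chartMetric (h.chartMap_mem hx'))
      (h.injective_fderiv hx') u v w z).congr ?_).continuousWithinAt
    filter_upwards [isOpen_interior.mem_nhds hx'] with y hy using (hKeq x hx y hy).symm
  have hG1 : ∀ x ∈ Ω, ContDiffAt ℝ 1 G x := fun x hx =>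
    h.contDiffAt_chartMetric_pullback (h.mem_chartDomain_self hx)
  have hGi : ∀ x ∈ Ω, IsInner (G x) := fun x hx => by
    have hx' := h.mem_chartDomain_self hx
    have he : G x = _ := (h.chartMetric_pullback_eventuallyEq hx').self_of_nhds
    rw [he]
    exact (h.isInner_chartMetric (h.chartMap_mem hx')).comp (h.injective_fderiv hx')
  have hcL : ∀ a b, ContinuousOn (fun y => christoffelLower G y a b z) Ω := fun a b x hx =>
    ((continuousAt_christoffelLower (hG1 x hx) a b).clm_apply
      continuousAt_const).continuousWithinAt
  have hc : ∀ a b a' b', ContinuousOn (fun y => G y (christoffel G y a b)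
      (christoffel G y a' b')) Ω := fun a b a' b' x hx =>
    (((hG1 x hx).continuousAt.clm_apply
      (continuousAt_christoffel (hG1 x hx) (hGi x hx) a b)).clm_apply
      (continuousAt_christoffel (hG1 x hx) (hGi x hx) a' b')).continuousWithinAt
  refine ⟨hKc, fun φ hφ hφc hφs => weak_of_local isOpen_interior hKc (hcL v w) (hcL u w)
    ((hc u w v z).sub (hc v w u z)) (fun x hx => ⟨_, isOpen_interior, h.mem_chartDomain_self hx,
      fun ψ hψ hψc hψs => ?_⟩) hφ hφc hφs⟩
  have hgw := gauss_weak isOpen_interior (fun y hy => h.contDiffAt_chartMap hy)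
    (fun y hy => h.contDiffAt_chartMetric (h.chartMap_mem hy))
    (fun y hy => h.eventually_isInner_chartMetric (h.chartMap_mem hy))
    (fun y hy => h.injective_fderiv hy) u v w z hψ hψc hψs
  refine Eq.trans ?_ (hgw.trans ?_)
  · refine integral_congr_ae (.of_forall fun y => ?_)
    by_cases hy : y ∈ tsupport ψ
    · simp only [hKeq x hx y (hψs hy)]
    · simp [image_eq_zero_of_notMem_tsupport hy]
  · refine integral_congr_ae (.of_forall fun y => ?_)
    by_cases hy : y ∈ tsupport ψ
    · have he := (h.chartMetric_pullback_eventuallyEq (hψs hy)).symm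
      simp only [christoffelLower_congr he, christoffel_congr he, he.self_of_nhds]
      rfl
    · have h0 : fderiv ℝ ψ y = 0 :=
        image_eq_zero_of_notMem_tsupport fun h' => hy (tsupport_fderiv_subset ℝ h')
      simp [image_eq_zero_of_notMem_tsupport hy, h0]

end IsInteriorImmersion

end ImmersionCurvature

/-! ### Defining functions and compactified metrics at the boundary -/

lemma IsInner.areaSq_pos {k : ℕ} {h : Bilin k} (hh : IsInner h) {u v : Vec k}
    (huv : LinearIndependent ℝ ![u, v]) : 0 < areaSq h u v := by
  have hu : u ≠ 0 := by simpa using huv.ne_zero 0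
  have huu := hh.2 u hu
  have hw : v + (-(h u v / h u u)) • u ≠ 0 := fun h0 => by
    have h1 := (LinearIndependent.pair_iff.1 huv) (-(h u v / h u u)) 1
      (by rw [one_smul, add_comm, h0])
    exact one_ne_zero h1.2
  rw [← areaSq_shear hh.1 u v (-(h u v / h u u))]
  have hort : h u (v + (-(h u v / h u u)) • u) = 0 := by
    rw [map_add, map_smul, smul_eq_mul]
    field_simp
    ring
  rw [areaSq, hort]
  have := mul_pos huu (hh.2 _ hw)
  linarith

lemma linearIndependent_pair_map {k n : ℕ} {L : Vec k →L[ℝ] Vec n} (hL : Function.Injective L)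
    {u v : Vec k} (huv : LinearIndependent ℝ ![u, v]) : LinearIndependent ℝ ![L u, L v] := by
  rw [LinearIndependent.pair_iff] at huv ⊢
  intro a b hab
  rw [← map_smul, ← map_smul, ← map_add, ← map_zero L] at hab
  exact huv a b (hL hab)

section DefiningFunction

variable {d : ℕ} {X : Type*} [TopologicalSpace X] [ChartedSpace (EuclideanHalfSpace (d + 1)) X]
  {r : X → ℝ}

namespace IsDefiningFunction

lemma nonneg (hr : IsDefiningFunction d r) (x : X) : 0 ≤ r x := by
  rcases (𝓡∂ (d + 1)).isInteriorPoint_or_isBoundaryPoint x with hx | hx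
  · exact (hr.2.1 x hx).le
  · exact (hr.2.2 x hx).1.ge

variable [IsManifold (𝓡∂ (d + 1)) ∞ X]

lemma contDiffOn_chart (hr : IsDefiningFunction d r) (P : X) :
    ContDiffOn ℝ ∞ (r ∘ (extChartAt (𝓡∂ (d + 1)) P).symm) (extChartAt (𝓡∂ (d + 1)) P).target :=
  contMDiffOn_iff_contDiffOn.1 (hr.1.comp_contMDiffOn (contMDiffOn_extChartAt_symm P))

omit [IsManifold (𝓡∂ (d + 1)) ∞ X] in
lemma fderivWithin_chart (hr : IsDefiningFunction d r) (x : X) :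
    fderivWithin ℝ (r ∘ (extChartAt (𝓡∂ (d + 1)) x).symm) (extChartAt (𝓡∂ (d + 1)) x).target
      (extChartAt (𝓡∂ (d + 1)) x x) = mfderiv (𝓡∂ (d + 1)) 𝓘(ℝ, ℝ) r x := by
  rw [fderivWithin_congr_set extChartAt_target_eventuallyEq,
    (hr.1.mdifferentiableAt (by simp)).mfderiv]
  rfl

omit [IsManifold (𝓡∂ (d + 1)) ∞ X] in
lemma fderivWithin_chart_ne_zero (hr : IsDefiningFunction d r) {x : X}
    (hx : x ∈ (𝓡∂ (d + 1)).boundary X) :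
    fderivWithin ℝ (r ∘ (extChartAt (𝓡∂ (d + 1)) x).symm) (extChartAt (𝓡∂ (d + 1)) x).target
      (extChartAt (𝓡∂ (d + 1)) x x) ≠ 0 := by
  rw [hr.fderivWithin_chart x]
  exact (hr.2.2 x hx).2

omit [IsManifold (𝓡∂ (d + 1)) ∞ X] in
/-- A defining function vanishes to first order along the boundary, where it is minimal. -/
lemma fderivWithin_chart_eq_zero (hr : IsDefiningFunction d r) {x : X}
    (hx : x ∈ (𝓡∂ (d + 1)).boundary X) {v : Vec d} (hv : v 0 = 0) :
    fderivWithin ℝ (r ∘ (extChartAt (𝓡∂ (d + 1)) x).symm) (extChartAt (𝓡∂ (d + 1)) x).target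
      (extChartAt (𝓡∂ (d + 1)) x x) v = 0 := by
  rw [fderivWithin_congr_set extChartAt_target_eventuallyEq]
  have hmin : IsLocalMinOn (r ∘ (extChartAt (𝓡∂ (d + 1)) x).symm) (range (𝓡∂ (d + 1)))
      (extChartAt (𝓡∂ (d + 1)) x x) := by
    refine .of_forall fun z => ?_
    simp only [Function.comp_apply, extChartAt_to_inv, (hr.2.2 x hx).1]
    exact hr.nonneg _
  have hcone : ∀ w : Vec d, w 0 = 0 →
      w ∈ posTangentConeAt (range (𝓡∂ (d + 1))) (extChartAt (𝓡∂ (d + 1)) x x) := by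
    intro w hw
    refine mem_posTangentConeAt_of_segment_subset ?_
    have hx0 : (extChartAt (𝓡∂ (d + 1)) x x) ∈ range (𝓡∂ (d + 1)) :=
      extChartAt_target_subset_range x (mem_extChartAt_target x)
    rw [range_modelWithCornersEuclideanHalfSpace] at hx0 ⊢
    rintro z ⟨a, b, ha, hb, hab, rfl⟩
    have h1 : (0 : ℝ) ≤ (extChartAt (𝓡∂ (d + 1)) x x) 0 := hx0
    simp only [mem_ofPred_eq, PiLp.add_apply, PiLp.smul_apply, smul_eq_mul, hw, add_zero]
    positivity
  exact hmin.fderivWithin_eq_zero (hcone v hv) (hcone (-v) (by simp [hv]))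

end IsDefiningFunction

/-- `gbar = r² g` is a `C^2` metric on `X` up to the boundary, for the defining function `r`. -/
structure IsCompactification (d : ℕ) {X : Type*} [TopologicalSpace X]
    [ChartedSpace (EuclideanHalfSpace (d + 1)) X] (g gbar : BilinField d X) (r : X → ℝ) : Prop where
  isDefiningFunction : IsDefiningFunction d r
  isInner : ∀ x, IsInner (gbar x)
  contDiffOn : ∀ P : X,
    ContDiffOn ℝ 2 (chartMetric gbar P) (extChartAt (𝓡∂ (d + 1)) P).target
  eq_smul : ∀ x ∈ (𝓡∂ (d + 1)).interior X, gbar x = (r x) ^ 2 • g x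

namespace IsCompactification

variable {g gbar : BilinField d X} [IsManifold (𝓡∂ (d + 1)) ∞ X]
  (h : IsCompactification d g gbar r)
include h

lemma pos_chart {P : X} {z : Vec d} (hz : z ∈ interior (extChartAt (𝓡∂ (d + 1)) P).target) :
    0 < (r ∘ (extChartAt (𝓡∂ (d + 1)) P).symm) z :=
  h.isDefiningFunction.2.1 _ (symm_mem_interior hz)

lemma chartMetric_eq {P : X} {z : Vec d}
    (hz : z ∈ interior (extChartAt (𝓡∂ (d + 1)) P).target) :
    chartMetric g P z =
      ((r ∘ (extChartAt (𝓡∂ (d + 1)) P).symm) z ^ 2)⁻¹ • chartMetric gbar P z := by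
  have hpos := h.pos_chart hz
  ext u v
  simp only [chartMetric, h.eq_smul _ (symm_mem_interior hz), smul_apply,
    ContinuousLinearMap.bilinearComp_apply, smul_eq_mul, Function.comp_apply] at hpos ⊢
  field_simp

lemma chartMetric_eventuallyEq {P : X} {z : Vec d}
    (hz : z ∈ interior (extChartAt (𝓡∂ (d + 1)) P).target) :
    chartMetric g P =ᶠ[𝓝 z]
      fun z => ((r ∘ (extChartAt (𝓡∂ (d + 1)) P).symm) z ^ 2)⁻¹ • chartMetric gbar P z := by
  filter_upwards [isOpen_interior.mem_nhds hz] with y hy using h.chartMetric_eq hy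

lemma contDiffOn_chartMetric (P : X) :
    ContDiffOn ℝ 2 (chartMetric g P) (interior (extChartAt (𝓡∂ (d + 1)) P).target) := by
  have hρ : ContDiffOn ℝ 2 (r ∘ (extChartAt (𝓡∂ (d + 1)) P).symm)
      (interior (extChartAt (𝓡∂ (d + 1)) P).target) :=
    ((h.isDefiningFunction.contDiffOn_chart P).of_le
      (WithTop.coe_le_coe.2 (le_top : ((2 : ℕ) : ℕ∞) ≤ ⊤))).mono interior_subset
  refine ContDiffOn.congr (ContDiffOn.smul (ContDiffOn.inv (hρ.pow 2) fun z hz => ?_)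
    ((h.contDiffOn P).mono interior_subset)) fun z hz => h.chartMetric_eq hz
  exact pow_ne_zero 2 (h.pos_chart hz).ne'

omit [IsManifold (𝓡∂ (d + 1)) ∞ X] in
lemma isInner_interior {x : X} (hx : x ∈ (𝓡∂ (d + 1)).interior X) : IsInner (g x) := by
  have hpos := h.isDefiningFunction.2.1 x hx
  have h1 : g x = ((r x) ^ 2)⁻¹ • gbar x := by
    rw [h.eq_smul x hx, smul_smul, inv_mul_cancel₀ (by positivity), one_smul]
  rw [h1]
  exact (h.isInner x).smul (by positivity)

lemma sectional_chart {Rm : FourTensorField d X} (hRm : IsCurvatureTensor g Rm) {P : X} {z : Vec d}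
    (hz : z ∈ interior (extChartAt (𝓡∂ (d + 1)) P).target) (u v : Vec d) :
    sectional g Rm ((extChartAt (𝓡∂ (d + 1)) P).symm z) (chartInvDeriv P z u)
      (chartInvDeriv P z v) = classicalCurv (chartMetric g P) z u v v u /
        areaSq (chartMetric g P z) u v := by
  rw [sectional, hRm.eq_classicalCurv (fun x hx => h.isInner_interior hx)
    (h.contDiffOn_chartMetric P) hz]
  rfl

/-- Asymptotic sectional curvature `-1` means that `|dr| = 1` along the boundary. -/
lemma inverse_fderivWithin_eq_one {Rm : FourTensorField d X} (hRm : IsCurvatureTensor g Rm)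
    (hd : d ≠ 0)
    (hsec : ∀ ε > 0, ∀ᶠ x in 𝓝ˢ ((𝓡∂ (d + 1)).boundary X), x ∈ (𝓡∂ (d + 1)).interior X →
      ∀ u v : Vec d, LinearIndependent ℝ ![u, v] → |sectional g Rm x u v - (-1)| < ε)
    {x : X} (hx : x ∈ (𝓡∂ (d + 1)).boundary X) :
    fderivWithin ℝ (r ∘ (extChartAt (𝓡∂ (d + 1)) x).symm) (extChartAt (𝓡∂ (d + 1)) x).target
      (extChartAt (𝓡∂ (d + 1)) x x) ((chartMetric gbar x (extChartAt (𝓡∂ (d + 1)) x x)).inverse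
        (fderivWithin ℝ (r ∘ (extChartAt (𝓡∂ (d + 1)) x).symm)
          (extChartAt (𝓡∂ (d + 1)) x).target (extChartAt (𝓡∂ (d + 1)) x x))) = 1 := by
  set t := (extChartAt (𝓡∂ (d + 1)) x).target with ht
  set z₀ := extChartAt (𝓡∂ (d + 1)) x x with hz₀
  set ρ := r ∘ (extChartAt (𝓡∂ (d + 1)) x).symm with hρ
  set G := chartMetric gbar x with hG
  set c₀ := fderivWithin ℝ ρ t z₀ with hc₀
  have hz₀t : z₀ ∈ t := mem_extChartAt_target x
  have hρz : ρ z₀ = 0 := by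
    simp only [hρ, hz₀, Function.comp_apply, extChartAt_to_inv, (h.isDefiningFunction.2.2 x hx).1]
  have hρ2 : ContDiffOn ℝ 2 ρ t := (h.isDefiningFunction.contDiffOn_chart x).of_le
      (WithTop.coe_le_coe.2 (le_top : ((2 : ℕ) : ℕ∞) ≤ ⊤))
  have hGi : ∀ z ∈ t, IsInner (G z) := fun z hz => .chartMetric hz (h.isInner _)
  have : (𝓝[interior t] z₀).NeBot :=
    mem_closure_iff_nhdsWithin_neBot.1 (extChartAt_target_subset_closure_interior hz₀t)
  -- a single plane suffices, and there is one since the dimension `d + 1` is at least two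
  let u : Vec d := stdVec 0
  let v : Vec d := stdVec (Fin.last d)
  have huv : LinearIndependent ℝ ![u, v] := by
    rw [LinearIndependent.pair_iff]
    intro a b hab
    have h0 := congrArg (fun w : Vec d => w 0) hab
    have h1 := congrArg (fun w : Vec d => w (Fin.last d)) hab
    have hne : (Fin.last d) ≠ 0 := by simpa [Fin.ext_iff] using hd
    simp [u, v, stdVec, hne, hne.symm] at h0 h1
    exact ⟨h0, h1⟩
  have hlim := tendsto_classicalCurv_boundary (uniqueDiffOn_extChartAt_target x) hz₀t
    (h.contDiffOn x) hρ2 hGi (fun z hz => h.pos_chart hz) hρz u v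
  have harea : Tendsto (fun z => areaSq (G z) u v) (𝓝[interior t] z₀) (𝓝 (areaSq (G z₀) u v)) := by
    have hGt := tendsto_interior_of_continuousOn (h.contDiffOn x).continuousOn hz₀t
    have hGt' : ∀ a b : Vec d, Tendsto (fun z => G z a b) (𝓝[interior t] z₀) (𝓝 (G z₀ a b)) :=
      fun a b => (hGt.clm_apply tendsto_const_nhds).clm_apply tendsto_const_nhds
    exact ((hGt' u u).mul (hGt' v v)).sub ((hGt' u v).pow 2)
  have hA : areaSq (G z₀) u v ≠ 0 := ((hGi z₀ hz₀t).areaSq_pos huv).ne'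
  have h1 : Tendsto (fun z => sectional g Rm ((extChartAt (𝓡∂ (d + 1)) x).symm z)
      (chartInvDeriv x z u) (chartInvDeriv x z v)) (𝓝[interior t] z₀)
      (𝓝 (-(c₀ ((G z₀).inverse c₀)))) := by
    have h2 := hlim.div harea hA
    rw [show G z₀ u u * G z₀ v v - G z₀ u v ^ 2 = areaSq (G z₀) u v from rfl,
      mul_div_cancel_right₀ _ hA] at h2
    refine h2.congr' ?_
    filter_upwards [self_mem_nhdsWithin] with z hz
    have hp := h.pos_chart hz
    have hp' : 0 < ρ z := hp
    have ha := (hGi z (interior_subset hz)).areaSq_pos huv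
    rw [h.sectional_chart hRm hz, classicalCurv_congr (h.chartMetric_eventuallyEq hz),
      h.chartMetric_eq hz]
    have h3 : areaSq ((ρ z ^ 2)⁻¹ • G z) u v = (ρ z ^ 4)⁻¹ * areaSq (G z) u v := by
      simp only [areaSq, smul_apply, smul_eq_mul]
      field_simp
    rw [h3]
    simp only [Pi.div_apply]
    field_simp
    rfl
  have h2 : Tendsto (fun z => sectional g Rm ((extChartAt (𝓡∂ (d + 1)) x).symm z)
      (chartInvDeriv x z u) (chartInvDeriv x z v)) (𝓝[interior t] z₀) (𝓝 (-1)) := by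
    rw [Metric.tendsto_nhds]
    intro ε hε
    have h3 := (hsec ε hε).filter_mono (nhds_le_nhdsSet hx)
    have h4 : Tendsto (extChartAt (𝓡∂ (d + 1)) x).symm (𝓝[interior t] z₀) (𝓝 x) := by
      have h5 := tendsto_interior_of_continuousOn (continuousOn_extChartAt_symm x) hz₀t
      rwa [extChartAt_to_inv] at h5
    filter_upwards [h4.eventually h3, self_mem_nhdsWithin] with z hz hzt
    rw [Real.dist_eq]
    refine hz (symm_mem_interior hzt) _ _ (linearIndependent_pair_map
      (bijective_chartInvDeriv (interior_subset hzt)).1 huv)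
  have h3 := tendsto_nhds_unique h1 h2
  linarith

end IsCompactification

end DefiningFunction

/-! ### Immersions that are transversal to the boundary -/

lemma traceForm_smul {k n : ℕ} {B : Bilin n} (hB : IsInner B) {D : Vec k →L[ℝ] Vec n}
    (hD : Function.Injective D) (b : Vec k → Vec k → Vec n) {c : ℝ} (hc : c ≠ 0) (s : ℝ) :
    traceForm (c • B) D (fun u v => s • b u v) = (c⁻¹ * s) • traceForm B D b := by
  have h1 : gram (c • B) D = (Units.mk0 c hc) • gram B D := by
    ext i j
    simp [gram, Units.smul_def]
  rw [traceForm, traceForm, h1, Matrix.inv_smul' _ _ (gram_isUnit hB hD)]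
  simp [Finset.smul_sum, smul_smul, Units.smul_def]
  refine Finset.sum_congr rfl fun i _ => Finset.sum_congr rfl fun j _ => ?_
  congr 1
  ring

section Boundary

variable {n k : ℕ} {X : Type*} [TopologicalSpace X] [ChartedSpace (EuclideanHalfSpace (n + 1)) X]
  {Y : Type*} [TopologicalSpace Y] [ChartedSpace (EuclideanHalfSpace (k + 1)) Y]

/-- `f` is a `C^2` immersion of manifolds with boundary that is transversal to the boundary of `X`,
and `g` is a metric on the interior of `X` with the compactification `gbar = r² g`. -/
structure IsTransversalImmersion (k n : ℕ) {X : Type*} [TopologicalSpace X]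
    [ChartedSpace (EuclideanHalfSpace (n + 1)) X] {Y : Type*} [TopologicalSpace Y]
    [ChartedSpace (EuclideanHalfSpace (k + 1)) Y] (g gbar : BilinField n X) (r : X → ℝ)
    (f : Y → X) : Prop where
  compactification : IsCompactification n g gbar r
  contMDiff : ContMDiff (𝓡∂ (k + 1)) (𝓡∂ (n + 1)) 2 f
  mapsTo : ∀ y ∈ (𝓡∂ (k + 1)).interior Y, f y ∈ (𝓡∂ (n + 1)).interior X
  mapsTo_boundary : ∀ y ∈ (𝓡∂ (k + 1)).boundary Y, f y ∈ (𝓡∂ (n + 1)).boundary X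
  injective : ∀ y, Function.Injective (mfderiv (𝓡∂ (k + 1)) (𝓡∂ (n + 1)) f y)
  transversal : ∀ y ∈ (𝓡∂ (k + 1)).boundary Y,
    LinearMap.range (mfderiv (𝓡∂ (k + 1)) (𝓡∂ (n + 1)) f y).toLinearMap
      ⊔ boundaryTangent (f y) = ⊤

/-- The jet of `f`, the compactified metric and the defining function in charts. The derivatives are
two-sided, so this is meaningful only over the interior. -/
def chartJet (gbar : BilinField n X) (r : X → ℝ) (f : Y → X) (p : Y) (P : X) (q : Vec k) :
    ImmersionJet k n :=
  (chartMetric gbar P (chartMap k n f p P q),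
    fderiv ℝ (chartMetric gbar P) (chartMap k n f p P q),
    fderiv ℝ (chartMap k n f p P) q,
    fderiv ℝ (fderiv ℝ (chartMap k n f p P)) q,
    (r ∘ (extChartAt (𝓡∂ (n + 1)) P).symm) (chartMap k n f p P q),
    fderiv ℝ (r ∘ (extChartAt (𝓡∂ (n + 1)) P).symm) (chartMap k n f p P q))

/-- The jet at a boundary point `y`, made up of one-sided derivatives in the charts around `y` and
`f y`. -/
def boundaryJet (gbar : BilinField n X) (r : X → ℝ) (f : Y → X) (y : Y) : ImmersionJet k n :=
  (chartMetric gbar (f y) (chartMap k n f y (f y) (extChartAt (𝓡∂ (k + 1)) y y)),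
    fderivWithin ℝ (chartMetric gbar (f y)) (extChartAt (𝓡∂ (n + 1)) (f y)).target
      (chartMap k n f y (f y) (extChartAt (𝓡∂ (k + 1)) y y)),
    fderivWithin ℝ (chartMap k n f y (f y)) (chartDomain k n f y (f y))
      (extChartAt (𝓡∂ (k + 1)) y y),
    fderivWithin ℝ (fderivWithin ℝ (chartMap k n f y (f y)) (chartDomain k n f y (f y)))
      (chartDomain k n f y (f y)) (extChartAt (𝓡∂ (k + 1)) y y),
    (r ∘ (extChartAt (𝓡∂ (n + 1)) (f y)).symm)
      (chartMap k n f y (f y) (extChartAt (𝓡∂ (k + 1)) y y)),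
    fderivWithin ℝ (r ∘ (extChartAt (𝓡∂ (n + 1)) (f y)).symm)
      (extChartAt (𝓡∂ (n + 1)) (f y)).target
      (chartMap k n f y (f y) (extChartAt (𝓡∂ (k + 1)) y y)))

lemma apply_zero_of_mem_boundaryTangent [IsManifold (𝓡∂ (n + 1)) ∞ X] {x : X}
    {b : TangentSpace (𝓡∂ (n + 1)) x} (hb : b ∈ boundaryTangent x) :
    (show Vec n from b) 0 = 0 := by
  have : IsManifold (𝓡∂ (n + 1)) 1 X := IsManifold.of_le (n := ∞) (by simp)
  have h1 : (show Vec n from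
    mfderiv (𝓡∂ (n + 1)) 𝓘(ℝ, Vec n) (extChartAt (𝓡∂ (n + 1)) x) x b) 0 = 0 := hb
  rw [mfderiv_extChartAt_self] at h1
  exact h1

lemma chartMap_center (f : Y → X) (y : Y) : chartMap k n f y (f y) (extChartAt (𝓡∂ (k + 1)) y y) =
    extChartAt (𝓡∂ (n + 1)) (f y) (f y) := by
  rw [chartMap, extChartAt_to_inv]

lemma center_mem_chartDomain (f : Y → X) (y : Y) :
    extChartAt (𝓡∂ (k + 1)) y y ∈ chartDomain k n f y (f y) :=
  ⟨mem_extChartAt_target y, by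
    rw [mem_preimage, extChartAt_to_inv]; exact mem_extChartAt_source (I := 𝓡∂ (n + 1)) (f y)⟩

lemma chartDomain_eventuallyEq {f : Y → X} (hf : Continuous f) (y : Y) :
    chartDomain k n f y (f y) =ᶠ[𝓝 (extChartAt (𝓡∂ (k + 1)) y y)] range (𝓡∂ (k + 1)) := by
  refine EventuallyEq.trans ?_ extChartAt_target_eventuallyEq
  have h1 := chartDomain_mem_nhdsWithin hf (center_mem_chartDomain (k := k) (n := n) f y)
  filter_upwards [mem_nhdsWithin_iff_eventually.1 h1] with q hq
  exact propext ⟨fun h => h.1, fun h => hq h⟩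

/-- Interior points accumulate at every point of the chart. -/
lemma neBot_nhdsWithin_interior_chartDomain {f : Y → X} (hf : Continuous f) (y : Y) :
    (𝓝[interior (chartDomain k n f y (f y))] (extChartAt (𝓡∂ (k + 1)) y y)).NeBot := by
  have h0 : (𝓝[interior (extChartAt (𝓡∂ (k + 1)) y).target]
      (extChartAt (𝓡∂ (k + 1)) y y)).NeBot :=
    mem_closure_iff_nhdsWithin_neBot.1
      (extChartAt_target_subset_closure_interior (mem_extChartAt_target y))
  refine h0.mono (nhdsWithin_le_iff.2 ?_)
  obtain ⟨V, hV, hyV, hVs⟩ := mem_nhdsWithin.1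
    (chartDomain_mem_nhdsWithin hf (center_mem_chartDomain (k := k) (n := n) f y))
  refine mem_nhdsWithin.2 ⟨V, hV, hyV, ?_⟩
  exact interior_maximal ((inter_subset_inter_right _ interior_subset).trans hVs)
    (hV.inter isOpen_interior)

namespace IsTransversalImmersion

variable [IsManifold (𝓡∂ (n + 1)) ∞ X] [IsManifold (𝓡∂ (k + 1)) ∞ Y]
  {g gbar : BilinField n X} {r : X → ℝ} {f : Y → X} {p y : Y} {P : X} {q : Vec k}
  (h : IsTransversalImmersion k n g gbar r f)
include h

omit [IsManifold (𝓡∂ (k + 1)) ∞ Y] in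
lemma isInteriorImmersion : IsInteriorImmersion k n g f :=
  ⟨h.contMDiff, h.mapsTo, h.injective, fun _ hx => h.compactification.isInner_interior hx,
    h.compactification.contDiffOn_chartMetric⟩

lemma contDiffOn_chartMap (p : Y) (P : X) :
    ContDiffOn ℝ 2 (chartMap k n f p P) (chartDomain k n f p P) := by
  have h1 : ContMDiffOn (𝓡∂ (n + 1)) 𝓘(ℝ, Vec n) ∞ (extChartAt (𝓡∂ (n + 1)) P)
      (extChartAt (𝓡∂ (n + 1)) P).source := by
    rw [extChartAt_source]
    exact contMDiffOn_extChartAt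
  have h2 : ContMDiffOn 𝓘(ℝ, Vec k) (𝓡∂ (k + 1)) ∞ (extChartAt (𝓡∂ (k + 1)) p).symm
      (chartDomain k n f p P) := (contMDiffOn_extChartAt_symm p).mono inter_subset_left
  have h2le : (2 : WithTop ℕ∞) ≤ ((⊤ : ℕ∞) : WithTop ℕ∞) :=
    WithTop.coe_le_coe.2 (le_top : ((2 : ℕ) : ℕ∞) ≤ ⊤)
  exact contMDiffOn_iff_contDiffOn.1 ((h1.of_le h2le).comp
    (h.contMDiff.comp_contMDiffOn (h2.of_le h2le)) fun q hq => hq.2)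

omit [IsManifold (𝓡∂ (n + 1)) ∞ X] in
lemma uniqueDiffOn_chartDomain (p : Y) (P : X) : UniqueDiffOn ℝ (chartDomain k n f p P) := by
  have : IsManifold (𝓡∂ (k + 1)) 1 Y := IsManifold.of_le (n := ∞) (by simp)
  exact UniqueMDiffOn.uniqueDiffOn_target_inter
    ((isOpen_extChartAt_source P).preimage h.contMDiff.continuous).uniqueMDiffOn p

lemma tendsto_chartMap (y : Y) :
    Tendsto (chartMap k n f y (f y))
      (𝓝[interior (chartDomain k n f y (f y))] (extChartAt (𝓡∂ (k + 1)) y y))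
      (𝓝[interior (extChartAt (𝓡∂ (n + 1)) (f y)).target]
        (chartMap k n f y (f y) (extChartAt (𝓡∂ (k + 1)) y y))) := by
  refine tendsto_nhdsWithin_iff.2 ⟨tendsto_interior_of_continuousOn
    (h.contDiffOn_chartMap y (f y)).continuousOn (center_mem_chartDomain f y), ?_⟩
  filter_upwards [self_mem_nhdsWithin] with q hq using h.isInteriorImmersion.chartMap_mem hq

/-- The jets of the immersion at interior points converge at the boundary. -/
lemma tendsto_chartJet (y : Y) :
    Tendsto (chartJet gbar r f y (f y) : Vec k → ImmersionJet k n)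
      (𝓝[interior (chartDomain k n f y (f y))] (extChartAt (𝓡∂ (k + 1)) y y))
      (𝓝 (boundaryJet gbar r f y)) := by
  have hF := h.tendsto_chartMap y
  have hFc := h.contDiffOn_chartMap y (f y)
  have hu := h.uniqueDiffOn_chartDomain y (f y)
  have hm := center_mem_chartDomain (k := k) (n := n) f y
  have hz : chartMap k n f y (f y) (extChartAt (𝓡∂ (k + 1)) y y) ∈
      (extChartAt (𝓡∂ (n + 1)) (f y)).target := by
    rw [chartMap_center]; exact mem_extChartAt_target _
  have hG := h.compactification.contDiffOn (f y)
  have hρ := h.compactification.isDefiningFunction.contDiffOn_chart (f y)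
  have huX := uniqueDiffOn_extChartAt_target (I := 𝓡∂ (n + 1)) (f y)
  refine Tendsto.prodMk_nhds ?_ (Tendsto.prodMk_nhds ?_ (Tendsto.prodMk_nhds ?_
    (Tendsto.prodMk_nhds ?_ (Tendsto.prodMk_nhds ?_ ?_))))
  · exact (tendsto_interior_of_continuousOn hG.continuousOn hz).comp hF
  · exact (tendsto_fderiv_interior (hG.of_le (by norm_num)) huX hz).comp hF
  · exact tendsto_fderiv_interior (hFc.of_le (by norm_num)) hu hm
  · exact tendsto_fderiv_fderiv_interior hFc hu hm
  · exact (tendsto_interior_of_continuousOn hρ.continuousOn hz).comp hF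
  · exact (tendsto_fderiv_interior (hρ.of_le (by simp)) huX hz).comp hF

omit [IsManifold (𝓡∂ (k + 1)) ∞ Y] in
lemma isInner_boundaryJet (y : Y) :
    IsInner (ImmersionJet.metric (boundaryJet gbar r f y : ImmersionJet k n)) :=
  .chartMetric (by rw [chartMap_center]; exact mem_extChartAt_target _)
    (h.compactification.isInner _)

omit [IsManifold (𝓡∂ (n + 1)) ∞ X] [IsManifold (𝓡∂ (k + 1)) ∞ Y] in
lemma tangent_boundaryJet (y : Y) :
    ImmersionJet.tangent (boundaryJet gbar r f y) = mfderiv (𝓡∂ (k + 1)) (𝓡∂ (n + 1)) f y := by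
  rw [((h.contMDiff y).mdifferentiableAt (by norm_num)).mfderiv]
  exact fderivWithin_congr_set (chartDomain_eventuallyEq h.contMDiff.continuous y)

omit [IsManifold (𝓡∂ (n + 1)) ∞ X] [IsManifold (𝓡∂ (k + 1)) ∞ Y] in
lemma injective_boundaryJet (y : Y) :
    Function.Injective (ImmersionJet.tangent (boundaryJet gbar r f y : ImmersionJet k n)) := by
  rw [h.tangent_boundaryJet y]
  exact h.injective y

omit [IsManifold (𝓡∂ (n + 1)) ∞ X] [IsManifold (𝓡∂ (k + 1)) ∞ Y] in
lemma boundaryJet_eq_zero (hy : y ∈ (𝓡∂ (k + 1)).boundary Y) :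
    (boundaryJet gbar r f y : ImmersionJet k n).2.2.2.2.1 = 0 := by
  simp only [boundaryJet, chartMap_center, Function.comp_apply, extChartAt_to_inv]
  exact (h.compactification.isDefiningFunction.2.2 _ (h.mapsTo_boundary y hy)).1

omit [IsManifold (𝓡∂ (k + 1)) ∞ Y] in
/-- By transversality, the differential of the defining function does not vanish on the tangent
space of the submanifold. -/
lemma exists_tangent_ne_zero (hy : y ∈ (𝓡∂ (k + 1)).boundary Y) :
    ∃ a : Vec k, (boundaryJet gbar r f y : ImmersionJet k n).2.2.2.2.2
      (ImmersionJet.tangent (boundaryJet gbar r f y : ImmersionJet k n) a) ≠ 0 := by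
  by_contra! hzero
  have hx := h.mapsTo_boundary y hy
  have hr := h.compactification.isDefiningFunction
  have hc : (boundaryJet gbar r f y : ImmersionJet k n).2.2.2.2.2 =
      fderivWithin ℝ (r ∘ (extChartAt (𝓡∂ (n + 1)) (f y)).symm)
        (extChartAt (𝓡∂ (n + 1)) (f y)).target (extChartAt (𝓡∂ (n + 1)) (f y) (f y)) := by
    simp only [boundaryJet, chartMap_center]
  rw [hc, h.tangent_boundaryJet y] at hzero
  refine hr.fderivWithin_chart_ne_zero hx (ContinuousLinearMap.ext fun v => ?_)
  obtain ⟨D, hD⟩ : ∃ D : Vec k →L[ℝ] Vec n, D = mfderiv (𝓡∂ (k + 1)) (𝓡∂ (n + 1)) f y := ⟨_, rfl⟩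
  obtain ⟨a, b, hb0, rfl⟩ : ∃ (a : Vec k) (b : Vec n), b 0 = 0 ∧ D a + b = v := by
    have hv : (show TangentSpace (𝓡∂ (n + 1)) (f y) from v) ∈
        LinearMap.range (mfderiv (𝓡∂ (k + 1)) (𝓡∂ (n + 1)) f y).toLinearMap
          ⊔ boundaryTangent (f y) := by
      rw [h.transversal y hy]
      exact Submodule.mem_top
    obtain ⟨a', ⟨a, ha⟩, b, hb, hab⟩ := Submodule.mem_sup.1 hv
    refine ⟨a, b, apply_zero_of_mem_boundaryTangent hb, ?_⟩
    rw [hD]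
    rw [← ha] at hab
    exact hab
  have ha := hzero a
  rw [map_add, hr.fderivWithin_chart_eq_zero hx hb0, add_zero, hD]
  exact ha

end IsTransversalImmersion

end Boundary

/-! ### Asymptotic curvature -/

section Asymptotics

variable {n k : ℕ} {X : Type*} [TopologicalSpace X] [ChartedSpace (EuclideanHalfSpace (n + 1)) X]
  {Y : Type*} [TopologicalSpace Y] [ChartedSpace (EuclideanHalfSpace (k + 1)) Y]

/-- The squared length of the normal part of the gradient of the defining function at a boundary
point, for the compactified metric. -/
def boundaryNormalSq (k : ℕ) {n : ℕ} {X : Type*} [TopologicalSpace X]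
    [ChartedSpace (EuclideanHalfSpace (n + 1)) X] {Y : Type*} [TopologicalSpace Y]
    [ChartedSpace (EuclideanHalfSpace (k + 1)) Y] (gbar : BilinField n X) (r : X → ℝ) (f : Y → X)
    (y : Y) : ℝ :=
  let w : ImmersionJet k n := boundaryJet gbar r f y
  w.metric w.normalGrad w.normalGrad

namespace IsTransversalImmersion

variable [IsManifold (𝓡∂ (n + 1)) ∞ X] [IsManifold (𝓡∂ (k + 1)) ∞ Y]
  {g gbar : BilinField n X} {r : X → ℝ} {f : Y → X} {p y : Y} {P : X} {q : Vec k}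
  (h : IsTransversalImmersion k n g gbar r f)
include h

lemma chartJet_pos (hq : q ∈ interior (chartDomain k n f p P)) :
    0 < (chartJet gbar r f p P q : ImmersionJet k n).2.2.2.2.1 :=
  h.compactification.pos_chart (h.isInteriorImmersion.chartMap_mem hq)

lemma isInner_chartJet (hq : q ∈ interior (chartDomain k n f p P)) :
    IsInner (ImmersionJet.metric (chartJet gbar r f p P q : ImmersionJet k n)) :=
  .chartMetric (interior_subset (h.isInteriorImmersion.chartMap_mem hq))
    (h.compactification.isInner _)

lemma injective_chartJet (hq : q ∈ interior (chartDomain k n f p P)) :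
    Function.Injective (ImmersionJet.tangent (chartJet gbar r f p P q : ImmersionJet k n)) :=
  h.isInteriorImmersion.injective_fderiv hq

lemma chartMetric_eq_jet (hq : q ∈ interior (chartDomain k n f p P)) :
    chartMetric g P (chartMap k n f p P q) =
      ((chartJet gbar r f p P q : ImmersionJet k n).2.2.2.2.1 ^ 2)⁻¹ •
        ImmersionJet.metric (chartJet gbar r f p P q) :=
  h.compactification.chartMetric_eq (h.isInteriorImmersion.chartMap_mem hq)

/-- The second fundamental form for the complete metric in terms of the compactified metric. -/
lemma secondFundamentalForm_eq_jet (hq : q ∈ interior (chartDomain k n f p P)) (u v : Vec k) :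
    secondFundamentalForm (chartMetric g P) (chartMap k n f p P) q u v =
      ((chartJet gbar r f p P q : ImmersionJet k n).2.2.2.2.1)⁻¹ •
        ImmersionJet.scaledForm (chartJet gbar r f p P q) u v := by
  have hz := h.isInteriorImmersion.chartMap_mem hq
  have hzn := mem_interior_iff_mem_nhds.1 hz
  have hpos := h.chartJet_pos hq
  rw [secondFundamentalForm_congr (EventuallyEq.refl _ _)
    (h.compactification.chartMetric_eventuallyEq hz), secondFundamentalForm_conformal
    (((h.compactification.contDiffOn P).contDiffAt hzn).differentiableAt (by norm_num))
    (((h.compactification.isDefiningFunction.contDiffOn_chart P).contDiffAt hzn).differentiableAt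
      (by simp)) hpos.ne' (h.isInner_chartJet hq) (h.injective_chartJet hq),
    secondFundamentalForm_eq, ImmersionJet.scaledForm, smul_add, smul_smul, smul_smul,
    inv_mul_cancel₀ hpos.ne', one_smul]
  rfl

/-- The mean curvature in terms of the compactified metric. -/
lemma meanCurvatureNormSq_eq_jet (hq : q ∈ interior (chartDomain k n f p P)) :
    meanCurvatureNormSq k g f ((extChartAt (𝓡∂ (k + 1)) p).symm q) =
      ImmersionJet.metric (chartJet gbar r f p P q)
        (traceForm (ImmersionJet.metric (chartJet gbar r f p P q))
          (ImmersionJet.tangent (chartJet gbar r f p P q))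
          (ImmersionJet.scaledForm (chartJet gbar r f p P q)))
        (traceForm (ImmersionJet.metric (chartJet gbar r f p P q))
          (ImmersionJet.tangent (chartJet gbar r f p P q))
          (ImmersionJet.scaledForm (chartJet gbar r f p P q))) := by
  have hpos := h.chartJet_pos hq
  have hII : secondFundamentalForm (chartMetric g P) (chartMap k n f p P) q = fun u v =>
      ((chartJet gbar r f p P q : ImmersionJet k n).2.2.2.2.1)⁻¹ •
        ImmersionJet.scaledForm (chartJet gbar r f p P q) u v := by
    funext u v
    exact h.secondFundamentalForm_eq_jet hq u v
  rw [h.isInteriorImmersion.meanCurvatureNormSq_eq hq, meanCurvatureVector_eq, hII,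
    h.chartMetric_eq_jet hq]
  have htr := traceForm_smul (h.isInner_chartJet hq) (h.injective_chartJet hq)
    (ImmersionJet.scaledForm (chartJet gbar r f p P q))
    (c := ((chartJet gbar r f p P q : ImmersionJet k n).2.2.2.2.1 ^ 2)⁻¹) (by positivity)
    ((chartJet gbar r f p P q : ImmersionJet k n).2.2.2.2.1)⁻¹
  have htr' := htr
  change traceForm _ (fderiv ℝ (chartMap k n f p P) q) _ = _ at htr'
  rw [htr']
  simp only [map_smul, smul_apply, smul_eq_mul]
  field_simp

/-- The Gauss equation for sectional curvatures, in terms of the compactified metric. -/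
lemma sectional_eq_jet {Rm : FourTensorField n X} (hRm : IsCurvatureTensor g Rm)
    (hq : q ∈ interior (chartDomain k n f p P)) (u v : Vec k) :
    sectional (pullback g f : BilinField k Y) (immersionCurv g Rm f)
      ((extChartAt (𝓡∂ (k + 1)) p).symm q) (chartInvDeriv p q u) (chartInvDeriv p q v) =
    sectional g Rm (f ((extChartAt (𝓡∂ (k + 1)) p).symm q))
      (chartInvDeriv P (chartMap k n f p P q) (fderiv ℝ (chartMap k n f p P) q u))
      (chartInvDeriv P (chartMap k n f p P q) (fderiv ℝ (chartMap k n f p P) q v)) +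
    gaussTerm (ImmersionJet.metric (chartJet gbar r f p P q))
      (ImmersionJet.scaledForm (chartJet gbar r f p P q)) u v /
        areaSq (ImmersionJet.induced (chartJet gbar r f p P q)) u v := by
  have hz := h.isInteriorImmersion.chartMap_mem hq
  have hpos := h.chartJet_pos hq
  have h1 : sectional (pullback g f : BilinField k Y) (immersionCurv g Rm f)
      ((extChartAt (𝓡∂ (k + 1)) p).symm q) (chartInvDeriv p q u) (chartInvDeriv p q v) =
      gaussCurv (chartMetric g P) (chartMap k n f p P) q u v v u /
        areaSq (chartMetric (pullback g f : BilinField k Y) p q) u v := by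
    rw [sectional, h.isInteriorImmersion.immersionCurv_eq_gaussCurv hRm hq]
    rfl
  have h2 : chartMetric (pullback g f : BilinField k Y) p q =
      ((chartJet gbar r f p P q : ImmersionJet k n).2.2.2.2.1 ^ 2)⁻¹ •
        ImmersionJet.induced (chartJet gbar r f p P q) := by
    rw [chartMetric_pullback g h.contMDiff h.mapsTo hq, inducedMetric, h.chartMetric_eq_jet hq]
    rfl
  have h3 : areaSq (chartMetric (pullback g f : BilinField k Y) p q) u v =
      areaSq (chartMetric g P (chartMap k n f p P q)) (fderiv ℝ (chartMap k n f p P) q u)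
        (fderiv ℝ (chartMap k n f p P) q v) := by
    rw [chartMetric_pullback g h.contMDiff h.mapsTo hq]
    rfl
  rw [← symm_chartMap (interior_subset hq), h.compactification.sectional_chart hRm hz, h1,
    gaussCurv, ← h3, add_sub_assoc, add_div]
  congr 1
  rw [h2]
  simp only [h.secondFundamentalForm_eq_jet hq, h.chartMetric_eq_jet hq, gaussTerm, areaSq,
    map_smul, smul_apply, smul_eq_mul]
  field_simp

omit [IsManifold (𝓡∂ (k + 1)) ∞ Y] in
/-- The normal part of the gradient of the defining function is shorter than the gradient, which
has length `1`. -/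
lemma boundaryNormalSq_lt_one {Rm : FourTensorField n X} (hRm : IsCurvatureTensor g Rm)
    (hsec : ∀ ε > 0, ∀ᶠ x in 𝓝ˢ ((𝓡∂ (n + 1)).boundary X), x ∈ (𝓡∂ (n + 1)).interior X →
      ∀ u v : Vec n, LinearIndependent ℝ ![u, v] → |sectional g Rm x u v - (-1)| < ε)
    (hy : y ∈ (𝓡∂ (k + 1)).boundary Y) :
    boundaryNormalSq k gbar r f y < 1 := by
  have hi := h.isInner_boundaryJet y
  have hinj := h.injective_boundaryJet y
  by_cases hn : n = 0
  · -- In dimension one there is no sectional curvature, but also no room for a normal vector.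
    have hsurj : Function.Surjective
        (ImmersionJet.tangent (boundaryJet gbar r f y : ImmersionJet k n)) := by
      have h1 := LinearMap.finrank_le_finrank_of_injective
        (f := (ImmersionJet.tangent (boundaryJet gbar r f y : ImmersionJet k n)).toLinearMap) hinj
      have h2 : Module.finrank ℝ (Vec k) = Module.finrank ℝ (Vec n) := by
        simp only [finrank_euclideanSpace, Fintype.card_fin] at h1 ⊢
        omega
      exact (LinearMap.injective_iff_surjective_of_finrank_eq_finrank h2
        (f := (ImmersionJet.tangent
          (boundaryJet gbar r f y : ImmersionJet k n)).toLinearMap)).1 hinj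
    rw [boundaryNormalSq, ImmersionJet.normalGrad_eq_zero hi hinj hsurj]
    simp
  · obtain ⟨a, ha⟩ := h.exists_tangent_ne_zero hy
    have h1 := ImmersionJet.normalGrad_lt hi hinj ha
    have h2 := h.compactification.inverse_fderivWithin_eq_one hRm hn hsec
      (h.mapsTo_boundary y hy)
    rw [← chartMap_center (k := k) f y] at h2
    exact h1.trans_eq h2

omit h [IsManifold (𝓡∂ (n + 1)) ∞ X] in
lemma tendsto_symm (hy : y ∈ (𝓡∂ (k + 1)).boundary Y) :
    Tendsto (extChartAt (𝓡∂ (k + 1)) y).symm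
      (𝓝[interior (chartDomain k n f y (f y))] (extChartAt (𝓡∂ (k + 1)) y y))
      (𝓝ˢ ((𝓡∂ (k + 1)).boundary Y) ⊓ 𝓟 ((𝓡∂ (k + 1)).interior Y)) := by
  refine tendsto_inf.2 ⟨?_, tendsto_principal.2 ?_⟩
  · have h1 := tendsto_interior_of_continuousOn ((continuousOn_extChartAt_symm y).mono
      (inter_subset_left : chartDomain k n f y (f y) ⊆ _)) (center_mem_chartDomain f y)
    rw [extChartAt_to_inv] at h1
    exact h1.mono_right (nhds_le_nhdsSet hy)
  · filter_upwards [self_mem_nhdsWithin] with q hq using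
      symm_mem_interior (interior_chartDomain_subset hq)

/-- The asymptotic mean curvature determines the normal part of the gradient of the defining
function at the boundary. -/
lemma boundaryNormalSq_eq {C : ℝ}
    (hH : Tendsto (meanCurvatureNormSq k g f)
      (𝓝ˢ ((𝓡∂ (k + 1)).boundary Y) ⊓ 𝓟 ((𝓡∂ (k + 1)).interior Y)) (𝓝 (C ^ 2)))
    (hy : y ∈ (𝓡∂ (k + 1)).boundary Y) :
    boundaryNormalSq k gbar r f y =
      C ^ 2 / ((k : ℝ) + 1) ^ 2 := by
  have h1 := (ImmersionJet.tendsto_trace (h.isInner_boundaryJet y) (h.injective_boundaryJet y)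
    (h.boundaryJet_eq_zero hy)).comp (h.tendsto_chartJet y)
  have h2 := hH.comp (tendsto_symm (n := n) (f := f) hy)
  have := neBot_nhdsWithin_interior_chartDomain (k := k) (n := n) h.contMDiff.continuous y
  have h3 := tendsto_nhds_unique (h1.congr' ?_) h2
  · rw [eq_div_iff (by positivity), ← h3, mul_comm]
    rfl
  · filter_upwards [self_mem_nhdsWithin] with q hq using (h.meanCurvatureNormSq_eq_jet hq).symm

omit [IsManifold (𝓡∂ (n + 1)) ∞ X] in
lemma tendsto_extChartAt (y : Y) :
    Tendsto (extChartAt (𝓡∂ (k + 1)) y) (𝓝[(𝓡∂ (k + 1)).interior Y] y)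
      (𝓝[interior (chartDomain k n f y (f y))] (extChartAt (𝓡∂ (k + 1)) y y)) := by
  refine tendsto_nhdsWithin_iff.2
    ⟨(continuousAt_extChartAt (I := 𝓡∂ (k + 1)) y).mono_left nhdsWithin_le_nhds, ?_⟩
  filter_upwards [self_mem_nhdsWithin,
    mem_nhdsWithin_of_mem_nhds (extChartAt_source_mem_nhds (I := 𝓡∂ (k + 1)) y),
    mem_nhdsWithin_of_mem_nhds (h.contMDiff.continuous.continuousAt.preimage_mem_nhds
      (extChartAt_source_mem_nhds (I := 𝓡∂ (n + 1)) (f y)))] with y' h1 h2 h3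
  refine mem_interior_chartDomain h.contMDiff.continuous (mem_interior_target h2 h1) ?_
  rw [(extChartAt (𝓡∂ (k + 1)) y).left_inv h2]
  exact h3

/-- The sectional curvatures of the submanifold near a boundary point: the ambient ones contribute
`-1` and the second fundamental form contributes the squared length of the normal gradient. -/
lemma eventually_sectional {Rm : FourTensorField n X} (hRm : IsCurvatureTensor g Rm)
    (hsec : ∀ ε > 0, ∀ᶠ x in 𝓝ˢ ((𝓡∂ (n + 1)).boundary X), x ∈ (𝓡∂ (n + 1)).interior X →
      ∀ u v : Vec n, LinearIndependent ℝ ![u, v] → |sectional g Rm x u v - (-1)| < ε)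
    (hy : y ∈ (𝓡∂ (k + 1)).boundary Y) {ε : ℝ} (hε : 0 < ε) :
    ∀ᶠ y' in 𝓝 y, y' ∈ (𝓡∂ (k + 1)).interior Y → ∀ u v : Vec k, LinearIndependent ℝ ![u, v] →
      |sectional (pullback g f : BilinField k Y) (immersionCurv g Rm f) y' u v -
        (-1 + boundaryNormalSq k gbar r f y)| < ε := by
  have h1 := (h.tendsto_extChartAt y).eventually ((h.tendsto_chartJet y).eventually
    (ImmersionJet.eventually_gaussTerm (h.isInner_boundaryJet y) (h.injective_boundaryJet y)
      (h.boundaryJet_eq_zero hy) (half_pos hε)))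
  have h2 := h.contMDiff.continuous.continuousAt.eventually
    ((hsec (ε / 2) (half_pos hε)).filter_mono (nhds_le_nhdsSet (h.mapsTo_boundary y hy)))
  have h3 := (h.tendsto_extChartAt y).eventually self_mem_nhdsWithin
  filter_upwards [eventually_nhdsWithin_iff.1 h1, h2, eventually_nhdsWithin_iff.1 h3,
    extChartAt_source_mem_nhds (I := 𝓡∂ (k + 1)) y] with y' hy1 hy2 hy3 hys hyi u' v' huv'
  have hq := hy3 hyi
  have hL := bijective_chartInvDeriv (interior_subset (interior_chartDomain_subset hq))
  have hJ := bijective_chartInvDeriv (interior_subset (h.isInteriorImmersion.chartMap_mem hq))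
  obtain ⟨u, rfl⟩ := hL.2 u'
  obtain ⟨v, rfl⟩ := hL.2 v'
  have huv : LinearIndependent ℝ ![u, v] := by
    rw [LinearIndependent.pair_iff] at huv' ⊢
    intro a b hab
    refine huv' a b ?_
    rw [← map_smul, ← map_smul, ← map_add, hab, map_zero]
  have e1 := h.sectional_eq_jet hRm hq u v
  have e2 := hy1 hyi (h.isInner_chartJet hq) (h.injective_chartJet hq) u v huv
  have e3 := hy2 (h.mapsTo _ hyi) _ _ (linearIndependent_pair_map hJ.1
    (linearIndependent_pair_map (h.injective_chartJet hq) huv))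
  rw [(extChartAt (𝓡∂ (k + 1)) y).left_inv hys] at e1
  rw [e1]
  refine lt_of_le_of_lt ?_ ((add_lt_add e3 e2).trans_eq (add_halves ε))
  refine le_trans (le_of_eq ?_) (abs_add_le _ _)
  congr 1
  simp only [boundaryNormalSq, chartJet]
  ring

end IsTransversalImmersion

lemma IsHolderMap.contMDiff {m : ℕ} {β : ℝ≥0} {f : Y → X} (hf : IsHolderMap k n m β f) :
    ContMDiff (𝓡∂ (k + 1)) (𝓡∂ (n + 1)) m f := by
  refine fun p => contMDiffAt_iff.2 ⟨hf.1.continuousAt, ?_⟩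
  refine ((hf.2 p).1 _ (center_mem_chartDomain f p)).mono_of_mem_nhdsWithin ?_
  rw [mem_nhdsWithin_iff_eventually]
  filter_upwards [chartDomain_eventuallyEq (n := n) hf.1 p] with q hq hq'
  exact hq.mpr hq'

lemma IsConformallyCompact.exists_isCompactification {m : ℕ} {α : ℝ≥0} {g : BilinField n X}
    (hm : 2 ≤ m) (hg : IsConformallyCompact m α g) :
    ∃ (gbar : BilinField n X) (r : X → ℝ), IsCompactification n g gbar r := by
  obtain ⟨-, -, -, r, hr, gbar, h1, h2, h3⟩ := hg
  exact ⟨gbar, r, hr, fun x => h1 x (mem_univ x),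
    fun P => (h2 P).1.of_le (by exact_mod_cast hm), h3⟩

lemma IsDefiningFunction.tendsto_comp {r : X → ℝ} (hr : IsDefiningFunction n r) {f : Y → X}
    (hf : Continuous f)
    (hfb : ∀ y ∈ (𝓡∂ (k + 1)).boundary Y, f y ∈ (𝓡∂ (n + 1)).boundary X) :
    Tendsto (fun y => r (f y)) (𝓝ˢ ((𝓡∂ (k + 1)).boundary Y)) (𝓝 0) := by
  rw [Metric.tendsto_nhds]
  refine fun ε hε => eventually_nhdsSet_iff_forall.2 fun y hy => ?_
  have h1 : Tendsto (fun y => r (f y)) (𝓝 y) (𝓝 (r (f y))) :=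
    (hr.1.continuous.comp hf).continuousAt
  rw [(hr.2.2 _ (hfb y hy)).1] at h1
  exact Metric.tendsto_nhds.1 h1 ε hε

variable [IsManifold (𝓡∂ (n + 1)) ∞ X] [IsManifold (𝓡∂ (k + 1)) ∞ Y]

/-- The asymptotic mean curvature is less than `k + 1` and determines the asymptotic sectional
curvature. -/
theorem IsAsymptoticallyCMC.isAsymptoticallyHyperbolic {α β : ℝ≥0} {m : ℕ} {g : BilinField n X}
    (hg : IsAsymptoticallyHyperbolic 3 α g (-1)) {f : Y → X} {C : ℝ}
    (hf : IsAsymptoticallyCMC k m β g f C) :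
    C < k + 1 ∧ IsAsymptoticallyHyperbolic m β (pullback g f : BilinField k Y)
      (-(1 - C ^ 2 / ((k : ℝ) + 1) ^ 2)) := by
  obtain ⟨hgc, -, Rm, hRm, hsec⟩ := hg
  obtain ⟨gbar, r, hcomp⟩ := hgc.exists_isCompactification (by norm_num)
  obtain ⟨⟨hHol, hinj, hmaps, hmapsb, htrans, hYc⟩, hC0, r', hr', hO⟩ := hf
  have h : IsTransversalImmersion k n g gbar r f :=
    ⟨hcomp, hHol.contMDiff, hmaps, hmapsb, hinj, htrans⟩
  have hH : Tendsto (meanCurvatureNormSq k g f)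
      (𝓝ˢ ((𝓡∂ (k + 1)).boundary Y) ⊓ 𝓟 ((𝓡∂ (k + 1)).interior Y)) (𝓝 (C ^ 2)) := by
    have h0 := hO.trans_tendsto
      ((hr'.tendsto_comp h.contMDiff.continuous hmapsb).mono_left inf_le_left)
    have h1 := h0.add_const (C ^ 2)
    simp only [sub_add_cancel, zero_add] at h1
    exact h1
  have hlt : ∀ y ∈ (𝓡∂ (k + 1)).boundary Y, C ^ 2 / ((k : ℝ) + 1) ^ 2 < 1 := fun y hy => by
    rw [← h.boundaryNormalSq_eq hH hy]
    exact h.boundaryNormalSq_lt_one hRm hsec hy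
  -- the boundary of `Y` is non-empty
  obtain ⟨y₀, hy₀⟩ := hYc.1
  have h1 := hlt y₀ hy₀
  refine ⟨?_, hYc, by linarith, immersionCurv g Rm f,
    h.isInteriorImmersion.isCurvatureTensor_immersionCurv hRm, fun ε hε =>
      eventually_nhdsSet_iff_forall.2 fun y hy => ?_⟩
  · rw [div_lt_one (by positivity)] at h1
    exact lt_of_pow_lt_pow_left₀ 2 (by positivity) h1
  · have h2 := h.eventually_sectional hRm hsec hy hε
    rw [h.boundaryNormalSq_eq hH hy] at h2
    convert h2 using 11
    ring

end Asymptotics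

end

end AHGeometry

theorem mainTheorem2 {n k : ℕ}
    {X : Type*} [TopologicalSpace X] [T2Space X] [CompactSpace X]
    [ChartedSpace (EuclideanHalfSpace (n + 1)) X] [IsManifold (𝓡∂ (n + 1)) ∞ X]
    {Y : Type*} [TopologicalSpace Y] [T2Space Y] [CompactSpace Y]
    [ChartedSpace (EuclideanHalfSpace (k + 1)) Y] [IsManifold (𝓡∂ (k + 1)) ∞ Y]
    (α β : ℝ≥0) (hα : 0 < α) (hα' : α ≤ 1) (hβ : 0 < β) (hβ' : β ≤ 1)
    (m : ℕ) (hm : 1 ≤ m)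
    (g : AHGeometry.BilinField n X)
    (hg : AHGeometry.IsAsymptoticallyHyperbolic 3 α g (-1))
    (f : Y → X) (C : ℝ)
    (hf : AHGeometry.IsAsymptoticallyCMC k m β g f C) :
    C < k + 1 ∧
    AHGeometry.IsAsymptoticallyHyperbolic m β
      (AHGeometry.pullback g f : AHGeometry.BilinField k Y) (-(1 - C ^ 2 / ((k : ℝ) + 1) ^ 2)) ∧
    (C = 0 → AHGeometry.IsAsymptoticallyHyperbolic m β
      (AHGeometry.pullback g f : AHGeometry.BilinField k Y) (-1)) := by
  have h := AHGeometry.IsAsymptoticallyCMC.isAsymptoticallyHyperbolic hg hf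
  refine ⟨h.1, h.2, fun hC => ?_⟩
  have h2 := h.2
  rw [hC] at h2
  simpa using h2
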